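/- All graphs are finite and simple. A tree decomposition of a graph $G$ is a tree $T$ with a bag $X_t\subseteq V(G)$ for every $t\in V(T)$ such that every vertex of $G$ is in a bag, both ends of every edge of $G$ are in a common bag, and for every $v\in V(G)$ the nodes $t$ with $v\in X_t$ induce a connected subgraph of $T$. Its independence number is $\max_{t\in V(T)}\alpha(G[X_t])$. For a finite family $\mathcal H=\{H_j\}_{j\in J}$ of connected nonnull subgraphs of $G$, an independent $\mathcal H$-packing is a subfamily $\{H_i\}_{i\in I}$, $I\subseteq J$, whose members are pairwise vertex-disjoint and such that no edge of $G$ joins two different members. Given $G$, $\mathcal H$ and weights $w:J\to\mathbb Q_{\ge 0}$, the problem Max Weight Independent Packing asks for an independent $\mathcal H$-packing that maximizes $\sum_{i\in I}w_i$. For a finite set $\mathcal F$ of connected nonnull graphs, Max Weight Independent $\mathcal F$-Packing is the special case in which $\mathcal H=\mathcal H(G,\mathcal F)$ is the set of all subgraphs of $G$ that are isomorphic to a member of $\mathcal F$. Running times are those of a random access machine whose words have $O(\log(|V(G)|\cdot|V(T)|))$ bits, with unit-cost operations on words and unit-cost addition, subtraction and comparison of rational weights. $G$ is given by its adjacency matrix,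 $T$ by adjacency lists, and bags and the subgraphs $H_j$ by lists of their elements (vertices, and edges). Theorem. Let $k$ and $r$ be positive integers. Given a nonnull graph $G$, a finite family $\mathcal H=\{H_j\}_{j\in J}$ of pairwise distinct connected nonnull subgraphs of $G$ with $|V(H_j)|\le r$ for all $j\in J$, weights $w:J\to\mathbb Q_{\ge 0}$, and a tree decomposition $(T,\{X_t\}_{t\in V(T)})$ of $G$ with independence number at most $k$, Max Weight Independent Packing can be solved in time $O\big(|V(G)|^{r(k+1)}\cdot|V(T)|\big)$, where the constant depends only on $k$ and $r$. Corollary. Let $\mathcal F$ be a nonempty finite set of connected nonnull graphs, let $r$ be the maximum number of vertices of a graph in $\mathcal F$, and let $k\ge 1$. Given a nonnull graph $G$, a tree decomposition $(T,\{X_t\}_{t\in V(T)})$ of $G$ with independence number at most $k$, and weights on $\mathcal H(G,\mathcal F)$ (given as a table in which the weight of the image of an injective homomorphism $f:F\to G$, $F\in\mathcal F$, can be looked up from $F$ and $f$ in unit time), Max Weight Independent $\mathcal F$-Packing can be solved in time $O\big(|V(G)|^{r(k+1)}\cdot|V(T)|\big)$, where the constant depends only on $\mathcal F$ and $k$. 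-/

import Mathlib

/-! ### Tree decompositions and independent packings -/

/-- A tree decomposition of a graph `G`: a tree `T` on the node type `τ`, and a bag of vertices of
`G` for every node, such that every vertex is in a bag, both ends of every edge are in a common
bag, and the nodes whose bags contain a given vertex induce a connected subgraph of `T`. -/
structure TreeDecomposition {V : Type*} (G : SimpleGraph V) (τ : Type*) where
  T : SimpleGraph τ
  isTree : T.IsTree
  bag : τ → Set V
  exists_mem_bag : ∀ v, ∃ t, v ∈ bag t
  exists_edge_bag : ∀ u v, G.Adj u v → ∃ t, u ∈ bag t ∧ v ∈ bag t
  connected_bags : ∀ v, (T.induce {t | v ∈ bag t}).Connected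

/-- The independence number of a tree decomposition: the maximum over all nodes `t` of the
independence number of the subgraph of `G` induced by the bag of `t`. -/
noncomputable def TreeDecomposition.independenceNumber {V τ : Type*} [Fintype τ]
    {G : SimpleGraph V} (D : TreeDecomposition G τ) : ℕ :=
  Finset.univ.sup fun t => (G.induce (D.bag t)).indepNum

/-- `{H j}_{j ∈ I}` is an independent packing in `G`: any two of its members are vertex-disjoint
and no edge of `G` joins them. -/
def IsIndependentPacking {V J : Type*} {G : SimpleGraph V} (H : J → G.Subgraph)
    (I : Finset J) : Prop :=
  ∀ i ∈ I, ∀ j ∈ I, i ≠ j →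
    Disjoint (H i).verts (H j).verts ∧ ∀ u ∈ (H i).verts, ∀ v ∈ (H j).verts, ¬ G.Adj u v

/-- `I` is an optimal solution of the Max Weight Independent Packing problem. -/
def IsMaxWeightIndependentPacking {V J : Type*} {G : SimpleGraph V} (H : J → G.Subgraph)
    (w : J → ℚ≥0) (I : Finset J) : Prop :=
  IsIndependentPacking H I ∧
    ∀ I' : Finset J, IsIndependentPacking H I' → ∑ i ∈ I', w i ≤ ∑ i ∈ I, w i

/-- The set of all subgraphs of `G` that are isomorphic to a member of the family `F`. -/
def subgraphsIsoTo {V ι : Type*} {U : ι → Type*} (G : SimpleGraph V)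
    (F : ∀ i, SimpleGraph (U i)) : Set G.Subgraph :=
  {H | ∃ i, Nonempty (F i ≃g H.coe)}

/-! ### The machine model

A random access machine with programs in structured form. Its memory consists of arrays of natural
numbers ("words") and of arrays of rational numbers ("weights"). All arrays are indexed by pairs of
words; the name of an array is a constant of the program, so a program uses finitely many of them.
On words there are the usual arithmetic operations and comparisons; weights can only be added,
subtracted and compared. A word that is stored must not exceed a given bound `W`, and
assignments, tests and `skip` take unit time. -/

/-- The memory: word arrays `nat a` and weight arrays `wt a`, for `a : ℕ`. -/
structure RamState where
  nat : ℕ → ℕ → ℕ → ℕ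
  wt : ℕ → ℕ → ℕ → ℚ

/-- Store the word `x` in cell `(i, j)` of the word array `a`. -/
def RamState.setNat (s : RamState) (a i j x : ℕ) : RamState where
  nat a' i' j' := if a' = a ∧ i' = i ∧ j' = j then x else s.nat a' i' j'
  wt := s.wt

/-- Store the weight `x` in cell `(i, j)` of the weight array `a`. -/
def RamState.setWt (s : RamState) (a i j : ℕ) (x : ℚ) : RamState where
  nat := s.nat
  wt a' i' j' := if a' = a ∧ i' = i ∧ j' = j then x else s.wt a' i' j'

/-- Expressions for words; `read a i j` is the content of cell `(i, j)` of the word array `a`. -/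
inductive NatExpr : Type
  | const (c : ℕ) : NatExpr
  | read (a : ℕ) (i j : NatExpr) : NatExpr
  | add (x y : NatExpr) : NatExpr
  | sub (x y : NatExpr) : NatExpr
  | mul (x y : NatExpr) : NatExpr
  | div (x y : NatExpr) : NatExpr
  | mod (x y : NatExpr) : NatExpr
  | lt (x y : NatExpr) : NatExpr
  | eq (x y : NatExpr) : NatExpr

/-- The value of a word expression; comparisons have value `1` if they hold and `0` otherwise. -/
def NatExpr.eval (s : RamState) : NatExpr → ℕ
  | const c => c
  | read a i j => s.nat a (i.eval s) (j.eval s)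
  | add x y => x.eval s + y.eval s
  | sub x y => x.eval s - y.eval s
  | mul x y => x.eval s * y.eval s
  | div x y => x.eval s / y.eval s
  | mod x y => x.eval s % y.eval s
  | lt x y => if x.eval s < y.eval s then 1 else 0
  | eq x y => if x.eval s = y.eval s then 1 else 0

/-- Expressions for weights. -/
inductive WtExpr : Type
  | zero : WtExpr
  | read (a : ℕ) (i j : NatExpr) : WtExpr
  | add (x y : WtExpr) : WtExpr
  | sub (x y : WtExpr) : WtExpr

/-- The value of a weight expression. -/
def WtExpr.eval (s : RamState) : WtExpr → ℚ
  | zero => 0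
  | read a i j => s.wt a (i.eval s) (j.eval s)
  | add x y => x.eval s + y.eval s
  | sub x y => x.eval s - y.eval s

/-- Programs: `set a i j e` stores the value of `e` in cell `(i, j)` of the word array `a`,
`setW` does the same for weights, `cond e P Q` runs `P` if the value of `e` is nonzero and `Q`
otherwise, `condLe x y P Q` runs `P` if the weight `x` is at most the weight `y` and `Q` otherwise,
and `loop e P` repeats `P` as long as the value of `e` is nonzero. -/
inductive RamProgram : Type
  | skip : RamProgram
  | set (a : ℕ) (i j e : NatExpr) : RamProgram
  | setW (a : ℕ) (i j : NatExpr) (e : WtExpr) : RamProgram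
  | seq (P Q : RamProgram) : RamProgram
  | cond (e : NatExpr) (P Q : RamProgram) : RamProgram
  | condLe (x y : WtExpr) (P Q : RamProgram) : RamProgram
  | loop (e : NatExpr) (P : RamProgram) : RamProgram

/-- `Runs W P s t s'`: with words bounded by `W`, the program `P` started in memory `s` halts after
exactly `t` steps, in memory `s'`. -/
inductive Runs (W : ℕ) : RamProgram → RamState → ℕ → RamState → Prop
  | skip (s : RamState) : Runs W .skip s 1 s
  | set (a : ℕ) (i j e : NatExpr) (s : RamState) (h : e.eval s ≤ W) :
      Runs W (.set a i j e) s 1 (s.setNat a (i.eval s) (j.eval s) (e.eval s))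
  | setW (a : ℕ) (i j : NatExpr) (e : WtExpr) (s : RamState) :
      Runs W (.setW a i j e) s 1 (s.setWt a (i.eval s) (j.eval s) (e.eval s))
  | seq {P Q : RamProgram} {s s' s'' : RamState} {t t' : ℕ} (h : Runs W P s t s')
      (h' : Runs W Q s' t' s'') : Runs W (.seq P Q) s (t + t') s''
  | cond_true {e : NatExpr} {P Q : RamProgram} {s s' : RamState} {t : ℕ} (he : e.eval s ≠ 0)
      (h : Runs W P s t s') : Runs W (.cond e P Q) s (t + 1) s'
  | cond_false {e : NatExpr} {P Q : RamProgram} {s s' : RamState} {t : ℕ} (he : e.eval s = 0)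
      (h : Runs W Q s t s') : Runs W (.cond e P Q) s (t + 1) s'
  | condLe_true {x y : WtExpr} {P Q : RamProgram} {s s' : RamState} {t : ℕ}
      (he : x.eval s ≤ y.eval s) (h : Runs W P s t s') : Runs W (.condLe x y P Q) s (t + 1) s'
  | condLe_false {x y : WtExpr} {P Q : RamProgram} {s s' : RamState} {t : ℕ}
      (he : ¬ x.eval s ≤ y.eval s) (h : Runs W Q s t s') : Runs W (.condLe x y P Q) s (t + 1) s'
  | loop_stop {e : NatExpr} {P : RamProgram} {s : RamState} (he : e.eval s = 0) :
      Runs W (.loop e P) s 1 s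
  | loop_step {e : NatExpr} {P : RamProgram} {s s' s'' : RamState} {t t' : ℕ}
      (he : e.eval s ≠ 0) (h : Runs W P s t s') (h' : Runs W (.loop e P) s' t' s'') :
      Runs W (.loop e P) s (t + t' + 1) s''

/-- The machine is deterministic. -/
theorem Runs.deterministic {W : ℕ} {P : RamProgram} {s s₁ s₂ : RamState} {t₁ t₂ : ℕ}
    (h₁ : Runs W P s t₁ s₁) (h₂ : Runs W P s t₂ s₂) : t₁ = t₂ ∧ s₁ = s₂ := by
  induction h₁ generalizing t₂ s₂ with
  | skip s => cases h₂; exact ⟨rfl, rfl⟩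
  | set a i j e s h => cases h₂; exact ⟨rfl, rfl⟩
  | setW a i j e s => cases h₂; exact ⟨rfl, rfl⟩
  | seq _ _ ih ih' =>
    cases h₂ with
    | seq k k' =>
      obtain ⟨rfl, rfl⟩ := ih k
      obtain ⟨rfl, rfl⟩ := ih' k'
      exact ⟨rfl, rfl⟩
  | cond_true he _ ih =>
    cases h₂ with
    | cond_true _ k => obtain ⟨rfl, rfl⟩ := ih k; exact ⟨rfl, rfl⟩
    | cond_false he' _ => exact absurd he' he
  | cond_false he _ ih =>
    cases h₂ with
    | cond_true he' _ => exact absurd he he'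
    | cond_false _ k => obtain ⟨rfl, rfl⟩ := ih k; exact ⟨rfl, rfl⟩
  | condLe_true he _ ih =>
    cases h₂ with
    | condLe_true _ k => obtain ⟨rfl, rfl⟩ := ih k; exact ⟨rfl, rfl⟩
    | condLe_false he' _ => exact absurd he he'
  | condLe_false he _ ih =>
    cases h₂ with
    | condLe_true he' _ => exact absurd he' he
    | condLe_false _ k => obtain ⟨rfl, rfl⟩ := ih k; exact ⟨rfl, rfl⟩
  | loop_stop he =>
    cases h₂ with
    | loop_stop _ => exact ⟨rfl, rfl⟩
    | loop_step he' _ _ => exact absurd he he'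
  | loop_step he _ _ ih ih' =>
    cases h₂ with
    | loop_stop he' => exact absurd he' he
    | loop_step _ k k' =>
      obtain ⟨rfl, rfl⟩ := ih k
      obtain ⟨rfl, rfl⟩ := ih' k'
      exact ⟨rfl, rfl⟩

/-! ### Representation of the inputs and outputs

Vertices of `G`, nodes of `T` and members of the family of subgraphs are numbered from `0`. The
graph `G` is given by its adjacency matrix, the tree `T` by adjacency lists, and sets by lists
without repetitions, in any order. -/

/-- `f 0, …, f (len - 1)` is a list of the elements of `S`, without repetitions. -/
def ListsSet {n : ℕ} (len : ℕ) (f : ℕ → ℕ) (S : Set (Fin n)) : Prop :=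
  ∃ e : Fin len → Fin n, Function.Injective e ∧ Set.range e = S ∧ ∀ x : Fin len, f x = e x

/-- The pairs `f x, g x` for `x < len` are a list of the edges in `S`, without repetitions. -/
def ListsEdges {n : ℕ} (len : ℕ) (f g : ℕ → ℕ) (S : Set (Sym2 (Fin n))) : Prop :=
  ∃ a b : Fin len → Fin n, Function.Injective (fun x => s(a x, b x)) ∧
    Set.range (fun x => s(a x, b x)) = S ∧ ∀ x : Fin len, f x = a x ∧ g x = b x

/-- A graph with a tree decomposition, in the word arrays `0` (the numbers of vertices and nodes),
`1` (adjacency matrix of `G`), `2`, `3` (degrees and adjacency lists of `T`) and `4`, `5` (sizes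
and lists of the bags). -/
def RepresentsDecomposedGraph (s : RamState) {n m : ℕ} (G : SimpleGraph (Fin n))
    (D : TreeDecomposition G (Fin m)) : Prop :=
  s.nat 0 0 0 = n ∧ s.nat 0 0 1 = m ∧
  (∀ u v : Fin n, (G.Adj u v → s.nat 1 u v = 1) ∧ (¬ G.Adj u v → s.nat 1 u v = 0)) ∧
  (∀ t : Fin m, ListsSet (s.nat 2 t 0) (s.nat 3 t) (D.T.neighborSet t)) ∧
  (∀ t : Fin m, ListsSet (s.nat 4 t 0) (s.nat 5 t) (D.bag t))

/-- An input of Max Weight Independent Packing. In addition to the graph and its tree decomposition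
it consists of the size of the family (cell `(0, 2)` of word array `0`), the vertex sets of its
members (word arrays `6`, `7`: sizes and lists), their edge sets (word arrays `8`, `9`, `10`: sizes
and lists of first and second ends) and their weights (weight array `0`). All other arrays are
zero. -/
def RepresentsPackingInput (s : RamState) {n m p : ℕ} (G : SimpleGraph (Fin n))
    (D : TreeDecomposition G (Fin m)) (H : Fin p → G.Subgraph) (w : Fin p → ℚ≥0) : Prop :=
  RepresentsDecomposedGraph s G D ∧
  s.nat 0 0 2 = p ∧
  (∀ j : Fin p, ListsSet (s.nat 6 j 0) (s.nat 7 j) (H j).verts) ∧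
  (∀ j : Fin p, ListsEdges (s.nat 8 j 0) (s.nat 9 j) (s.nat 10 j) (H j).edgeSet) ∧
  (∀ j : Fin p, s.wt 0 j 0 = (w j : ℚ)) ∧
  (∀ a, 11 ≤ a → s.nat a = 0) ∧ (∀ a, 1 ≤ a → s.wt a = 0)

/-- The output `I ⊆ {0, …, p - 1}`: word array `11` holds the size of `I`, word array `12` a list of
its elements. -/
def OutputsIndexSet (s : RamState) {p : ℕ} (I : Finset (Fin p)) : Prop :=
  ListsSet (s.nat 11 0 0) (s.nat 12 0) (I : Set (Fin p))

/-- The code of a map `f` from `{0, …, a - 1}` to `{0, …, n - 1}`: the number whose digits in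
base `n` are `f 0, …, f (a - 1)`, least significant digit first. -/
def mapCode {a n : ℕ} (f : Fin a → Fin n) : ℕ := ∑ x : Fin a, (f x : ℕ) * n ^ (x : ℕ)

/-- An input of Max Weight Independent `F`-Packing, for a fixed family `F`: a graph with a tree
decomposition and the weights of the subgraphs of `G` that are isomorphic to a member of `F`. The
weights are looked up in the weight arrays `0, …, q - 1`: for every injective homomorphism `f`
from `F i` to `G`, cell `(mapCode f, 0)` of weight array `i` is the weight of the subgraph of `G`
that is the image of `f`. All other arrays are zero. -/
def RepresentsFPackingInput (s : RamState) {n m q : ℕ} (G : SimpleGraph (Fin n))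
    (D : TreeDecomposition G (Fin m)) {size : Fin q → ℕ} (F : ∀ i, SimpleGraph (Fin (size i)))
    (w : subgraphsIsoTo G F → ℚ≥0) : Prop :=
  RepresentsDecomposedGraph s G D ∧
  (∀ (i : Fin q) (f : SimpleGraph.Copy (F i) G) (H : subgraphsIsoTo G F),
    H.1 = f.toSubgraph → s.wt i (mapCode f) 0 = (w H : ℚ)) ∧
  (∀ a, 6 ≤ a → s.nat a = 0) ∧ (∀ a, q ≤ a → s.wt a = 0)

/-- The output, a set `I` of subgraphs isomorphic to members of `F`: cell `(0, 0)` of word array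
`11` holds the size of `I`, and the cells `(x, 0)` and `(x, 1)` of word array `12` hold a number `i`
and the code of an injective homomorphism from `F i` to `G` whose image is the `x`-th member
of `I`. -/
def OutputsSubgraphs (s : RamState) {n q : ℕ} {G : SimpleGraph (Fin n)} {size : Fin q → ℕ}
    (F : ∀ i, SimpleGraph (Fin (size i))) (I : Finset (subgraphsIsoTo G F)) : Prop :=
  ∃ e : Fin (s.nat 11 0 0) → subgraphsIsoTo G F, Function.Injective e ∧ Set.range e = (I : Set _) ∧
    ∀ x : Fin (s.nat 11 0 0), ∃ (i : Fin q) (f : SimpleGraph.Copy (F i) G),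
      s.nat 12 x 0 = i ∧ s.nat 12 x 1 = mapCode f ∧ (e x).1 = f.toSubgraph

/-! Say that two members of the family conflict if they share a vertex or are joined by an edge of
`G`; a member then conflicts with itself. Independent packings are the conflict-free sets, so the
task is to find an independent set of maximum weight in the conflict graph. This graph inherits the
tree: the new bag of a node consists of the members that meet the old bag. Since members are
connected, the nodes whose bags contain a given member form a subtree, and conflicting members have
a common bag. The independence number does not grow: from each member of a conflict-free part of a
new bag choose a vertex in the old bag; the chosen vertices are distinct and pairwise nonadjacent,
so there are at most `k` of them (`TreeDecomposition.isRootedDecomposition`).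

Hence a packing meets each bag in at most `k` of the `p` members and is recorded there by a
`k`-tuple over `p + 1` symbols, the symbol `p` meaning an empty entry. Root the tree by a search and
put a virtual root `m` with empty bag above it. Packings correspond to labelings of the nodes by
conflict-free tuples such that a node and its parent agree, position by position, on the members
common to their bags (`exists_isConflictFree_of_labeling`, `exists_labeling_of_isConflictFree`).
Each member is weighed at the topmost node of its subtree. Nodes are eliminated from the last to the
first (`isGreatest_eliminate`). Two labels fit if and only if their restrictions to the common part
coincide, so the best values of a child are tabulated by restriction and no pairs of labels are
compared: the maximum weight is found in time `O(m (p+1)^k)`.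

An optimal set is obtained from optimal values by self-reduction (`IsReduction`). The weight of each
member in turn is set to zero, the dynamic program is repeated, and the member is kept only if the
optimum drops. These `p + 1` runs cost `O(m (p+1)^(k+1))`. As a subgraph with at most `r` vertices
is determined by a list of vertices and a relation on its positions, `p = O(n^r)`
(`card_le_of_injective_subgraphs`), which gives the claimed time.

For `F`-packings, all maps from the members of `F` to `G` are tested, which lists at most `q * n^r`
copies. The same subgraph may be listed several times, but its listings conflict, so at most one of
them is chosen. -/

/-! ### Program logic -/

namespace RamState

@[simp] theorem setNat_nat_same (s : RamState) (a i j x i' j' : ℕ) :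
    (s.setNat a i j x).nat a i' j' = if i' = i ∧ j' = j then x else s.nat a i' j' := by
  simp [setNat]

@[simp] theorem setNat_nat_of_ne (s : RamState) {a b : ℕ} (i j x : ℕ) (h : b ≠ a) :
    (s.setNat a i j x).nat b = s.nat b := by
  funext i' j'; simp [setNat, h]

@[simp] theorem setNat_wt (s : RamState) (a i j x : ℕ) : (s.setNat a i j x).wt = s.wt := rfl

@[simp] theorem setWt_nat (s : RamState) (a i j : ℕ) (x : ℚ) : (s.setWt a i j x).nat = s.nat := rfl

@[simp] theorem setWt_wt_same (s : RamState) (a i j : ℕ) (x : ℚ) (i' j' : ℕ) :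
    (s.setWt a i j x).wt a i' j' = if i' = i ∧ j' = j then x else s.wt a i' j' := by
  simp [setWt]

@[simp] theorem setWt_wt_of_ne (s : RamState) {a b : ℕ} (i j : ℕ) (x : ℚ) (h : b ≠ a) :
    (s.setWt a i j x).wt b = s.wt b := by
  funext i' j'; simp [setWt, h]

end RamState

namespace NatExpr

/-- The content of cell `(0, 0)` of the word array `a`. -/
def reg (a : ℕ) : NatExpr := .read a (.const 0) (.const 0)

/-- The power of an expression with a constant exponent. -/
def pow (e : NatExpr) : ℕ → NatExpr
  | 0 => .const 1
  | x + 1 => .mul (pow e x) e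

/-- The sum of a constant number of expressions. -/
def sum (f : ℕ → NatExpr) : ℕ → NatExpr
  | 0 => .const 0
  | x + 1 => .add (sum f x) (f x)

/-- The value of `x` if `c` is nonzero, and of `y` otherwise. -/
def ite (c x y : NatExpr) : NatExpr :=
  .add (.mul (.lt (.const 0) c) x) (.mul (.eq c (.const 0)) y)

/-- The digit of `c` at position `x` in base `b`. -/
def digit (b c : NatExpr) (x : ℕ) : NatExpr := .mod (.div c (b.pow x)) b

attribute [simp] eval

@[simp] theorem eval_reg (s : RamState) (a : ℕ) : (reg a).eval s = s.nat a 0 0 := rfl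

@[simp] theorem eval_pow (s : RamState) (e : NatExpr) (x : ℕ) :
    (e.pow x).eval s = e.eval s ^ x := by
  induction x with
  | zero => rfl
  | succ x ih => simp [pow, ih, pow_succ]

@[simp] theorem eval_sum (s : RamState) (f : ℕ → NatExpr) (x : ℕ) :
    (sum f x).eval s = ∑ y ∈ Finset.range x, (f y).eval s := by
  induction x with
  | zero => rfl
  | succ x ih => simp [sum, ih, Finset.sum_range_succ]

@[simp] theorem eval_ite (s : RamState) (c x y : NatExpr) :
    (ite c x y).eval s = if c.eval s = 0 then y.eval s else x.eval s := by
  by_cases h : c.eval s = 0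
  · simp [ite, h]
  · simp [ite, h, Nat.pos_of_ne_zero h]

@[simp] theorem eval_digit (s : RamState) (b c : NatExpr) (x : ℕ) :
    (digit b c x).eval s = c.eval s / b.eval s ^ x % b.eval s := by
  simp [digit]

end NatExpr

namespace WtExpr

/-- The sum of a constant number of expressions. -/
def sum (f : ℕ → WtExpr) : ℕ → WtExpr
  | 0 => .zero
  | x + 1 => .add (sum f x) (f x)

attribute [simp] eval

@[simp] theorem eval_sum (s : RamState) (f : ℕ → WtExpr) (x : ℕ) :
    (sum f x).eval s = ∑ y ∈ Finset.range x, (f y).eval s := by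
  induction x with
  | zero => rfl
  | succ x ih => simp [sum, ih, Finset.sum_range_succ]

end WtExpr

namespace RamProgram

/-- The program stores words in array `b`. -/
@[simp] def WritesNat : RamProgram → ℕ → Prop
  | skip, _ => False
  | set a _ _ _, b => b = a
  | setW _ _ _ _, _ => False
  | seq P Q, b => P.WritesNat b ∨ Q.WritesNat b
  | cond _ P Q, b => P.WritesNat b ∨ Q.WritesNat b
  | condLe _ _ P Q, b => P.WritesNat b ∨ Q.WritesNat b
  | loop _ P, b => P.WritesNat b

/-- The program stores weights in array `b`. -/
@[simp] def WritesWt : RamProgram → ℕ → Prop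
  | skip, _ => False
  | set _ _ _ _, _ => False
  | setW a _ _ _, b => b = a
  | seq P Q, b => P.WritesWt b ∨ Q.WritesWt b
  | cond _ P Q, b => P.WritesWt b ∨ Q.WritesWt b
  | condLe _ _ P Q, b => P.WritesWt b ∨ Q.WritesWt b
  | loop _ P, b => P.WritesWt b

/-- The memories `s` and `s'` agree on all arrays that `P` does not change. -/
structure Frame (P : RamProgram) (s s' : RamState) : Prop where
  nat : ∀ b, ¬ P.WritesNat b → s'.nat b = s.nat b
  wt : ∀ b, ¬ P.WritesWt b → s'.wt b = s.wt b

theorem Frame.refl (P : RamProgram) (s : RamState) : P.Frame s s := ⟨fun _ _ => rfl, fun _ _ => rfl⟩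

theorem Frame.trans {P : RamProgram} {s s' s'' : RamState} (h : P.Frame s s') (h' : P.Frame s' s'') :
    P.Frame s s'' :=
  ⟨fun b hb => (h'.nat b hb).trans (h.nat b hb), fun b hb => (h'.wt b hb).trans (h.wt b hb)⟩

theorem Frame.mono {P Q : RamProgram} {s s' : RamState} (h : P.Frame s s')
    (hn : ∀ b, P.WritesNat b → Q.WritesNat b) (hw : ∀ b, P.WritesWt b → Q.WritesWt b) :
    Q.Frame s s' :=
  ⟨fun b hb => h.nat b fun k => hb (hn b k), fun b hb => h.wt b fun k => hb (hw b k)⟩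

/-- The arrays that may change are read off the syntax of the program, so every run carries a frame.
Specifications then need to mention only the arrays that matter. -/
theorem Frame.of_runs {W : ℕ} {P : RamProgram} {s s' : RamState} {t : ℕ} (h : Runs W P s t s') :
    P.Frame s s' := by
  induction h with
  | skip s => exact .refl _ _
  | set a i j e s h => exact ⟨fun b hb => by simp at hb; simp [hb], fun b hb => rfl⟩
  | setW a i j e s => exact ⟨fun b hb => rfl, fun b hb => by simp at hb; simp [hb]⟩
  | seq _ _ ih ih' =>
    exact (ih.mono (fun _ => Or.inl) fun _ => Or.inl).trans
      (ih'.mono (fun _ => Or.inr) fun _ => Or.inr)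
  | cond_true _ _ ih => exact ih.mono (fun _ => Or.inl) fun _ => Or.inl
  | cond_false _ _ ih => exact ih.mono (fun _ => Or.inr) fun _ => Or.inr
  | condLe_true _ _ ih => exact ih.mono (fun _ => Or.inl) fun _ => Or.inl
  | condLe_false _ _ ih => exact ih.mono (fun _ => Or.inr) fun _ => Or.inr
  | loop_stop _ => exact .refl _ _
  | loop_step _ _ _ ih ih' =>
    exact ⟨fun b hb => (ih'.nat b hb).trans (ih.nat b hb),
      fun b hb => (ih'.wt b hb).trans (ih.wt b hb)⟩

/-- Started in `s`, the program halts, and the number of steps and the final memory satisfy `Q`. -/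
def Exec (W : ℕ) (P : RamProgram) (s : RamState) (Q : ℕ → RamState → Prop) : Prop :=
  ∃ t s', Runs W P s t s' ∧ Q t s'

namespace Exec

variable {W : ℕ} {P P' : RamProgram} {s : RamState} {Q Q' : ℕ → RamState → Prop}

/-- The rule of consequence, which also hands the frame of the run to the continuation. -/
theorem mono (h : Exec W P s Q) (hQ : ∀ t s', P.Frame s s' → Q t s' → Q' t s') :
    Exec W P s Q' := by
  obtain ⟨t, s', hr, hq⟩ := h
  exact ⟨t, s', hr, hQ t s' (.of_runs hr) hq⟩

theorem skip (h : Q 1 s) : Exec W .skip s Q := ⟨_, _, .skip s, h⟩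

theorem set {a : ℕ} {i j e : NatExpr} (h : e.eval s ≤ W)
    (hQ : Q 1 (s.setNat a (i.eval s) (j.eval s) (e.eval s))) : Exec W (.set a i j e) s Q :=
  ⟨_, _, .set a i j e s h, hQ⟩

theorem setW {a : ℕ} {i j : NatExpr} {e : WtExpr}
    (hQ : Q 1 (s.setWt a (i.eval s) (j.eval s) (e.eval s))) : Exec W (.setW a i j e) s Q :=
  ⟨_, _, .setW a i j e s, hQ⟩

theorem seq (h : Exec W P s fun t s' => Exec W P' s' fun t' s'' => Q (t + t') s'') :
    Exec W (.seq P P') s Q := by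
  obtain ⟨t, s', hr, t', s'', hr', hq⟩ := h
  exact ⟨_, _, .seq hr hr', hq⟩

theorem cond {e : NatExpr} (h : e.eval s ≠ 0 → Exec W P s fun t s' => Q (t + 1) s')
    (h' : e.eval s = 0 → Exec W P' s fun t s' => Q (t + 1) s') : Exec W (.cond e P P') s Q := by
  by_cases he : e.eval s = 0
  · obtain ⟨t, s', hr, hq⟩ := h' he
    exact ⟨_, _, .cond_false he hr, hq⟩
  · obtain ⟨t, s', hr, hq⟩ := h he
    exact ⟨_, _, .cond_true he hr, hq⟩

theorem condLe {x y : WtExpr} (h : x.eval s ≤ y.eval s → Exec W P s fun t s' => Q (t + 1) s')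
    (h' : y.eval s < x.eval s → Exec W P' s fun t s' => Q (t + 1) s') :
    Exec W (.condLe x y P P') s Q := by
  by_cases he : x.eval s ≤ y.eval s
  · obtain ⟨t, s', hr, hq⟩ := h he
    exact ⟨_, _, .condLe_true he hr, hq⟩
  · obtain ⟨t, s', hr, hq⟩ := h' (not_le.mp he)
    exact ⟨_, _, .condLe_false he hr, hq⟩

end Exec

/-! ### Counting loops and their running time. -/

/-- Run `B` for the values `0, …, e - 1` of the loop counter in word array `a`. -/
def forLoop (a : ℕ) (e : NatExpr) (B : RamProgram) : RamProgram :=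
  .seq (.set a (.const 0) (.const 0) (.const 0))
    (.loop (.lt (.reg a) e)
      (.seq B (.set a (.const 0) (.const 0) (.add (.reg a) (.const 1)))))

@[simp] theorem writesNat_forLoop {a : ℕ} {e : NatExpr} {B : RamProgram} {b : ℕ} :
    (forLoop a e B).WritesNat b ↔ b = a ∨ B.WritesNat b := by
  simp [forLoop]; tauto

@[simp] theorem writesWt_forLoop {a : ℕ} {e : NatExpr} {B : RamProgram} {b : ℕ} :
    (forLoop a e B).WritesWt b ↔ B.WritesWt b := by
  simp [forLoop]

/-- A counting loop whose invariant `Inv i τ` speaks about the number `i` of completed rounds and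
the time `τ` that they took. -/
theorem Exec.forLoop_timed {W n a : ℕ} {e : NatExpr} {B : RamProgram} {s : RamState}
    (Inv : ℕ → ℕ → RamState → Prop) (ha : ¬ B.WritesNat a) (hn : n ≤ W)
    (he : ∀ s', (forLoop a e B).Frame s s' → e.eval s' = n) (h0 : Inv 0 0 s)
    (hinv : ∀ i τ s' x, Inv i τ s' → Inv i τ (s'.setNat a 0 0 x))
    (hstep : ∀ i τ s', i < n → (forLoop a e B).Frame s s' → s'.nat a 0 0 = i → Inv i τ s' →
      Exec W B s' fun t s'' => Inv (i + 1) (τ + t + 2) s'') :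
    Exec W (forLoop a e B) s fun t s' => ∃ τ, t ≤ τ + 2 ∧ Inv n τ s' := by
  -- Induction on the number `d` of rounds that remain. A round costs two steps besides its body,
  -- the test and the increment; the last test costs one more step, and so does the initial
  -- assignment.
  have key : ∀ d i τ s', i + d = n → (forLoop a e B).Frame s s' → s'.nat a 0 0 = i → Inv i τ s' →
      Exec W (.loop (.lt (.reg a) e)
        (.seq B (.set a (.const 0) (.const 0) (.add (.reg a) (.const 1))))) s'
        fun t s'' => ∃ τ', τ + t ≤ τ' + 1 ∧ Inv n τ' s'' := by
    intro d
    induction d with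
    | zero =>
      intro i τ s' hi hf hr h
      refine ⟨1, s', Runs.loop_stop ?_, τ, le_rfl, ?_⟩
      · simp [he s' hf, hr]; omega
      · obtain rfl : i = n := by omega
        exact h
    | succ d ih =>
      intro i τ s' hi hf hr h
      obtain ⟨t, s₁, hr₁, h₁⟩ := hstep i τ s' (by omega) hf hr h
      have hf₁ := Frame.of_runs hr₁
      have hc : s₁.nat a 0 0 = i := by rw [hf₁.nat a ha, hr]
      have hrs : Runs W (.set a (.const 0) (.const 0) (.add (.reg a) (.const 1))) s₁ 1
          (s₁.setNat a 0 0 (i + 1)) := by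
        have := Runs.set (W := W) a (.const 0) (.const 0) (.add (.reg a) (.const 1)) s₁
          (by simp [hc]; omega)
        simpa [hc] using this
      have hf₂ : (forLoop a e B).Frame s (s₁.setNat a 0 0 (i + 1)) := by
        refine hf.trans ⟨fun b hb => ?_, fun b hb => ?_⟩
        · simp at hb
          rw [RamState.setNat_nat_of_ne _ _ _ _ hb.1, hf₁.nat b hb.2]
        · simp at hb
          rw [RamState.setNat_wt, hf₁.wt b hb]
      obtain ⟨t₂, s₂, hr₂, τ', hτ, hI⟩ := ih (i + 1) (τ + t + 2) _ (by omega) hf₂ (by simp)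
        (hinv _ _ _ _ h₁)
      exact ⟨_, s₂, .loop_step (by simp [he s' hf, hr]; omega) (.seq hr₁ hrs) hr₂, τ', by omega, hI⟩
  refine .seq (.set (by simp) ?_)
  refine (key n 0 0 (s.setNat a 0 0 0) (by omega) ⟨fun b hb => ?_, fun b hb => rfl⟩ (by simp)
    (hinv _ _ _ _ h0)).mono fun t s' _ h => ?_
  · simp at hb; simp [hb.1]
  · obtain ⟨τ, h1, h2⟩ := h
    exact ⟨τ, by omega, h2⟩

/-- A counting loop whose body takes at most `T` steps. -/
theorem Exec.forLoop {W n a : ℕ} {e : NatExpr} {B : RamProgram} {s : RamState} (T : ℕ)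
    (Inv : ℕ → RamState → Prop) (ha : ¬ B.WritesNat a) (hn : n ≤ W)
    (he : ∀ s', (forLoop a e B).Frame s s' → e.eval s' = n) (h0 : Inv 0 s)
    (hinv : ∀ i s' x, Inv i s' → Inv i (s'.setNat a 0 0 x))
    (hstep : ∀ i s', i < n → (forLoop a e B).Frame s s' → s'.nat a 0 0 = i → Inv i s' →
      Exec W B s' fun t s'' => t ≤ T ∧ Inv (i + 1) s'') :
    Exec W (forLoop a e B) s fun t s' => t ≤ n * (T + 2) + 2 ∧ Inv n s' := by
  refine (Exec.forLoop_timed (fun i τ s' => τ ≤ i * (T + 2) ∧ Inv i s') ha hn he ⟨by simp, h0⟩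
    (fun i τ s' x h => ⟨h.1, hinv _ _ _ h.2⟩) fun i τ s' hi hf hr h => ?_).mono fun t s' _ h => ?_
  · refine (hstep i s' hi hf hr h.2).mono fun t s'' _ h' => ⟨?_, h'.2⟩
    have := h.1
    have := h'.1
    rw [add_mul]; omega
  · obtain ⟨τ, h1, h2, h3⟩ := h
    exact ⟨by omega, h3⟩

end RamProgram

/-! ### Elimination of the nodes of a rooted tree -/

section Labeling

variable (m : ℕ) (pp : ℕ → ℕ) (valid : ℕ → ℕ → Prop) (up dn : ℕ → ℕ → ℕ) (wgt : ℕ → ℕ → ℚ)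

/-- Labels of the nodes `0, …, i - 1` and of the virtual root `m` that are valid and fit together
along the edges from the nodes to their parents. -/
def IsLabeling (i : ℕ) (c : ℕ → ℕ) : Prop :=
  valid m (c m) ∧ ∀ x < i, valid x (c x) ∧ up x (c x) = dn x (c (pp x))

/-- The value of a labeling of the nodes `0, …, i - 1`, where `F` holds the contributions of the
nodes that have been eliminated. -/
def labelingValue (F : ℕ → ℕ → ℚ) (i : ℕ) (c : ℕ → ℕ) : ℚ :=
  ∑ x ∈ Finset.range i, (F x (c x) + wgt x (c x)) + F m (c m)

variable {m pp valid up dn wgt}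

/-- Only the row of `pp i` changes, and it enters the value exactly once: as a term of the sum if
`pp i < i`, and as the separate last term if `pp i = m`. -/
theorem labelingValue_eliminate {F F' : ℕ → ℕ → ℚ} {g : ℕ → ℚ} {i : ℕ} {c : ℕ → ℕ}
    (hi : i < m) (hpp : ∀ x < m, pp x < x ∨ pp x = m)
    (hF : ∀ x, x < i ∨ x = m → ∀ y, valid x y → F' x y = F x y + if x = pp i then g (dn i y) else 0)
    (hc : IsLabeling m pp valid up dn i c) :
    labelingValue m wgt F' i c = labelingValue m wgt F i c + g (dn i (c (pp i))) := by
  have h1 : ∀ x ∈ Finset.range i, F' x (c x) + wgt x (c x) =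
      F x (c x) + wgt x (c x) + if x = pp i then g (dn i (c x)) else 0 := fun x hx => by
    rw [Finset.mem_range] at hx
    rw [hF x (.inl hx) _ (hc.2 x hx).1]; ring
  rw [labelingValue, labelingValue, Finset.sum_congr rfl h1, hF m (.inr rfl) _ hc.1,
    Finset.sum_add_distrib, Finset.sum_ite_eq']
  rcases hpp i hi with h | h
  · rw [if_pos (Finset.mem_range.mpr h), if_neg (by omega)]; ring
  · rw [if_neg (by simp; omega), if_pos h.symm, h]; ring

/-- Eliminating the last node preserves the maximum value of a labeling. -/
theorem isGreatest_eliminate {F F' : ℕ → ℕ → ℚ} {g : ℕ → ℚ} {i : ℕ} {o : ℚ}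
    (hi : i < m) (hpp : ∀ x < m, pp x < x ∨ pp x = m)
    (hF : ∀ x, x < i ∨ x = m → ∀ y, valid x y → F' x y = F x y + if x = pp i then g (dn i y) else 0)
    (hg : ∀ y, valid i y → F i y + wgt i y ≤ g (up i y))
    (hg' : ∀ y, valid (pp i) y → ∃ z, valid i z ∧ up i z = dn i y ∧ F i z + wgt i z = g (dn i y))
    (ho : IsGreatest {q | ∃ c, IsLabeling m pp valid up dn (i + 1) c ∧
      labelingValue m wgt F (i + 1) c = q} o) :
    IsGreatest {q | ∃ c, IsLabeling m pp valid up dn i c ∧ labelingValue m wgt F' i c = q} o := by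
  have hsucc : ∀ c, labelingValue m wgt F (i + 1) c =
      labelingValue m wgt F i c + (F i (c i) + wgt i (c i)) := fun c => by
    rw [labelingValue, labelingValue, Finset.sum_range_succ]; ring
  have hub : ∀ c, IsLabeling m pp valid up dn i c → labelingValue m wgt F' i c ≤ o := by
    intro c hc
    have hu : valid (pp i) (c (pp i)) := by
      rcases hpp i hi with h | h
      · exact (hc.2 _ h).1
      · rw [h]; exact hc.1
    obtain ⟨z, hz, hz1, hz2⟩ := hg' _ hu
    have hup : ∀ x, x ≠ i → Function.update c i z x = c x := fun x hx => by
      rw [Function.update_of_ne hx]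
    have hppi : ∀ x ≤ i, pp x ≠ i := fun x hx => by
      rcases hpp x (by omega) with h | h <;> omega
    -- Extend the labeling by a label `z` of node `i` that attains `g`. No node up to `i` has parent
    -- `i`, so the other constraints are not affected.
    refine le_trans (le_of_eq ?_) (ho.2 ⟨Function.update c i z, ⟨?_, fun x hx => ?_⟩, rfl⟩)
    · rw [labelingValue_eliminate hi hpp hF hc, hsucc, Function.update_self, hz2]
      congr 1
      rw [labelingValue, labelingValue, hup m (by omega)]
      congr 1
      refine Finset.sum_congr rfl fun x hx => ?_
      rw [Finset.mem_range] at hx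
      rw [hup x (by omega)]
    · rw [hup m (by omega)]; exact hc.1
    · rw [hup (pp x) (hppi x (by omega))]
      rcases Nat.lt_succ_iff_lt_or_eq.mp hx with h | h
      · rw [hup x (by omega)]; exact hc.2 x h
      · subst h; rw [Function.update_self]; exact ⟨hz, hz1⟩
  refine ⟨?_, ?_⟩
  -- Forgetting the label of `i` in an optimal labeling loses nothing, because `g` bounds the value
  -- that this label contributed.
  · obtain ⟨c, hc, hv⟩ := ho.1
    have hc' : IsLabeling m pp valid up dn i c := ⟨hc.1, fun x hx => hc.2 x (by omega)⟩
    refine ⟨c, hc', le_antisymm (hub c hc') ?_⟩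
    rw [← hv, hsucc, labelingValue_eliminate hi hpp hF hc', ← (hc.2 i (by omega)).2]
    have := hg _ (hc.2 i (by omega)).1
    linarith
  · rintro q ⟨c, hc, rfl⟩
    exact hub c hc

end Labeling

/-! ### Codes of tuples -/

/-- The digit of `c` at position `x` in base `p + 1`. -/
def dig (p c x : ℕ) : ℕ := c / (p + 1) ^ x % (p + 1)

theorem dig_le (p c x : ℕ) : dig p c x ≤ p := Nat.lt_succ_iff.mp (Nat.mod_lt _ (Nat.succ_pos p))

theorem sum_digits_lt {b k : ℕ} {d : ℕ → ℕ} (hd : ∀ x < k, d x < b) :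
    ∑ x ∈ Finset.range k, d x * b ^ x < b ^ k := by
  have := (finFunctionFinEquiv (fun x : Fin k => (⟨d x, hd x x.2⟩ : Fin b))).2
  rwa [finFunctionFinEquiv_apply_val, Fin.sum_univ_eq_sum_range (fun x => d x * b ^ x)] at this

theorem digit_sum_digits {b k : ℕ} {d : ℕ → ℕ} (hd : ∀ x < k, d x < b) {x : ℕ} (hx : x < k) :
    (∑ y ∈ Finset.range k, d y * b ^ y) / b ^ x % b = d x := by
  have h := finFunctionFinEquiv.symm_apply_apply (fun x : Fin k => (⟨d x, hd x x.2⟩ : Fin b))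
  have h2 := congrArg Fin.val (congrFun h ⟨x, hx⟩)
  rwa [finFunctionFinEquiv_symm_apply_val, finFunctionFinEquiv_apply_val,
    Fin.sum_univ_eq_sum_range (fun x => d x * b ^ x)] at h2

theorem eq_sum_digits {b k c : ℕ} (hc : c < b ^ k) :
    ∑ x ∈ Finset.range k, c / b ^ x % b * b ^ x = c := by
  have h := congrArg Fin.val (finFunctionFinEquiv.apply_symm_apply (⟨c, hc⟩ : Fin (b ^ k)))
  rw [finFunctionFinEquiv_apply_val] at h
  simpa [finFunctionFinEquiv_symm_apply_val,
    Fin.sum_univ_eq_sum_range (fun x => c / b ^ x % b * b ^ x)] using h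

/-- The code of the tuple that arises from the tuple with code `c` when all entries that are not
marked by `M` are replaced by the empty entry `p`. -/
def keepMarked (k p : ℕ) (M : ℕ → ℕ) (c : ℕ) : ℕ :=
  ∑ x ∈ Finset.range k, (if M (dig p c x) = 0 then p else dig p c x) * (p + 1) ^ x

theorem keepMarked_lt (k p : ℕ) (M : ℕ → ℕ) (c : ℕ) : keepMarked k p M c < (p + 1) ^ k :=
  sum_digits_lt fun x _ => by
    have := dig_le p c x
    split_ifs <;> omega

theorem dig_keepMarked {k p : ℕ} (M : ℕ → ℕ) (c : ℕ) {x : ℕ} (hx : x < k) :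
    dig p (keepMarked k p M c) x = if M (dig p c x) = 0 then p else dig p c x :=
  digit_sum_digits (fun x _ => by have := dig_le p c x; split_ifs <;> omega) hx

theorem code_ext {k p c c' : ℕ} (hc : c < (p + 1) ^ k) (hc' : c' < (p + 1) ^ k)
    (h : ∀ x < k, dig p c x = dig p c' x) : c = c' := by
  rw [← eq_sum_digits hc, ← eq_sum_digits hc']
  refine Finset.sum_congr rfl fun x hx => ?_
  exact congrArg (· * (p + 1) ^ x) (h x (Finset.mem_range.mp hx))

/-- Either side keeps exactly the entries with both marks. Thus a parent's label restricted to the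
child's bag is still fixed by the restriction to the parent's bag. -/
theorem keepMarked_comm {k p : ℕ} {M M' : ℕ → ℕ} (hM : M p = 0) (hM' : M' p = 0) (c : ℕ) :
    keepMarked k p M (keepMarked k p M' c) = keepMarked k p M' (keepMarked k p M c) := by
  refine code_ext (keepMarked_lt _ _ _ _) (keepMarked_lt _ _ _ _) fun x hx => ?_
  simp only [dig_keepMarked _ _ hx]
  by_cases h : M (dig p c x) = 0 <;> by_cases h' : M' (dig p c x) = 0 <;> simp [h, h', hM, hM']

/-- The tuple with code `c` lists marked entries without conflicts. -/
def IsValidCode (k p : ℕ) (A : ℕ → ℕ → ℕ) (M : ℕ → ℕ) (c : ℕ) : Prop :=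
  keepMarked k p M c = c ∧
    ∑ x ∈ Finset.range k, ∑ y ∈ Finset.range x, A (dig p c x) (dig p c y) = 0

/-- A value of `keepMarked` has only `k` digits, so the fixed point equation bounds the code as
well. A loop over the numbers below `(p + 1) ^ k` therefore meets all labels. -/
theorem IsValidCode.lt {k p c : ℕ} {A : ℕ → ℕ → ℕ} {M : ℕ → ℕ} (h : IsValidCode k p A M c) :
    c < (p + 1) ^ k := h.1 ▸ keepMarked_lt _ _ _ _

theorem isValidCode_iff {k p c : ℕ} {A : ℕ → ℕ → ℕ} {M : ℕ → ℕ} (hc : c < (p + 1) ^ k) :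
    IsValidCode k p A M c ↔ (∀ x < k, dig p c x ≠ p → M (dig p c x) ≠ 0) ∧
      ∀ x < k, ∀ y < x, A (dig p c x) (dig p c y) = 0 := by
  refine and_congr ⟨fun h x hx hp h0 => hp ?_, fun h => ?_⟩ (by simp [Finset.sum_eq_zero_iff])
  · have := dig_keepMarked (p := p) M c hx
    rwa [h, if_pos h0] at this
  · refine code_ext (keepMarked_lt _ _ _ _) hc fun x hx => ?_
    rw [dig_keepMarked M c hx]
    split_ifs with h0
    · by_contra hne
      exact h x hx (Ne.symm hne) h0
    · rfl

/-- The code of the empty tuple. -/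
def emptyCode (k p : ℕ) : ℕ := ∑ x ∈ Finset.range k, p * (p + 1) ^ x

theorem emptyCode_lt (k p : ℕ) : emptyCode k p < (p + 1) ^ k := sum_digits_lt fun _ _ => by omega

theorem dig_emptyCode {k p x : ℕ} (hx : x < k) : dig p (emptyCode k p) x = p :=
  digit_sum_digits (fun _ _ => by omega) hx

theorem keepMarked_eq_emptyCode {k p : ℕ} {M : ℕ → ℕ} (hM : ∀ j, M j = 0) (c : ℕ) :
    keepMarked k p M c = emptyCode k p := by
  simp [keepMarked, emptyCode, hM]

/-- The set of the entries of the tuple with code `c`. -/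
def codeSet (k p c : ℕ) : Finset ℕ := ((Finset.range k).image (dig p c)).erase p

theorem mem_codeSet {k p c j : ℕ} : j ∈ codeSet k p c ↔ j ≠ p ∧ ∃ x < k, dig p c x = j := by
  simp [codeSet]

/-- A set of members of a family without conflicts. -/
def IsConflictFree (p : ℕ) (A : ℕ → ℕ → ℕ) (I : Finset ℕ) : Prop :=
  (∀ a ∈ I, a < p) ∧ ∀ a ∈ I, ∀ b ∈ I, a ≠ b → A a b = 0

theorem IsConflictFree.mono {p : ℕ} {A : ℕ → ℕ → ℕ} {I I' : Finset ℕ} (h : IsConflictFree p A I)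
    (hI : I' ⊆ I) : IsConflictFree p A I' :=
  ⟨fun a ha => h.1 a (hI ha), fun a ha b hb => h.2 a (hI ha) b (hI hb)⟩

/-! ### Rooted decompositions of the conflict graph and tuples in their bags. -/

/-- A rooted tree decomposition, with nodes `0, …, m - 1` and parents `pp`, of the conflict graph
`A` of a family of `p` members: `M i j` is nonzero if `j` is in the bag of `i`. -/
structure IsRootedDecomposition (m p k : ℕ) (pp : ℕ → ℕ) (M A : ℕ → ℕ → ℕ) : Prop where
  parent : ∀ i < m, pp i < i ∨ pp i = m
  not_mem : ∀ i, M i p = 0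
  root : ∀ j, M m j = 0
  left_none : ∀ j, A p j = 0
  right_none : ∀ j, A j p = 0
  self : ∀ j < p, A j j ≠ 0
  symm : ∀ a < p, ∀ b < p, A a b = 0 → A b a = 0
  top : ∀ j < p, ∃ i < m, (M i j ≠ 0 ∧ M (pp i) j = 0) ∧
    ∀ i' < m, M i' j ≠ 0 → M (pp i') j = 0 → i' = i
  edge : ∀ a < p, ∀ b < p, A a b ≠ 0 → ∃ i < m, M i a ≠ 0 ∧ M i b ≠ 0
  card_le : ∀ i < m, ∀ I, IsConflictFree p A I → (∀ a ∈ I, M i a ≠ 0) → I.card ≤ k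

namespace IsRootedDecomposition

variable {m p k : ℕ} {pp : ℕ → ℕ} {M A : ℕ → ℕ → ℕ}

/-- Blanking out entries creates no conflict, since the empty entry conflicts with nothing. -/
theorem isValidCode_keepMarked (h : IsRootedDecomposition m p k pp M A) {i i' c : ℕ}
    (hc : IsValidCode k p A (M i) c) : IsValidCode k p A (M i') (keepMarked k p (M i') c) := by
  rw [isValidCode_iff hc.lt] at hc
  rw [isValidCode_iff (keepMarked_lt _ _ _ _)]
  refine ⟨fun x hx => ?_, fun x hx y hy => ?_⟩
  · rw [dig_keepMarked _ _ hx]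
    split_ifs with h0
    · simp
    · exact fun _ => h0
  · rw [dig_keepMarked _ _ hx, dig_keepMarked _ _ (hy.trans hx)]
    split_ifs
    · exact h.left_none _
    · exact h.left_none _
    · exact h.right_none _
    · exact hc.2 x hx y hy

theorem isConflictFree_codeSet (h : IsRootedDecomposition m p k pp M A) {i c : ℕ}
    (hc : IsValidCode k p A (M i) c) : IsConflictFree p A (codeSet k p c) := by
  rw [isValidCode_iff hc.lt] at hc
  have hlt : ∀ a ∈ codeSet k p c, a < p := fun a ha => by
    rw [mem_codeSet] at ha
    obtain ⟨h1, x, -, rfl⟩ := ha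
    have := dig_le p c x
    omega
  refine ⟨hlt, fun a ha b hb hab => ?_⟩
  have ha' := hlt a ha
  have hb' := hlt b hb
  rw [mem_codeSet] at ha hb
  obtain ⟨h1, x, hx, rfl⟩ := ha
  obtain ⟨h2, y, hy, rfl⟩ := hb
  rcases lt_trichotomy x y with hxy | rfl | hxy
  · exact h.symm _ hb' _ ha' (hc.2 y hy x hxy)
  · exact absurd rfl hab
  · exact hc.2 x hx y hxy

theorem mem_of_mem_codeSet {i c j : ℕ} (hc : IsValidCode k p A (M i) c) (hj : j ∈ codeSet k p c) :
    M i j ≠ 0 := by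
  rw [isValidCode_iff hc.lt] at hc
  rw [mem_codeSet] at hj
  obtain ⟨h1, x, hx, rfl⟩ := hj
  exact hc.1 x hx h1

theorem _root_.mem_codeSet_keepMarked {k p : ℕ} {M : ℕ → ℕ} {c j : ℕ} :
    j ∈ codeSet k p (keepMarked k p M c) ↔ j ∈ codeSet k p c ∧ M j ≠ 0 := by
  simp only [mem_codeSet]
  constructor
  · rintro ⟨h1, x, hx, rfl⟩
    rw [dig_keepMarked _ _ hx] at h1 ⊢
    split_ifs at h1 ⊢ with h0
    · simp at h1
    · exact ⟨⟨h1, x, hx, rfl⟩, h0⟩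
  · rintro ⟨⟨h1, x, hx, rfl⟩, h0⟩
    exact ⟨h1, x, hx, by rw [dig_keepMarked _ _ hx, if_neg h0]⟩

/-- Members conflict with themselves, so a conflict-free tuple cannot repeat one. -/
theorem dig_injOn (h : IsRootedDecomposition m p k pp M A) {i c : ℕ}
    (hc : IsValidCode k p A (M i) c) :
    Set.InjOn (dig p c) {x | x < k ∧ dig p c x ≠ p} := by
  rw [isValidCode_iff hc.lt] at hc
  have key : ∀ x < k, ∀ y < x, dig p c x ≠ p → dig p c x ≠ dig p c y := fun x hx y hy hp he => by
    have h1 := hc.2 x hx y hy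
    rw [← he] at h1
    have := dig_le p c x
    exact h.self _ (by omega) h1
  rintro x ⟨hx, hxp⟩ y ⟨hy, hyp⟩ he
  rcases lt_trichotomy x y with hxy | rfl | hxy
  · exact absurd he.symm (key y hy x hxy hyp)
  · rfl
  · exact absurd he (key x hx y hxy hxp)

/-- A tuple can be extended to a tuple that lists a given larger set. -/
theorem exists_code_extending (h : IsRootedDecomposition m p k pp M A) {i u r : ℕ} (hi : i < m)
    {S : Finset ℕ} (hS : IsConflictFree p A S) (hSi : ∀ a ∈ S, M i a ≠ 0)
    (hr : IsValidCode k p A (M u) r) (hrS : ∀ a, a ∈ codeSet k p r ↔ a ∈ S ∧ M u a ≠ 0) :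
    ∃ c, IsValidCode k p A (M i) c ∧ keepMarked k p (M u) c = r ∧ codeSet k p c = S := by
  classical
  -- `Z` holds the free positions of `r` and `Y` the occupied ones. The occupied positions
  -- correspond to the members of `S` marked at `u`. As `S` has at most `k` members, there is room
  -- in `Z` for the rest `T` of `S`; the positions `Z'` receive `T` and all others are left as they
  -- are.
  let Z := (Finset.range k).filter fun x => dig p r x = p
  let Y := (Finset.range k).filter fun x => dig p r x ≠ p
  let T := S.filter fun a => M u a = 0
  have hZY : Z.card + Y.card = k := by
    rw [Finset.card_filter_add_card_filter_not, Finset.card_range]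
  have hY : Y.card = (S.filter fun a => M u a ≠ 0).card := by
    rw [← Finset.card_image_of_injOn (s := Y) (f := dig p r)]
    · congr 1
      ext a
      rw [Finset.mem_filter, ← hrS, mem_codeSet]
      simp only [Y, Finset.mem_image, Finset.mem_filter, Finset.mem_range]
      constructor
      · rintro ⟨x, ⟨h1, h2⟩, rfl⟩
        exact ⟨h2, x, h1, rfl⟩
      · rintro ⟨h2, x, h1, rfl⟩
        exact ⟨x, ⟨h1, h2⟩, rfl⟩
    · refine (h.dig_injOn hr).mono fun x hx => ?_
      simpa [Y] using hx
  have hTS : T.card + (S.filter fun a => M u a ≠ 0).card = S.card :=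
    Finset.card_filter_add_card_filter_not _
  have hle : T.card ≤ Z.card := by
    have := h.card_le i hi S hS hSi
    omega
  obtain ⟨Z', hZ', hcard⟩ := Finset.exists_subset_card_eq hle
  let e := Finset.equivOfCardEq hcard
  let d : ℕ → ℕ := fun x => if hx : x ∈ Z' then (e ⟨x, hx⟩ : ℕ) else dig p r x
  have hd1 : ∀ x, x ∈ Z' → d x ∈ T := fun x hx => by
    simp only [d, dif_pos hx]; exact (e ⟨x, hx⟩).2
  have hd2 : ∀ x, x ∉ Z' → d x = dig p r x := fun x hx => by simp only [d, dif_neg hx]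
  have hTmem : ∀ a, a ∈ T → a ∈ S ∧ M u a = 0 := fun a ha => by simpa [T] using ha
  have hdle : ∀ x < k, d x < p + 1 := fun x _ => by
    by_cases hx : x ∈ Z'
    · have := hS.1 _ (hTmem _ (hd1 x hx)).1
      omega
    · rw [hd2 x hx]
      have := dig_le p r x
      omega
  have hmem : ∀ x < k, d x ≠ p → d x ∈ S := fun x hx hp => by
    by_cases hx' : x ∈ Z'
    · exact (hTmem _ (hd1 x hx')).1
    · rw [hd2 x hx'] at hp ⊢
      exact ((hrS _).mp (mem_codeSet.mpr ⟨hp, x, hx, rfl⟩)).1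
  have hmem' : ∀ x < k, x ∉ Z' → d x ≠ p → M u (d x) ≠ 0 := fun x hx hx' hp => by
    rw [hd2 x hx'] at hp ⊢
    exact ((hrS _).mp (mem_codeSet.mpr ⟨hp, x, hx, rfl⟩)).2
  -- A new entry is unmarked at `u` and an old one is marked, so they differ.
  have hinj : ∀ x < k, ∀ y < k, d x ≠ p → d x = d y → x = y := fun x hx y hy hp he => by
    by_cases hx' : x ∈ Z' <;> by_cases hy' : y ∈ Z'
    · simp only [d, dif_pos hx', dif_pos hy'] at he
      simpa using e.injective (Subtype.ext he)
    · exact absurd (hTmem _ (hd1 x hx')).2 (he ▸ hmem' y hy hy' (he ▸ hp))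
    · exact absurd (he ▸ (hTmem _ (hd1 y hy')).2) (hmem' x hx hx' hp)
    · have he' := he
      rw [hd2 x hx', hd2 y hy'] at he'
      rw [hd2 x hx'] at hp
      exact h.dig_injOn hr ⟨hx, hp⟩ ⟨hy, he' ▸ hp⟩ he'
  have hdig : ∀ x < k, dig p (∑ y ∈ Finset.range k, d y * (p + 1) ^ y) x = d x := fun x hx =>
    digit_sum_digits hdle hx
  refine ⟨∑ y ∈ Finset.range k, d y * (p + 1) ^ y, ?_, ?_, ?_⟩
  · rw [isValidCode_iff (sum_digits_lt hdle)]
    refine ⟨fun x hx => ?_, fun x hx y hy => ?_⟩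
    · rw [hdig x hx]
      exact fun hp => hSi _ (hmem x hx hp)
    · rw [hdig x hx, hdig y (hy.trans hx)]
      by_cases hxp : d x = p
      · rw [hxp]; exact h.left_none _
      by_cases hyp : d y = p
      · rw [hyp]; exact h.right_none _
      exact hS.2 _ (hmem x hx hxp) _ (hmem y (hy.trans hx) hyp)
        fun he => hy.ne' (hinj x hx y (hy.trans hx) hxp he)
  · refine code_ext (keepMarked_lt _ _ _ _) hr.lt fun x hx => ?_
    rw [dig_keepMarked _ _ hx, hdig x hx]
    by_cases hx' : x ∈ Z'
    · rw [if_pos (hTmem _ (hd1 x hx')).2]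
      have := hZ' hx'
      simp only [Z, Finset.mem_filter] at this
      exact this.2.symm
    · by_cases hp : d x = p
      · rw [hp, if_pos (h.not_mem u), ← hd2 x hx', hp]
      · rw [if_neg (hmem' x hx hx' hp), hd2 x hx']
  · ext a
    rw [mem_codeSet]
    constructor
    · rintro ⟨hp, x, hx, rfl⟩
      rw [hdig x hx] at hp ⊢
      exact hmem x hx hp
    · intro ha
      refine ⟨(hS.1 a ha).ne, ?_⟩
      by_cases hu : M u a = 0
      · have hT : a ∈ T := by simp [T, ha, hu]
        obtain ⟨⟨x, hx⟩, hxe⟩ := e.surjective ⟨a, hT⟩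
        have hxk : x < k := by
          have := hZ' hx
          simp only [Z, Finset.mem_filter, Finset.mem_range] at this
          exact this.1
        refine ⟨x, hxk, ?_⟩
        rw [hdig x hxk]
        simp only [d, dif_pos hx, hxe]
      · obtain ⟨hp, x, hx, hxa⟩ := mem_codeSet.mp ((hrS a).mpr ⟨ha, hu⟩)
        have hxZ : x ∉ Z' := fun hx' => by
          have := hZ' hx'
          simp only [Z, Finset.mem_filter] at this
          exact hp (hxa ▸ this.2)
        exact ⟨x, hx, by rw [hdig x hx, hd2 x hxZ, hxa]⟩

/-- The weight of the entries of the tuple with code `c` that are not marked by `M`. -/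
def _root_.unmarkedWeight (k p : ℕ) (w : ℕ → ℚ) (M : ℕ → ℕ) (c : ℕ) : ℚ :=
  ∑ x ∈ Finset.range k, w (if M (dig p c x) = 0 then dig p c x else p)

/-- Since no member is repeated, a sum over positions is a sum over members. Positions that should
not count read the weight of `p`, which is zero. -/
theorem unmarkedWeight_eq (h : IsRootedDecomposition m p k pp M A) {i c : ℕ}
    (hc : IsValidCode k p A (M i) c) {w : ℕ → ℚ} (hw : w p = 0) (M' : ℕ → ℕ) :
    unmarkedWeight k p w M' c = ∑ j ∈ (codeSet k p c).filter (fun j => M' j = 0), w j := by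
  classical
  let Y := (Finset.range k).filter fun x => dig p c x ≠ p ∧ M' (dig p c x) = 0
  have hY : (codeSet k p c).filter (fun j => M' j = 0) = Y.image (dig p c) := by
    ext a
    simp only [Finset.mem_filter, mem_codeSet, Y, Finset.mem_image, Finset.mem_range]
    constructor
    · rintro ⟨⟨hp, x, hx, rfl⟩, h0⟩
      exact ⟨x, ⟨hx, hp, h0⟩, rfl⟩
    · rintro ⟨x, ⟨hx, hp, h0⟩, rfl⟩
      exact ⟨⟨hp, x, hx, rfl⟩, h0⟩
  rw [hY, Finset.sum_image, unmarkedWeight, Finset.sum_filter]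
  · refine Finset.sum_congr rfl fun x _ => ?_
    by_cases h0 : M' (dig p c x) = 0 <;> by_cases hp : dig p c x = p <;> simp [h0, hp, hw]
  · refine (h.dig_injOn hc).mono fun x hx => ?_
    simp only [Y, Finset.coe_filter, Finset.mem_range, Set.mem_ofPred_eq] at hx
    exact ⟨hx.1, hx.2.1⟩

end IsRootedDecomposition

/-! ### Labelings by tuples versus conflict-free sets. -/

/-- A labeling by codes of conflict-free tuples of members in the bags, such that the labels of a
node and of its parent agree on the intersection of their bags. -/
def IsCodeLabeling (m p k : ℕ) (pp : ℕ → ℕ) (M A : ℕ → ℕ → ℕ) (i : ℕ) (c : ℕ → ℕ) : Prop :=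
  IsLabeling m pp (fun i => IsValidCode k p A (M i)) (fun i => keepMarked k p (M (pp i)))
    (fun i => keepMarked k p (M i)) i c

/-- The value of a labeling by codes: every member counts at the topmost node of its subtree. -/
def codeLabelingValue (m p k : ℕ) (pp : ℕ → ℕ) (M : ℕ → ℕ → ℕ) (w : ℕ → ℚ) (F : ℕ → ℕ → ℚ) (i : ℕ)
    (c : ℕ → ℕ) : ℚ :=
  labelingValue m (fun i => unmarkedWeight k p w (M (pp i))) F i c

namespace IsRootedDecomposition

variable {m p k : ℕ} {pp : ℕ → ℕ} {M A : ℕ → ℕ → ℕ}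

/-- After exchanging the sums, each member of `I` is counted once per node whose bag contains it
while the parent's bag does not; by `top` there is exactly one such node. -/
theorem codeLabelingValue_eq (h : IsRootedDecomposition m p k pp M A) {w : ℕ → ℚ} (hw : w p = 0)
    {c : ℕ → ℕ} (hc : IsCodeLabeling m p k pp M A m c) {I : Finset ℕ} (hI : IsConflictFree p A I)
    (hcI : ∀ i < m, codeSet k p (c i) = I.filter fun j => M i j ≠ 0) :
    codeLabelingValue m p k pp M w (fun _ _ => 0) m c = ∑ j ∈ I, w j := by
  have h1 : ∀ i ∈ Finset.range m, 0 + unmarkedWeight k p w (M (pp i)) (c i) =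
      ∑ j ∈ I, if M i j ≠ 0 ∧ M (pp i) j = 0 then w j else 0 := fun i hi => by
    rw [Finset.mem_range] at hi
    rw [zero_add, h.unmarkedWeight_eq (hc.2 i hi).1 hw, hcI i hi, Finset.filter_filter,
      Finset.sum_filter]
  rw [codeLabelingValue, labelingValue, Finset.sum_congr rfl h1, Finset.sum_comm, add_zero]
  refine Finset.sum_congr rfl fun j hj => ?_
  obtain ⟨i, hi, h2, h3⟩ := h.top j (hI.1 j hj)
  rw [Finset.sum_eq_single i, if_pos h2]
  · intro i' hi' hne
    rw [if_neg]
    exact fun h4 => hne (h3 i' (Finset.mem_range.mp hi') h4.1 h4.2)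
  · intro hn
    exact absurd (Finset.mem_range.mpr hi) hn

/-- Whether `j` is chosen is decided at the topmost node of its subtree, and agreement with the
parent carries this decision to all bags that contain `j`. A conflict between two chosen members
would show up in a common bag, where the label excludes it. -/
theorem exists_isConflictFree_of_labeling (h : IsRootedDecomposition m p k pp M A)
    {c : ℕ → ℕ} (hc : IsCodeLabeling m p k pp M A m c) :
    ∃ I, IsConflictFree p A I ∧ ∀ i < m, codeSet k p (c i) = I.filter fun j => M i j ≠ 0 := by
  classical
  have key : ∀ j < p, ∃ P : Prop, ∀ i < m, M i j ≠ 0 → (j ∈ codeSet k p (c i) ↔ P) := by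
    intro j hj
    obtain ⟨i₀, -, -, h3⟩ := h.top j hj
    refine ⟨j ∈ codeSet k p (c i₀), fun i => ?_⟩
    induction i using Nat.strong_induction_on with
    | _ i ih =>
      intro hi hM
      by_cases hpp : M (pp i) j = 0
      · rw [h3 i hi hM hpp]
      -- If `j` is also in the parent's bag, both restrictions retain it, so their equality
      -- transfers membership from the parent's label.
      · have hlt : pp i < i := (h.parent i hi).resolve_right fun he => hpp (he ▸ h.root j)
        rw [← ih _ hlt (hlt.trans hi) hpp]
        have h1 := mem_codeSet_keepMarked (k := k) (p := p) (M := M (pp i)) (c := c i) (j := j)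
        have h2 := mem_codeSet_keepMarked (k := k) (p := p) (M := M i) (c := c (pp i)) (j := j)
        have he := (hc.2 i hi).2
        simp only at he
        rw [he, h2] at h1
        simpa [hM, hpp] using h1.symm
  let I := (Finset.range p).filter fun j => ∀ i < m, M i j ≠ 0 → j ∈ codeSet k p (c i)
  have hI : ∀ i < m, codeSet k p (c i) = I.filter fun j => M i j ≠ 0 := by
    intro i hi
    ext j
    simp only [I, Finset.mem_filter, Finset.mem_range]
    constructor
    · intro hj
      have hjp := (h.isConflictFree_codeSet (hc.2 i hi).1).1 j hj
      have hM := mem_of_mem_codeSet (hc.2 i hi).1 hj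
      obtain ⟨P, hP⟩ := key j hjp
      exact ⟨⟨hjp, fun i' hi' hM' => (hP i' hi' hM').mpr ((hP i hi hM).mp hj)⟩, hM⟩
    · rintro ⟨⟨-, h1⟩, h2⟩
      exact h1 i hi h2
  refine ⟨I, ⟨fun a ha => by simp only [I, Finset.mem_filter, Finset.mem_range] at ha; exact ha.1,
    fun a ha b hb hab => ?_⟩, hI⟩
  by_contra hA
  have ha' : a < p := by simp only [I, Finset.mem_filter, Finset.mem_range] at ha; exact ha.1
  have hb' : b < p := by simp only [I, Finset.mem_filter, Finset.mem_range] at hb; exact hb.1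
  obtain ⟨i, hi, hMa, hMb⟩ := h.edge a ha' b hb' hA
  refine hA ((h.isConflictFree_codeSet (hc.2 i hi).1).2 a ?_ b ?_ hab) <;> rw [hI i hi]
  · exact Finset.mem_filter.mpr ⟨ha, hMa⟩
  · exact Finset.mem_filter.mpr ⟨hb, hMb⟩

theorem isValidCode_emptyCode (h : IsRootedDecomposition m p k pp M A) (i : ℕ) :
    IsValidCode k p A (M i) (emptyCode k p) := by
  rw [isValidCode_iff (emptyCode_lt _ _)]
  refine ⟨fun x hx hn => absurd (dig_emptyCode hx) hn, fun x hx y hy => ?_⟩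
  rw [dig_emptyCode hx]
  exact h.left_none _

/-- Labels are chosen from the root downwards. Agreement holds position by position, so the parent's
label prescribes the places of the common members, and `exists_code_extending` places the remaining
ones. -/
theorem exists_labeling_of_isConflictFree (h : IsRootedDecomposition m p k pp M A)
    {I : Finset ℕ} (hI : IsConflictFree p A I) :
    ∃ c, IsCodeLabeling m p k pp M A m c ∧
      ∀ i < m, codeSet k p (c i) = I.filter fun j => M i j ≠ 0 := by
  have key : ∀ n ≤ m, ∃ c, IsCodeLabeling m p k pp M A n c ∧ ∀ i, i < n ∨ i = m →
      codeSet k p (c i) = I.filter fun j => M i j ≠ 0 := by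
    intro n
    induction n with
    | zero =>
      intro _
      refine ⟨fun _ => emptyCode k p, ⟨h.isValidCode_emptyCode m, by simp⟩, fun i hi => ?_⟩
      obtain rfl : i = m := by omega
      ext j
      simp only [mem_codeSet, Finset.mem_filter, h.root]
      constructor
      · rintro ⟨h1, x, hx, rfl⟩
        exact absurd (dig_emptyCode hx) h1
      · simp
    | succ n ih =>
      intro hn
      obtain ⟨c, hc, hcI⟩ := ih (by omega)
      have hu : pp n < n ∨ pp n = m := h.parent n hn
      have huv : IsValidCode k p A (M (pp n)) (c (pp n)) := by
        rcases hu with hu | hu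
        · exact (hc.2 _ hu).1
        · rw [hu]; exact hc.1
      have hset : ∀ a, a ∈ codeSet k p (c (pp n)) ↔ a ∈ I ∧ M (pp n) a ≠ 0 := fun a => by
        rw [hcI _ hu, Finset.mem_filter]
      have hr : IsValidCode k p A (M (pp n)) (keepMarked k p (M n) (c (pp n))) := by
        have h1 := h.isValidCode_keepMarked (i' := n) huv
        have h2 := h.isValidCode_keepMarked (i' := pp n) h1
        rwa [keepMarked_comm (h.not_mem _) (h.not_mem _), huv.1] at h2
      obtain ⟨z, hz1, hz2, hz3⟩ := h.exists_code_extending hn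
        (hI.mono (Finset.filter_subset (fun j => M n j ≠ 0) I))
        (fun a ha => (Finset.mem_filter.mp ha).2) hr fun a => by
          rw [mem_codeSet_keepMarked, hset, Finset.mem_filter]; tauto
      have hup : ∀ x, x ≠ n → Function.update c n z x = c x := fun x hx => by
        rw [Function.update_of_ne hx]
      have hppn : ∀ x ≤ n, pp x ≠ n := fun x hx => by
        rcases h.parent x (by omega) with h | h <;> omega
      refine ⟨Function.update c n z, ⟨?_, fun x hx => ?_⟩, fun i hi => ?_⟩
      · rw [hup m (by omega)]; exact hc.1
      · rw [hup (pp x) (hppn x (by omega))]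
        rcases Nat.lt_succ_iff_lt_or_eq.mp hx with hx | rfl
        · rw [hup x (by omega)]; exact hc.2 x hx
        · rw [Function.update_self]; exact ⟨hz1, hz2⟩
      · by_cases hin : i = n
        · rw [hin, Function.update_self, hz3]
        · rw [hup i hin]; exact hcI i (by omega)
  obtain ⟨c, hc, hcI⟩ := key m le_rfl
  exact ⟨c, hc, fun i hi => hcI i (.inl hi)⟩

/-- The maximum value of a labeling is the maximum weight of a conflict-free set. -/
theorem isGreatest_codeLabelingValue (h : IsRootedDecomposition m p k pp M A) {w : ℕ → ℚ}
    (hw : w p = 0) {o : ℚ}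
    (ho : IsGreatest {q | ∃ I, IsConflictFree p A I ∧ ∑ j ∈ I, w j = q} o) :
    IsGreatest {q | ∃ c, IsCodeLabeling m p k pp M A m c ∧
      codeLabelingValue m p k pp M w (fun _ _ => 0) m c = q} o := by
  convert ho using 1
  ext q
  constructor
  · rintro ⟨c, hc, rfl⟩
    obtain ⟨I, hI, hcI⟩ := h.exists_isConflictFree_of_labeling hc
    exact ⟨I, hI, (h.codeLabelingValue_eq hw hc hI hcI).symm⟩
  · rintro ⟨I, hI, rfl⟩
    obtain ⟨c, hc, hcI⟩ := h.exists_labeling_of_isConflictFree hI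
    exact ⟨c, hc, h.codeLabelingValue_eq hw hc hI hcI⟩

/-- Once all nodes are eliminated, only the virtual root is left; its bag is empty, so the empty
tuple is its only label. -/
theorem codeLabelingValue_zero (h : IsRootedDecomposition m p k pp M A) {w : ℕ → ℚ}
    {F : ℕ → ℕ → ℚ} {o : ℚ}
    (ho : IsGreatest {q | ∃ c, IsCodeLabeling m p k pp M A 0 c ∧
      codeLabelingValue m p k pp M w F 0 c = q} o) : F m (emptyCode k p) = o := by
  obtain ⟨c, hc, rfl⟩ := ho.1
  have h1 := hc.1.1
  rw [keepMarked_eq_emptyCode h.root] at h1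
  simp [codeLabelingValue, labelingValue, ← h1]

end IsRootedDecomposition

theorem exists_isGreatest_isConflictFree (p : ℕ) (A : ℕ → ℕ → ℕ) (w : ℕ → ℚ) :
    ∃ o, IsGreatest {q | ∃ I, IsConflictFree p A I ∧ ∑ j ∈ I, w j = q} o := by
  classical
  obtain ⟨I, hI, hmax⟩ := Finset.exists_max_image
    ((Finset.range p).powerset.filter fun I => IsConflictFree p A I) (fun I => ∑ j ∈ I, w j)
    ⟨∅, Finset.mem_filter.mpr ⟨by simp, by simp [IsConflictFree]⟩⟩
  rw [Finset.mem_filter] at hI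
  refine ⟨_, ⟨I, hI.2, rfl⟩, ?_⟩
  rintro q ⟨I', hI', rfl⟩
  refine hmax I' (Finset.mem_filter.mpr ⟨Finset.mem_powerset.mpr fun a ha => ?_, hI'⟩)
  exact Finset.mem_range.mpr (hI'.1 a ha)

/-! ### The dynamic program -/

namespace NatExpr

/-- The number of nodes of the tree. -/
def nodeCount : NatExpr := .read 0 (.const 0) (.const 1)

/-- The base of the codes of tuples. -/
def radix : NatExpr := .add (reg 13) (.const 1)

/-- `keepMarked`, for the bag of the node `i`. -/
def keepMarked (k : ℕ) (i c : NatExpr) : NatExpr :=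
  sum (fun x => .mul (ite (.read 16 i (digit radix c x)) (digit radix c x) (reg 13)) (radix.pow x)) k

/-- The test `IsValidCode`, for the bag of the node `i`. -/
def isValidCode (k : ℕ) (i c : NatExpr) : NatExpr :=
  .mul (.eq (keepMarked k i c) c)
    (.eq (sum (fun x => sum (fun y => .read 15 (digit radix c x) (digit radix c y)) x) k) (.const 0))

@[simp] theorem eval_nodeCount (s : RamState) : nodeCount.eval s = s.nat 0 0 1 := rfl

@[simp] theorem eval_radix (s : RamState) : radix.eval s = s.nat 13 0 0 + 1 := rfl

@[simp] theorem eval_keepMarked (s : RamState) (k : ℕ) (i c : NatExpr) :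
    (keepMarked k i c).eval s =
      _root_.keepMarked k (s.nat 13 0 0) (s.nat 16 (i.eval s)) (c.eval s) := by
  simp only [keepMarked, eval_sum, eval, eval_ite, eval_digit, eval_pow, eval_radix, eval_reg]
  rfl

theorem eval_isValidCode_ne_zero (s : RamState) (k : ℕ) (i c : NatExpr) :
    (isValidCode k i c).eval s ≠ 0 ↔
      IsValidCode k (s.nat 13 0 0) (s.nat 15) (s.nat 16 (i.eval s)) (c.eval s) := by
  simp [isValidCode, IsValidCode, dig, and_comm]

end NatExpr

/-- `unmarkedWeight`, for the bag of the node `i` and the weights in array `β`. -/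
def WtExpr.unmarkedWeight (β k : ℕ) (i c : NatExpr) : WtExpr :=
  .sum (fun x => .read β (.ite (.read 16 i (.digit .radix c x)) (.reg 13) (.digit .radix c x))
    (.const 0)) k

@[simp] theorem WtExpr.eval_unmarkedWeight (s : RamState) (β k : ℕ) (i c : NatExpr) :
    (unmarkedWeight β k i c).eval s =
      _root_.unmarkedWeight k (s.nat 13 0 0) (fun j => s.wt β j 0) (s.nat 16 (i.eval s))
        (c.eval s) := by
  simp only [unmarkedWeight, eval_sum, eval, NatExpr.eval, NatExpr.eval_ite, NatExpr.eval_digit,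
    NatExpr.eval_radix, NatExpr.eval_reg]
  rfl

namespace RamProgram

/-- The row of the tables that belongs to the node in word array `a`. -/
def tableRow (a : ℕ) : NatExpr := .add (.reg 25) (.reg a)

/-- The value of the label in word array `26` at the node in word array `23` with parent `24`. -/
def labelValue (β k : ℕ) : WtExpr :=
  .add (.read (β + 2) (tableRow 23) (.reg 26)) (.unmarkedWeight β k (.reg 24) (.reg 26))

/-- Improve the best value for a label of the parent. -/
def improveBest (β k : ℕ) : RamProgram :=
  .cond (.isValidCode k (.reg 23) (.reg 26))
    (.condLe (labelValue β k) (.read (β + 3) (tableRow 23) (.keepMarked k (.reg 24) (.reg 26)))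
      .skip
      (.setW (β + 3) (tableRow 23) (.keepMarked k (.reg 24) (.reg 26)) (labelValue β k)))
    .skip

/-- Add the best value to the value of a label of the parent. -/
def addBest (β k : ℕ) : RamProgram :=
  .setW (β + 2) (tableRow 24) (.reg 26)
    (.add (.read (β + 2) (tableRow 24) (.reg 26))
      (.read (β + 3) (tableRow 23) (.keepMarked k (.reg 23) (.reg 26))))

/-- Eliminate a node. -/
def eliminateNode (β k : ℕ) : RamProgram :=
  .seq (.set 23 (.const 0) (.const 0) (.sub (.sub .nodeCount (.const 1)) (.reg 22)))
    (.seq (.set 24 (.const 0) (.const 0) (.read 18 (.reg 23) (.const 0)))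
      (.seq (forLoop 26 (.pow .radix k) (improveBest β k))
        (forLoop 26 (.pow .radix k) (addBest β k))))

/-- Eliminate all nodes, from the last one to the first one. -/
def eliminateAll (β k : ℕ) : RamProgram := forLoop 22 .nodeCount (eliminateNode β k)

variable {W β k m p b i u : ℕ} {pp : ℕ → ℕ} {M A : ℕ → ℕ → ℕ} {w : ℕ → ℚ} {F : ℕ → ℕ → ℚ}
  {s : RamState}

/-- The row becomes the maximum over labels with a given restriction, started from the default value
0. An entry is therefore either 0 or attained; that an entry 0 is attained where it matters follows
later from nonnegativity. -/
theorem exec_improveBest_loop (hK : (p + 1) ^ k ≤ W) (hp : s.nat 13 0 0 = p)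
    (hi : s.nat 23 0 0 = i) (hu : s.nat 24 0 0 = u) (hb : s.nat 25 0 0 = b)
    (hM : s.nat 16 = M) (hA : s.nat 15 = A) (hw : ∀ j, s.wt β j 0 = w j) (hF : s.wt (β + 2) = F)
    (hg : ∀ y, s.wt (β + 3) (b + i) y = 0) :
    Exec W (forLoop 26 (.pow .radix k) (improveBest β k)) s fun t s' =>
      t ≤ (p + 1) ^ k * 5 + 2 ∧ (∀ a ≠ b + i, s'.wt (β + 3) a = s.wt (β + 3) a) ∧
      (∀ y, IsValidCode k p A (M i) y → F (b + i) y + unmarkedWeight k p w (M u) y ≤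
        s'.wt (β + 3) (b + i) (keepMarked k p (M u) y)) ∧
      ∀ z, s'.wt (β + 3) (b + i) z = 0 ∨ ∃ y, IsValidCode k p A (M i) y ∧
        keepMarked k p (M u) y = z ∧
        F (b + i) y + unmarkedWeight k p w (M u) y = s'.wt (β + 3) (b + i) z := by
  refine (Exec.forLoop (n := (p + 1) ^ k) 3 (fun n s' =>
      (∀ a ≠ b + i, s'.wt (β + 3) a = s.wt (β + 3) a) ∧
      (∀ y < n, IsValidCode k p A (M i) y → F (b + i) y + unmarkedWeight k p w (M u) y ≤
        s'.wt (β + 3) (b + i) (keepMarked k p (M u) y)) ∧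
      ∀ z, s'.wt (β + 3) (b + i) z = 0 ∨ ∃ y, IsValidCode k p A (M i) y ∧
        keepMarked k p (M u) y = z ∧
        F (b + i) y + unmarkedWeight k p w (M u) y = s'.wt (β + 3) (b + i) z)
    (by simp [improveBest]) hK ?_ ⟨by simp, by simp, by simp [hg]⟩ (fun n s' x h => h) ?_).mono ?_
  · intro s' hf
    simp [hf.nat 13 (by simp [improveBest]), hp]
  · intro n s' hn hf hc ⟨h1, h2, h3⟩
    have e13 := hf.nat 13 (by simp [improveBest])
    have e23 := hf.nat 23 (by simp [improveBest])
    have e24 := hf.nat 24 (by simp [improveBest])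
    have e25 := hf.nat 25 (by simp [improveBest])
    have e16 := hf.nat 16 (by simp [improveBest])
    have e15 := hf.nat 15 (by simp [improveBest])
    have eF := hf.wt (β + 2) (by simp [improveBest])
    have ew := hf.wt β (by simp [improveBest])
    refine .cond (fun hv => ?_) fun hv => .skip ⟨by omega, h1, fun y hy hvy => ?_, h3⟩
    · rw [NatExpr.eval_isValidCode_ne_zero] at hv
      simp only [e13, hp, e15, hA, e16, hM, NatExpr.eval_reg, e23, hi, hc] at hv
      refine .condLe (fun hle => .skip ⟨by omega, h1, fun y hy hvy => ?_, h3⟩) fun hlt => ?_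
      · rcases Nat.lt_succ_iff_lt_or_eq.mp hy with hy | rfl
        · exact h2 y hy hvy
        · simpa [labelValue, tableRow, e25, hb, e23, hi, hc, eF, hF, e13, hp, e24, hu, e16, hM, ew,
            hw] using hle
      · simp only [labelValue, tableRow, WtExpr.eval, NatExpr.eval, NatExpr.eval_reg, e25, hb, e23,
          hi, hc, eF, hF, e13, hp, e24, hu, e16, hM, ew, hw, WtExpr.eval_unmarkedWeight,
          NatExpr.eval_keepMarked] at hlt
        refine .setW ⟨by omega, fun a ha => ?_, fun y hy hvy => ?_, fun z => ?_⟩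
        · simp only [labelValue, tableRow, WtExpr.eval, NatExpr.eval, NatExpr.eval_reg, e25, hb, e23,
            hi, hc, eF, hF, e13, hp, e24, hu, e16, hM, ew, hw, WtExpr.eval_unmarkedWeight,
            NatExpr.eval_keepMarked]
          funext z
          simp [ha, h1]
        · simp only [labelValue, tableRow, WtExpr.eval, NatExpr.eval, NatExpr.eval_reg, e25, hb, e23,
            hi, hc, eF, hF, e13, hp, e24, hu, e16, hM, ew, hw, WtExpr.eval_unmarkedWeight,
            NatExpr.eval_keepMarked, RamState.setWt_wt_same, true_and]
          rcases Nat.lt_succ_iff_lt_or_eq.mp hy with hy | rfl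
          · have := h2 y hy hvy
            split_ifs with he
            · rw [he] at this
              exact this.trans hlt.le
            · exact this
          · simp
        · simp only [labelValue, tableRow, WtExpr.eval, NatExpr.eval, NatExpr.eval_reg, e25, hb, e23,
            hi, hc, eF, hF, e13, hp, e24, hu, e16, hM, ew, hw, WtExpr.eval_unmarkedWeight,
            NatExpr.eval_keepMarked, RamState.setWt_wt_same, true_and]
          split_ifs with he
          · exact .inr ⟨n, hv, he.symm, rfl⟩
          · exact h3 z
    · rcases Nat.lt_succ_iff_lt_or_eq.mp hy with hy | rfl
      · exact h2 y hy hvy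
      · refine absurd hv ((NatExpr.eval_isValidCode_ne_zero _ _ _ _).mpr ?_)
        simpa [e13, hp, e15, hA, e16, hM, e23, hi, hc] using hvy
  · intro t s' _ ⟨ht, h1, h2, h3⟩
    exact ⟨ht, h1, fun y hy => h2 y hy.lt hy, h3⟩

/-- Invalid codes are updated too, which is harmless because labelings use valid codes only. -/
theorem exec_addBest_loop (hK : (p + 1) ^ k ≤ W) (hp : s.nat 13 0 0 = p)
    (hi : s.nat 23 0 0 = i) (hu : s.nat 24 0 0 = u) (hb : s.nat 25 0 0 = b) (hM : s.nat 16 = M) :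
    Exec W (forLoop 26 (.pow .radix k) (addBest β k)) s fun t s' =>
      t ≤ (p + 1) ^ k * 3 + 2 ∧ ∀ a y, s'.wt (β + 2) a y = s.wt (β + 2) a y +
        if a = b + u ∧ y < (p + 1) ^ k then s.wt (β + 3) (b + i) (keepMarked k p (M i) y) else 0 := by
  refine (Exec.forLoop (n := (p + 1) ^ k) 1 (fun n s' =>
      ∀ a y, s'.wt (β + 2) a y = s.wt (β + 2) a y +
        if a = b + u ∧ y < n then s.wt (β + 3) (b + i) (keepMarked k p (M i) y) else 0)
    (by simp [addBest]) hK ?_ (by simp) (fun n s' x h => h) ?_).mono fun _ _ _ h => h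
  · intro s' hf
    simp [hf.nat 13 (by simp [addBest]), hp]
  · intro n s' hn hf hc h
    have e13 := hf.nat 13 (by simp [addBest])
    have e23 := hf.nat 23 (by simp [addBest])
    have e24 := hf.nat 24 (by simp [addBest])
    have e25 := hf.nat 25 (by simp [addBest])
    have e16 := hf.nat 16 (by simp [addBest])
    have eg := hf.wt (β + 3) (by simp [addBest])
    refine .setW ⟨le_rfl, fun a y => ?_⟩
    simp only [tableRow, WtExpr.eval, NatExpr.eval, NatExpr.eval_reg, e25, hb, e23,
      hi, hc, e13, hp, e24, hu, e16, hM, eg, NatExpr.eval_keepMarked, RamState.setWt_wt_same, h]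
    by_cases ha : a = b + u
    · subst ha
      rcases lt_trichotomy y n with hy | rfl | hy
      · simp [hy, hy.ne, hy.trans (Nat.lt_succ_self n)]
      · simp
      · simp [hy.ne', not_lt.mpr hy.le, show ¬ y < n + 1 by omega]
    · simp [ha]

end RamProgram

namespace RamProgram

variable {W β k m p b i u : ℕ} {pp : ℕ → ℕ} {M A : ℕ → ℕ → ℕ} {w : ℕ → ℚ} {F : ℕ → ℕ → ℚ}
  {s : RamState}

/-- The invariant is that `o` remains the maximum value of a labeling of the nodes not yet
eliminated, with respect to the current table. A run uses the rows `b, …, b + m` only; all later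
rows stay zero and serve the next run, so no table is ever cleared. -/
theorem exec_eliminateAll (h : IsRootedDecomposition m p k pp M A) (hK : (p + 1) ^ k ≤ W)
    (hm : m ≤ W) (hp : s.nat 13 0 0 = p) (hms : s.nat 0 0 1 = m) (hb : s.nat 25 0 0 = b)
    (hM : s.nat 16 = M) (hA : s.nat 15 = A) (hpp : ∀ i < m, s.nat 18 i 0 = pp i)
    (hw : ∀ j, s.wt β j 0 = w j) (hw0 : ∀ j, 0 ≤ w j) (hwp : w p = 0)
    (hF0 : ∀ a y, 0 ≤ s.wt (β + 2) a y) (hFb : ∀ a ≥ b, ∀ y, s.wt (β + 2) a y = 0)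
    (hgb : ∀ a ≥ b, ∀ y, s.wt (β + 3) a y = 0) {o : ℚ}
    (ho : IsGreatest {q | ∃ I, IsConflictFree p A I ∧ ∑ j ∈ I, w j = q} o) :
    Exec W (eliminateAll β k) s fun t s' =>
      t ≤ m * ((p + 1) ^ k * 8 + 8) + 2 ∧ (∀ a y, 0 ≤ s'.wt (β + 2) a y) ∧
      (∀ a ≥ b + (m + 1), ∀ y, s'.wt (β + 2) a y = 0 ∧ s'.wt (β + 3) a y = 0) ∧
      s'.wt (β + 2) (b + m) (emptyCode k p) = o := by
  refine (Exec.forLoop (n := m) ((p + 1) ^ k * 8 + 6) (fun n s' =>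
      (∀ a y, 0 ≤ s'.wt (β + 2) a y) ∧
      (∀ a ≥ b + (m + 1), ∀ y, s'.wt (β + 2) a y = 0 ∧ s'.wt (β + 3) a y = 0) ∧
      (∀ i < m - n, ∀ y, s'.wt (β + 3) (b + i) y = 0) ∧
      IsGreatest {q | ∃ c, IsCodeLabeling m p k pp M A (m - n) c ∧
        codeLabelingValue m p k pp M w (fun x => s'.wt (β + 2) (b + x)) (m - n) c = q} o)
    (by simp [eliminateNode, improveBest, addBest]) hm ?_ ⟨hF0, ?_, ?_, ?_⟩
    (fun n s' x h => h) ?_).mono ?_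
  · intro s' hf
    simp [hf.nat 0 (by simp [eliminateNode, improveBest, addBest]), hms]
  · exact fun a ha y => ⟨hFb a (by omega) y, hgb a (by omega) y⟩
  · exact fun i _ y => hgb _ (by omega) y
  · rw [Nat.sub_zero, show (fun x => s.wt (β + 2) (b + x)) = fun _ _ => 0 from
      funext fun x => funext fun y => hFb _ (Nat.le_add_right _ _) _]
    exact h.isGreatest_codeLabelingValue hwp ho
  · intro n s' hn hf hc ⟨h1, h2, h3, h4⟩
    obtain ⟨i, hi⟩ : ∃ i, m - n = i + 1 := ⟨m - n - 1, by omega⟩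
    have hi' : m - (n + 1) = i := by omega
    have him : i < m := by omega
    rw [hi] at h3 h4
    rw [hi']
    have e13 := hf.nat 13 (by simp [eliminateNode, improveBest, addBest])
    have e0 := hf.nat 0 (by simp [eliminateNode, improveBest, addBest])
    have e25 := hf.nat 25 (by simp [eliminateNode, improveBest, addBest])
    have e16 := hf.nat 16 (by simp [eliminateNode, improveBest, addBest])
    have e15 := hf.nat 15 (by simp [eliminateNode, improveBest, addBest])
    have e18 := hf.nat 18 (by simp [eliminateNode, improveBest, addBest])
    have ew := hf.wt β (by simp [eliminateNode, improveBest, addBest])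
    have hppm : pp i ≤ m := by rcases h.parent i him with h | h <;> omega
    -- Round `n` treats node `m - 1 - n`, so every node comes before its parent.
    have hidx : m - 1 - n = i := by omega
    refine .seq (.set (by simp [e0, hms, hc]; omega) (.seq (.set ?_ (.seq ?_))))
    · simp [e0, hms, hc, hidx, e18, hpp i him]; omega
    refine (exec_improveBest_loop (β := β) (k := k) (p := p) (i := i) (u := pp i) (b := b) (M := M)
      (A := A) (w := w) (F := s'.wt (β + 2)) hK (by simp [e13, hp]) ?_ ?_ (by simp [e25, hb])
      (by simp [e16, hM]) (by simp [e15, hA]) (by simp [ew, hw]) (by simp) ?_).mono ?_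
    · simp [e0, hms, hc, hidx]
    · simp [e0, hms, hc, hidx, e18, hpp i him]
    · intro y; simpa using h3 i (by omega) y
    intro t₁ s₁ hf₁ ⟨ht₁, k1, k2, k3⟩
    simp only [RamState.setNat_wt] at k1 
    have hF₁ : s₁.wt (β + 2) = s'.wt (β + 2) := by
      rw [hf₁.wt (β + 2) (by simp [improveBest])]; rfl
    have hnn : ∀ y, 0 ≤ s'.wt (β + 2) (b + i) y + unmarkedWeight k p w (M (pp i)) y := fun y =>
      add_nonneg (h1 _ _) (Finset.sum_nonneg fun _ _ => hw0 _)
    have hgnn : ∀ z, 0 ≤ s₁.wt (β + 3) (b + i) z := fun z => by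
      rcases k3 z with k3 | ⟨y, -, -, k3⟩
      · exact k3.ge
      · rw [← k3]; exact hnn y
    refine (exec_addBest_loop (β := β) (k := k) (p := p) (i := i) (u := pp i) (b := b) (M := M)
      hK ?_ ?_ ?_ ?_ ?_).mono ?_
    · rw [hf₁.nat 13 (by simp [improveBest])]; simp [e13, hp]
    · rw [hf₁.nat 23 (by simp [improveBest])]; simp [e0, hms, hc, hidx]
    · rw [hf₁.nat 24 (by simp [improveBest])]; simp [e0, hms, hc, hidx, e18, hpp i him]
    · rw [hf₁.nat 25 (by simp [improveBest])]; simp [e25, hb]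
    · rw [hf₁.nat 16 (by simp [improveBest])]; simp [e16, hM]
    intro t₂ s₂ hf₂ ⟨ht₂, l1⟩
    have hg₂ : s₂.wt (β + 3) = s₁.wt (β + 3) := hf₂.wt (β + 3) (by simp [addBest])
    rw [hF₁] at l1
    refine ⟨by omega, fun a y => ?_, fun a ha y => ⟨?_, ?_⟩, fun x hx y => ?_, ?_⟩
    · rw [l1]
      split_ifs
      · exact add_nonneg (h1 _ _) (hgnn _)
      · exact add_nonneg (h1 _ _) le_rfl
    · rw [l1, if_neg (by omega), (h2 a ha y).1, add_zero]
    · rw [hg₂, k1 a (by omega)]; exact (h2 a ha y).2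
    · rw [hg₂, k1 (b + x) (by omega)]; exact h3 x (by omega) y
    · refine isGreatest_eliminate (F := fun x => s'.wt (β + 2) (b + x)) (g := s₁.wt (β + 3) (b + i))
        him h.parent (fun x _ y hy => ?_) k2 (fun y hy => ?_) h4
      · simp only [l1, add_right_inj, hy.lt, and_true]
      -- The restriction of the parent's label is itself a label of `i` with the required
      -- restriction. Its value is nonnegative, so a table entry that is still 0 is attained by it.
      · have hz := h.isValidCode_keepMarked (i' := i) hy
        have hup : keepMarked k p (M (pp i)) (keepMarked k p (M i) y) = keepMarked k p (M i) y := by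
          rw [keepMarked_comm (h.not_mem _) (h.not_mem _), hy.1]
        rcases k3 (keepMarked k p (M i) y) with k3 | k3
        · refine ⟨_, hz, hup, le_antisymm ?_ ?_⟩
          · have := k2 _ hz
            rwa [hup] at this
          · rw [k3]; exact hnn _
        · exact k3
  · intro t s' _ ⟨ht, h1, h2, _, h4⟩
    refine ⟨ht, h1, h2, ?_⟩
    rw [Nat.sub_self] at h4
    exact h.codeLabelingValue_zero h4

end RamProgram

/-! ### Finding an optimal set by deleting members -/

/-- The weights after the members `0, …, n - 1` except for those in `I` have been deleted. -/
def reducedWeight (w : ℕ → ℚ) (I : Finset ℕ) (n j : ℕ) : ℚ := if n ≤ j ∨ j ∈ I then w j else 0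

theorem reducedWeight_insert (w : ℕ → ℚ) {I : Finset ℕ} {n : ℕ} :
    reducedWeight w (insert n I) (n + 1) = reducedWeight w I n := by
  funext j
  unfold reducedWeight
  congr 1
  rw [Finset.mem_insert, eq_iff_iff]
  constructor
  · rintro (h | rfl | h)
    · exact .inl (by omega)
    · exact .inl le_rfl
    · exact .inr h
  · rintro (h | h)
    · rcases h.eq_or_lt with h | h
      · exact .inr (.inl h.symm)
      · exact .inl h
    · exact .inr (.inr h)

theorem reducedWeight_succ_of_ne (w : ℕ → ℚ) (I : Finset ℕ) {n j : ℕ} (h : j ≠ n) :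
    reducedWeight w I (n + 1) j = reducedWeight w I n j := by
  unfold reducedWeight
  congr 1
  rw [eq_iff_iff]
  exact or_congr_left ⟨fun _ => by omega, fun _ => by omega⟩

theorem reducedWeight_nonneg {w : ℕ → ℚ} (hw : ∀ j, 0 ≤ w j) (I : Finset ℕ) (n j : ℕ) :
    0 ≤ reducedWeight w I n j := by
  unfold reducedWeight
  split_ifs
  · exact hw j
  · exact le_rfl

theorem reducedWeight_succ_self (w : ℕ → ℚ) {I : Finset ℕ} {n : ℕ} (hI : ∀ a ∈ I, a < n) :
    reducedWeight w I (n + 1) n = 0 := by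
  rw [reducedWeight, if_neg]
  rintro (h | h)
  · omega
  · exact (hI n h).false

theorem reducedWeight_succ_le {w : ℕ → ℚ} (hw : ∀ j, 0 ≤ w j) {I : Finset ℕ} {n : ℕ}
    (hI : ∀ a ∈ I, a < n) (j : ℕ) : reducedWeight w I (n + 1) j ≤ reducedWeight w I n j := by
  by_cases h : j = n
  · rw [h, reducedWeight_succ_self w hI]
    exact reducedWeight_nonneg hw _ _ _
  · rw [reducedWeight_succ_of_ne w I h]

/-- The members `0, …, n - 1` except for those in `I` can be deleted without decreasing the maximum
weight `o` of a conflict-free set, but no member of `I` can. -/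
structure IsReduction (p : ℕ) (A : ℕ → ℕ → ℕ) (w : ℕ → ℚ) (o : ℚ) (n : ℕ) (I : Finset ℕ) : Prop where
  lt : ∀ a ∈ I, a < n
  isGreatest : IsGreatest {q | ∃ I', IsConflictFree p A I' ∧ ∑ j ∈ I', reducedWeight w I n j = q} o
  sum_lt : ∀ a ∈ I, ∀ I', IsConflictFree p A I' → a ∉ I' → ∑ j ∈ I', reducedWeight w I n j < o

namespace IsReduction

variable {p n : ℕ} {A : ℕ → ℕ → ℕ} {w : ℕ → ℚ} {o o' : ℚ} {I : Finset ℕ}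

/-- Deleting a member lowers no sum below what is recorded as lost: all sums weakly decrease, so `o
≤ o'` forces equality, and the strict bounds for the members of `I` persist. -/
theorem delete (h : IsReduction p A w o n I) (hw : ∀ j, 0 ≤ w j) (hle : o ≤ o')
    (ho' : IsGreatest {q | ∃ I', IsConflictFree p A I' ∧
      ∑ j ∈ I', reducedWeight w I (n + 1) j = q} o') : IsReduction p A w o (n + 1) I := by
  have hmono : ∀ I' : Finset ℕ, ∑ j ∈ I', reducedWeight w I (n + 1) j ≤
      ∑ j ∈ I', reducedWeight w I n j := fun I' =>
    Finset.sum_le_sum fun j _ => reducedWeight_succ_le hw h.lt j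
  have he : o = o' := by
    refine le_antisymm hle ?_
    obtain ⟨I', hI', rfl⟩ := ho'.1
    exact (hmono I').trans (h.isGreatest.2 ⟨I', hI', rfl⟩)
  exact ⟨fun a ha => (h.lt a ha).trans (Nat.lt_succ_self n), he ▸ ho',
    fun a ha I' hI' haI' => (hmono I').trans_lt (h.sum_lt a ha I' hI' haI')⟩

/-- A set that avoids `n` has the same weight before and after the deletion of `n`, hence at most
`o' < o`. So `n` is indispensable, and inserting it restores the previous weights. -/
theorem keep (h : IsReduction p A w o n I) (hlt : o' < o)
    (ho' : IsGreatest {q | ∃ I', IsConflictFree p A I' ∧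
      ∑ j ∈ I', reducedWeight w I (n + 1) j = q} o') : IsReduction p A w o (n + 1) (insert n I) := by
  refine ⟨fun a ha => ?_, ?_, fun a ha I' hI' haI' => ?_⟩
  · rcases Finset.mem_insert.mp ha with rfl | ha
    · exact Nat.lt_succ_self _
    · exact (h.lt a ha).trans (Nat.lt_succ_self n)
  · rw [reducedWeight_insert]; exact h.isGreatest
  · rw [reducedWeight_insert]
    rcases Finset.mem_insert.mp ha with rfl | ha
    · refine lt_of_le_of_lt (le_of_eq ?_) (lt_of_le_of_lt (ho'.2 ⟨I', hI', rfl⟩) hlt)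
      refine Finset.sum_congr rfl fun j hj => (reducedWeight_succ_of_ne w I ?_).symm
      rintro rfl
      exact haI' hj
    · exact h.sum_lt a ha I' hI' haI'

theorem zero (ho : IsGreatest {q | ∃ I', IsConflictFree p A I' ∧ ∑ j ∈ I', w j = q} o) :
    IsReduction p A w o 0 ∅ := by
  refine ⟨by simp, ?_, by simp⟩
  simpa [reducedWeight] using ho

/-- A set that attains `o` must contain every member of `I`, so `I` inherits its conflict-freeness.
-/
theorem isConflictFree (h : IsReduction p A w o p I) : IsConflictFree p A I := by
  obtain ⟨I', hI', he⟩ := h.isGreatest.1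
  refine hI'.mono fun a ha => ?_
  by_contra haI'
  exact (h.sum_lt a ha I' hI' haI').ne he

/-- For `n = p` all members outside `I` have reduced weight zero, so an optimal set, which contains
`I`, gets its whole weight from `I`. -/
theorem sum_eq (h : IsReduction p A w o p I) : ∑ j ∈ I, w j = o := by
  obtain ⟨I', hI', he⟩ := h.isGreatest.1
  have hsub : I ⊆ I' := fun a ha => by
    by_contra haI'
    exact (h.sum_lt a ha I' hI' haI').ne he
  rw [← he, ← Finset.sum_subset hsub]
  · exact Finset.sum_congr rfl fun j hj => by rw [reducedWeight, if_pos (.inr hj)]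
  · intro j hj hjI
    rw [reducedWeight, if_neg]
    rintro (h | h)
    · exact absurd (hI'.1 j hj) (not_lt.mpr h)
    · exact hjI h

end IsReduction

/-! ### The self-reduction as a program. -/

namespace RamProgram

/-- The value of the empty label at the virtual root: the maximum weight. -/
def rootValue (β k : ℕ) : WtExpr :=
  .read (β + 2) (.add (.reg 25) .nodeCount) (.sum (fun x => .mul (.reg 13) (.pow .radix x)) k)

/-- Append the number in word array `a` to the list in word array `31`. -/
def appendMember (a : ℕ) : RamProgram :=
  .seq (.set 31 (.const 0) (.reg 30) (.reg a))
    (.set 30 (.const 0) (.const 0) (.add (.reg 30) (.const 1)))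

/-- Delete a member if this does not decrease the maximum weight, and list it otherwise. -/
def testMember (β k : ℕ) : RamProgram :=
  .seq (.setW (β + 1) (.const 0) (.const 0) (.read β (.reg 27) (.const 0)))
    (.seq (.setW β (.reg 27) (.const 0) .zero)
      (.seq (eliminateAll β k)
        (.seq (.condLe (.read (β + 4) (.const 0) (.const 0)) (rootValue β k) .skip
            (.seq (.setW β (.reg 27) (.const 0) (.read (β + 1) (.const 0) (.const 0)))
              (appendMember 27)))
          (.set 25 (.const 0) (.const 0) (.add (.reg 25) (.add .nodeCount (.const 1)))))))

/-- List a conflict-free set of maximum weight. -/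
def listOptimum (β k : ℕ) : RamProgram :=
  .seq (eliminateAll β k)
    (.seq (.setW (β + 4) (.const 0) (.const 0) (rootValue β k))
      (.seq (.set 25 (.const 0) (.const 0) (.add .nodeCount (.const 1)))
        (forLoop 27 (.reg 13) (testMember β k))))

@[simp] theorem eval_rootValue (s : RamState) (β k : ℕ) : (rootValue β k).eval s =
    s.wt (β + 2) (s.nat 25 0 0 + s.nat 0 0 1) (emptyCode k (s.nat 13 0 0)) := by
  simp [rootValue, emptyCode]

@[simp] theorem writesNat_eliminateAll {β k b : ℕ} :
    (eliminateAll β k).WritesNat b ↔ b = 22 ∨ b = 23 ∨ b = 24 ∨ b = 26 := by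
  simp [eliminateAll, eliminateNode, improveBest, addBest]

@[simp] theorem writesWt_eliminateAll {β k b : ℕ} :
    (eliminateAll β k).WritesWt b ↔ b = β + 3 ∨ b = β + 2 := by
  simp [eliminateAll, eliminateNode, improveBest, addBest]

theorem bijOn_append {f : ℕ → ℕ} {c j : ℕ} {I : Finset ℕ} (h : Set.BijOn f (Set.Iio c) I)
    (hj : j ∉ I) {f' : ℕ → ℕ} (hf' : ∀ x, f' x = if x = c then j else f x) :
    Set.BijOn f' (Set.Iio (c + 1)) ((insert j I : Finset ℕ) : Set ℕ) := by
  have hlt : ∀ x < c, f' x = f x := fun x hx => by rw [hf', if_neg hx.ne]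
  have hc : f' c = j := by rw [hf', if_pos rfl]
  refine ⟨fun x hx => ?_, fun x hx y hy he => ?_, fun a ha => ?_⟩
  · rcases Nat.lt_succ_iff_lt_or_eq.mp hx with hx | rfl
    · rw [hlt x hx]; exact Finset.mem_insert_of_mem (h.1 hx)
    · rw [hc]; exact Finset.mem_insert_self _ _
  · rcases Nat.lt_succ_iff_lt_or_eq.mp hx with hx | rfl <;>
      rcases Nat.lt_succ_iff_lt_or_eq.mp hy with hy | rfl
    · rw [hlt x hx, hlt y hy] at he; exact h.2.1 hx hy he
    · rw [hlt x hx, hc] at he; exact absurd (he ▸ h.1 hx) hj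
    · rw [hlt y hy, hc] at he; exact absurd (he ▸ h.1 hy) hj
    · rfl
  · rcases Finset.mem_insert.mp ha with rfl | ha
    · exact ⟨c, Nat.lt_succ_self c, hc⟩
    · obtain ⟨x, hx, rfl⟩ := h.2.2 ha
      exact ⟨x, Nat.lt_succ_of_lt hx, hlt x hx⟩

variable {W β k m p : ℕ} {pp : ℕ → ℕ} {M A : ℕ → ℕ → ℕ} {w : ℕ → ℚ} {s : RamState}

/-- One run finds `o`, and each of the `p` trial deletions needs another one; this is where the
exponent grows from `k` to `k + 1`. Every run has its own block of `m + 1` table rows, which begins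
at the number in word array `25`. -/
theorem exec_listOptimum (h : IsRootedDecomposition m p k pp M A) (hK : (p + 1) ^ k ≤ W)
    (hW : (p + 1) * (m + 1) ≤ W) (hp : s.nat 13 0 0 = p) (hms : s.nat 0 0 1 = m)
    (hb : s.nat 25 0 0 = 0) (hcnt : s.nat 30 0 0 = 0)
    (hM : s.nat 16 = M) (hA : s.nat 15 = A) (hpp : ∀ i < m, s.nat 18 i 0 = pp i)
    (hw : ∀ j, s.wt β j 0 = w j) (hw0 : ∀ j, 0 ≤ w j) (hwp : w p = 0)
    (hF : s.wt (β + 2) = 0) (hg : s.wt (β + 3) = 0) :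
    Exec W (listOptimum β k) s fun t s' =>
      t ≤ (p + 1) * (m * ((p + 1) ^ k * 8 + 8) + 12) ∧ ∃ I : Finset ℕ,
        Set.BijOn (s'.nat 31 0) (Set.Iio (s'.nat 30 0 0)) I ∧ s'.nat 30 0 0 ≤ p ∧
        IsConflictFree p A I ∧ ∀ I', IsConflictFree p A I' → ∑ j ∈ I', w j ≤ ∑ j ∈ I, w j := by
  have hmW : m + 1 ≤ W := le_trans (Nat.le_mul_of_pos_left _ (Nat.succ_pos p)) hW
  have hpW : p ≤ W := le_trans (le_trans (Nat.le_succ p) (Nat.le_mul_of_pos_right _ (Nat.succ_pos m))) hW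
  obtain ⟨o, ho⟩ := exists_isGreatest_isConflictFree p A w
  refine .seq ((exec_eliminateAll h hK (by omega) hp hms hb hM hA hpp hw hw0 hwp (by simp [hF])
    (by simp [hF]) (by simp [hg]) ho).mono ?_)
  intro t₁ s₁ hf₁ ⟨ht₁, h1, h2, h3⟩
  refine .seq (.setW (.seq (.set (by simp [hf₁.nat 0 (by simp), hms]; omega) ?_)))
  have hroot : (rootValue β k).eval s₁ = o := by
    rw [eval_rootValue, hf₁.nat 25 (by simp), hf₁.nat 0 (by simp), hf₁.nat 13 (by simp), hb, hms, hp]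
    exact h3
  refine (Exec.forLoop (n := p) (m * ((p + 1) ^ k * 8 + 8) + 10) (fun n s' =>
    s'.nat 25 0 0 = (n + 1) * (m + 1) ∧ s'.nat 30 0 0 ≤ n ∧ (∀ a y, 0 ≤ s'.wt (β + 2) a y) ∧
    (∀ a ≥ (n + 1) * (m + 1), ∀ y, s'.wt (β + 2) a y = 0 ∧ s'.wt (β + 3) a y = 0) ∧
    ∃ I : Finset ℕ, Set.BijOn (s'.nat 31 0) (Set.Iio (s'.nat 30 0 0)) I ∧ IsReduction p A w o n I ∧
      ∀ j, s'.wt β j 0 = reducedWeight w I n j)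
    (by simp [testMember, appendMember]) hpW ?_ ?_ (fun n s' x h => by simpa using h) ?_).mono ?_
  · intro s' hf
    simp [hf.nat 13 (by simp [testMember, appendMember]), hf₁.nat 13 (by simp), hp]
  · refine ⟨by simp [hf₁.nat 0 (by simp), hms], by simp [hf₁.nat 30 (by simp), hcnt],
      by simpa using h1, by simpa using h2, ∅, by simp [hf₁.nat 30 (by simp), hcnt],
      .zero ho, fun j => ?_⟩
    simp [hf₁.wt β (by simp), hw, reducedWeight]
  · intro n s' hn hf hc ⟨k1, k2, k3, k4, I, k5, k6, k7⟩
    have e13 : s'.nat 13 0 0 = p := by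
      simp [hf.nat 13 (by simp [testMember, appendMember]), hf₁.nat 13 (by simp), hp]
    have e0 : s'.nat 0 0 1 = m := by
      simp [hf.nat 0 (by simp [testMember, appendMember]), hf₁.nat 0 (by simp), hms]
    have e16 : s'.nat 16 = M := by
      simp [hf.nat 16 (by simp [testMember, appendMember]), hf₁.nat 16 (by simp), hM]
    have e15 : s'.nat 15 = A := by
      simp [hf.nat 15 (by simp [testMember, appendMember]), hf₁.nat 15 (by simp), hA]
    have e18 : ∀ i < m, s'.nat 18 i 0 = pp i := by
      simpa [hf.nat 18 (by simp [testMember, appendMember]), hf₁.nat 18 (by simp)] using hpp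
    have e4 : s'.wt (β + 4) 0 0 = o := by
      simp [hf.wt (β + 4) (by simp [testMember, appendMember]), hroot]
    have hnm : (n + 1 + 1) * (m + 1) = (n + 1) * (m + 1) + (m + 1) := by ring
    have hnW : (n + 1 + 1) * (m + 1) ≤ W := le_trans (Nat.mul_le_mul_right _ (by omega)) hW
    obtain ⟨o', ho'⟩ := exists_isGreatest_isConflictFree p A (reducedWeight w I (n + 1))
    refine .seq (.setW (.seq (.setW (.seq ?_))))
    refine (exec_eliminateAll (p := p) (b := (n + 1) * (m + 1)) h hK (by omega) (by simp [e13])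
      (by simp [e0]) (by simp [k1]) (by simp [e16]) (by simp [e15]) (by simpa using e18)
      (w := reducedWeight w I (n + 1)) ?_ (reducedWeight_nonneg hw0 _ _) ?_ (by simpa using k3)
      (fun a ha y => by simpa using (k4 a ha y).1) (fun a ha y => by simpa using (k4 a ha y).2)
      ho').mono ?_
    · intro j
      by_cases hj : j = n
      · simp [hc, hj, reducedWeight_succ_self w k6.lt]
      · simp [hc, hj, reducedWeight_succ_of_ne w I hj, k7]
    · unfold reducedWeight
      split_ifs
      · exact hwp
      · rfl
    intro t₂ s₂ hf₂ ⟨ht₂, l1, l2, l3⟩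
    have f0 : s₂.nat 0 0 1 = m := by simp [hf₂.nat 0 (by simp), e0]
    have f13 : s₂.nat 13 0 0 = p := by simp [hf₂.nat 13 (by simp), e13]
    have f25 : s₂.nat 25 0 0 = (n + 1) * (m + 1) := by simp [hf₂.nat 25 (by simp), k1]
    have f27 : s₂.nat 27 0 0 = n := by simp [hf₂.nat 27 (by simp), hc]
    have f30 : s₂.nat 30 = s'.nat 30 := by simp [hf₂.nat 30 (by simp)]
    have f31 : s₂.nat 31 = s'.nat 31 := by simp [hf₂.nat 31 (by simp)]
    have f4 : s₂.wt (β + 4) 0 0 = o := by simp [hf₂.wt (β + 4) (by simp), e4]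
    have f1 : s₂.wt (β + 1) 0 0 = reducedWeight w I n n := by
      simp [hf₂.wt (β + 1) (by simp), k7, hc]
    have f2 : ∀ j, s₂.wt β j 0 = reducedWeight w I (n + 1) j := fun j => by
      by_cases hj : j = n
      · simp [hf₂.wt β (by simp), hc, hj, reducedWeight_succ_self w k6.lt]
      · simp [hf₂.wt β (by simp), hc, hj, reducedWeight_succ_of_ne w I hj, k7]
    refine .seq (.condLe (fun hle => .skip ?_) fun hlt => .seq (.setW (.seq (.set ?_ (.set ?_ ?_)))))
    · simp only [WtExpr.eval, NatExpr.eval, f4, eval_rootValue, f25, f0, f13, l3] at hle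
      refine .set (by simp [f25, f0]; omega) ⟨by omega, ?_, ?_, ?_, ?_, I, ?_, k6.delete hw0 hle ho', ?_⟩
      · simp [f25, f0, hnm]
      · simp [f30]; omega
      · simpa using l1
      · rw [hnm]; simpa using l2
      · simpa [f30, f31] using k5
      · simpa using f2
    · simp [f27]; omega
    · simp [f30]; omega
    · simp only [WtExpr.eval, NatExpr.eval, f4, eval_rootValue, f25, f0, f13, l3] at hlt
      refine .set (by simp [f25, f0]; omega)
        ⟨by omega, ?_, ?_, ?_, ?_, insert n I, ?_, k6.keep hlt ho', ?_⟩
      · simp [f25, f0, hnm]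
      · simp [f30]; omega
      · simpa using l1
      · rw [hnm]; simpa using l2
      · refine Eq.subst (motive := fun c => Set.BijOn _ (Set.Iio c) _) ?_
          (bijOn_append k5 (fun hn => (k6.lt n hn).false) fun x => ?_)
        · simp [f30]
        · simp [f30, f31, f27]
      · intro j
        rw [reducedWeight_insert]
        by_cases hj : j = n
        · simp [f27, hj, f1]
        · simp [f27, hj, f2, reducedWeight_succ_of_ne w I hj]
  · intro t s' _ ⟨ht, _, k2, _, _, I, k5, k6, _⟩
    refine ⟨?_, I, k5, k2, k6.isConflictFree, fun I' hI' => ?_⟩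
    · have : (p + 1) * (m * ((p + 1) ^ k * 8 + 8) + 12) =
        p * (m * ((p + 1) ^ k * 8 + 8) + 10 + 2) + (m * ((p + 1) ^ k * 8 + 8) + 12) := by ring
      omega
    · rw [k6.sum_eq]
      exact ho.2 ⟨I', hI', rfl⟩

end RamProgram

/-! ### Rooted tree decompositions of conflict graphs -/

/-- No set of vertices separates two vertices of `S` in the subgraph of `G` induced by `S`. -/
def SimpleGraph.ConnectedOn {V : Type*} (G : SimpleGraph V) (S : Set V) : Prop :=
  ∀ D : Set V, (S ∩ D).Nonempty → (S \ D).Nonempty → ∃ a ∈ S ∩ D, ∃ b ∈ S \ D, G.Adj a b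

/-- A walk from inside to outside of `D` uses an edge that crosses. Stated for images of maps that
preserve adjacency, this covers subtrees, subgraphs of `G` and copies. -/
theorem SimpleGraph.connectedOn_of_preconnected {V X : Type*} {G : SimpleGraph V}
    {K : SimpleGraph X} (hK : K.Preconnected) (f : X → V) (hf : ∀ x y, K.Adj x y → G.Adj (f x) (f y)) :
    G.ConnectedOn (Set.range f) := by
  rintro D ⟨_, ⟨x, rfl⟩, hx⟩ ⟨_, ⟨y, rfl⟩, hy⟩
  obtain ⟨q⟩ := hK x y
  obtain ⟨d, -, h1, h2⟩ := q.exists_boundary_dart (f ⁻¹' D) hx hy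
  exact ⟨_, ⟨⟨d.fst, rfl⟩, h1⟩, _, ⟨⟨d.snd, rfl⟩, h2⟩, hf _ _ d.adj⟩

/-- An enumeration `e` of the nodes of `T` in which every node except for the first one is preceded
by a neighbor, its parent; `pp` holds the positions of the parents. -/
structure IsSearchOrder {m : ℕ} (T : SimpleGraph (Fin m)) (e : Fin m ≃ Fin m) (pp : ℕ → ℕ) : Prop where
  root : pp 0 = m
  parent : ∀ i : Fin m, (i : ℕ) ≠ 0 → ∃ j : Fin m, j < i ∧ pp i = j ∧ T.Adj (e i) (e j)

namespace IsSearchOrder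

variable {m : ℕ} {T : SimpleGraph (Fin m)} {e : Fin m ≃ Fin m} {pp : ℕ → ℕ}

/-- The edges from the nodes other than the first one to their parents are distinct, because a
parent comes earlier. There are `m - 1` of them, so they are all the edges of the tree. -/
theorem parent_of_adj (h : IsSearchOrder T e pp) (hT : T.IsTree) {a b : Fin m}
    (hab : T.Adj (e a) (e b)) : (pp a = b ∨ pp b = a) := by
  classical
  have : NeZero m := ⟨fun h0 => by subst h0; exact a.elim0⟩
  choose par hlt hpar hadj using h.parent
  let q : {i : Fin m // (i : ℕ) ≠ 0} → Sym2 (Fin m) := fun i => s(e i, e (par i i.2))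
  have hq : Function.Injective q := by
    rintro ⟨i, hi⟩ ⟨j, hj⟩ he
    simp only [q, Sym2.eq_iff, EmbeddingLike.apply_eq_iff_eq] at he
    rcases he with ⟨he, -⟩ | ⟨h1, h2⟩
    · exact Subtype.ext he
    · have h3 := hlt i hi
      have h4 := hlt j hj
      rw [h2] at h3
      rw [← h1] at h4
      exact absurd h3 (not_lt.mpr h4.le)
  have hsub : Finset.univ.image q ⊆ T.edgeFinset := by
    intro z hz
    obtain ⟨i, -, rfl⟩ := Finset.mem_image.mp hz
    rw [SimpleGraph.mem_edgeFinset, SimpleGraph.mem_edgeSet]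
    exact hadj i i.2
  have hcard : Fintype.card {i : Fin m // (i : ℕ) ≠ 0} + 1 = m := by
    have h1 : Fintype.card {i : Fin m // (i : ℕ) ≠ 0} = _ :=
      Fintype.card_subtype_compl (fun i : Fin m => (i : ℕ) = 0)
    have h2 : Fintype.card {i : Fin m // (i : ℕ) = 0} = 1 := by
      rw [Fintype.card_eq_one_iff]
      refine ⟨⟨⟨0, Nat.pos_of_ne_zero (NeZero.ne m)⟩, rfl⟩, ?_⟩
      rintro ⟨y, hy⟩
      exact Subtype.ext (Fin.ext hy)
    rw [h2, Fintype.card_fin] at h1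
    have := Nat.pos_of_ne_zero (NeZero.ne m)
    omega
  have heq := Finset.eq_of_subset_of_card_le hsub (by
    rw [Finset.card_image_of_injective _ hq, Finset.card_univ]
    have := hT.card_edgeFinset
    rw [Fintype.card_fin] at this
    omega)
  have hmem : s(e a, e b) ∈ T.edgeFinset := by
    rw [SimpleGraph.mem_edgeFinset, SimpleGraph.mem_edgeSet]; exact hab
  rw [← heq] at hmem
  obtain ⟨⟨i, hi⟩, -, he⟩ := Finset.mem_image.mp hmem
  simp only [q, Sym2.eq_iff, EmbeddingLike.apply_eq_iff_eq] at he
  rcases he with ⟨rfl, rfl⟩ | ⟨rfl, rfl⟩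
  · exact .inl (hpar i hi)
  · exact .inr (hpar i hi)

/-- A connected set of nodes has only one node whose parent is not in the set. -/
theorem eq_of_parent_not_mem (h : IsSearchOrder T e pp) (hT : T.IsTree) {S : Set (Fin m)}
    (hS : T.ConnectedOn S) {i i' : Fin m} (hi : e i ∈ S) (hpi : ∀ u : Fin m, pp i = u → e u ∉ S)
    (hi' : e i' ∈ S) (hpi' : ∀ u : Fin m, pp i' = u → e u ∉ S) : i = i' := by
  wlog hlt : i' < i generalizing i i'
  · rcases lt_trichotomy i i' with hl | he | hl
    · exact (this hi' hpi' hi hpi hl).symm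
    · exact he
    · exact absurd hl hlt
  exfalso
  -- `D` consists of `i` and its descendants, and misses the earlier node `i'`. An edge inside `S`
  -- that leaves `D` could only join `i` to its parent, but the parent is not in `S`.
  let D : Set (Fin m) :=
    {v | Relation.ReflTransGen (fun a b : Fin m => pp a = b ∧ b < a) (e.symm v) i}
  have hge : ∀ v, v ∈ D → i ≤ e.symm v := fun v hv => by
    change Relation.ReflTransGen _ _ _ at hv
    generalize e.symm v = x at hv
    induction hv using Relation.ReflTransGen.head_induction_on with
    | refl => exact le_rfl
    | head h1 _ ih => exact ih.trans h1.2.le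
  obtain ⟨a, ⟨haS, haD⟩, b, ⟨hbS, hbD⟩, hab⟩ := hS D
    ⟨e i, hi, by simp only [D, Set.mem_ofPred_eq, Equiv.symm_apply_apply]; exact .refl⟩
    ⟨e i', hi', fun hd => by
      have := hge _ hd
      rw [Equiv.symm_apply_apply] at this
      exact absurd hlt (not_lt.mpr this)⟩
  obtain ⟨x, rfl⟩ := e.surjective a
  obtain ⟨y, rfl⟩ := e.surjective b
  have hlt' : ∀ x y : Fin m, pp x = y → y < x := fun x y hxy => by
    have hx0 : (x : ℕ) ≠ 0 := fun h0 => by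
      rw [h0, h.root] at hxy
      have := y.2
      omega
    obtain ⟨j, hj, hj', -⟩ := h.parent x hx0
    rwa [show y = j from Fin.ext (hxy.symm.trans hj')]
  simp only [D, Set.mem_ofPred_eq, Equiv.symm_apply_apply] at haD hbD
  rcases h.parent_of_adj hT hab with hxy | hyx
  · rcases Relation.ReflTransGen.cases_head haD with rfl | ⟨z, ⟨hz, -⟩, hzi⟩
    · exact hpi y hxy hbS
    · obtain rfl : z = y := Fin.ext (hz.symm.trans hxy)
      exact hbD hzi
  · exact hbD (.head ⟨hyx, hlt' _ _ hyx⟩ haD)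

end IsSearchOrder

/-! ### The tree decomposition inherited by the conflict graph. -/

namespace TreeDecomposition

variable {V τ : Type*} {G : SimpleGraph V} (D : TreeDecomposition G τ)

/-- The nodes whose bags meet a connected set of vertices form a connected set. -/
theorem connectedOn {U : Set V} (hU : G.ConnectedOn U) :
    D.T.ConnectedOn {t | (U ∩ D.bag t).Nonempty} := by
  have hv : ∀ v, D.T.ConnectedOn {t | v ∈ D.bag t} := fun v => by
    have := SimpleGraph.connectedOn_of_preconnected (G := D.T) (D.connected_bags v).preconnected
      Subtype.val (fun x y hxy => hxy)
    rwa [Subtype.range_coe] at this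
  rintro X ⟨t, ⟨u, hu, hut⟩, htX⟩ ⟨t', ⟨u', hu', hut'⟩, htX'⟩
  by_contra hno
  -- If no tree edge crosses `X`, then for each vertex of `U` all nodes lie on one side. As `U` is
  -- connected, an edge of `G` joins vertices of different sides, which contradicts their having a
  -- common bag.
  have hcut : ∀ v ∈ U, ∀ t₁, v ∈ D.bag t₁ → t₁ ∈ X → ∀ t₂, v ∈ D.bag t₂ → t₂ ∈ X := by
    intro v hvU t₁ h1 h1X t₂ h2
    by_contra h2X
    obtain ⟨a, ⟨ha, haX⟩, b, ⟨hb, hbX⟩, hab⟩ := hv v X ⟨t₁, h1, h1X⟩ ⟨t₂, h2, h2X⟩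
    exact hno ⟨a, ⟨⟨v, hvU, ha⟩, haX⟩, b, ⟨⟨v, hvU, hb⟩, hbX⟩, hab⟩
  obtain ⟨a, ⟨haU, haY⟩, b, ⟨hbU, hbY⟩, hab⟩ := hU {v | ∀ t, v ∈ D.bag t → t ∈ X}
    ⟨u, hu, hcut u hu t hut htX⟩ ⟨u', hu', fun h => htX' (h t' hut')⟩
  obtain ⟨t, hat, hbt⟩ := D.exists_edge_bag a b hab
  exact hbY (hcut b hbU t hbt (haY t hat))

theorem card_le_independenceNumber [Fintype τ] [Finite V] (t : τ) {I : Finset ℕ} {f : I → V}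
    (hf : ∀ a, f a ∈ D.bag t) (hI : ∀ a b, a ≠ b → f a ≠ f b ∧ ¬ G.Adj (f a) (f b)) :
    I.card ≤ D.independenceNumber := by
  classical
  let g : I ↪ D.bag t := ⟨fun a => ⟨f a, hf a⟩, fun a b hab => by
    by_contra hne
    exact (hI a b hne).1 (congrArg Subtype.val hab)⟩
  have hind : (G.induce (D.bag t)).IsIndepSet (Finset.univ.map g : Finset (D.bag t)) := by
    intro x hx y hy hxy
    simp only [Finset.coe_map, Finset.coe_univ, Set.image_univ, Set.mem_range] at hx hy
    obtain ⟨a, rfl⟩ := hx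
    obtain ⟨b, rfl⟩ := hy
    exact (hI a b fun h => hxy (congrArg g h)).2
  calc I.card = (Finset.univ.map g).card := by simp
    _ ≤ (G.induce (D.bag t)).indepNum := hind.card_le_indepNum
    _ ≤ D.independenceNumber :=
      Finset.le_sup (f := fun t => (G.induce (D.bag t)).indepNum) (Finset.mem_univ t)

/-- The conflict graph of a family of connected sets of vertices inherits the tree decomposition. -/
theorem isRootedDecomposition {n m p k : ℕ} {G : SimpleGraph (Fin n)}
    (D : TreeDecomposition G (Fin m)) (hk : D.independenceNumber ≤ k) {e : Fin m ≃ Fin m}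
    {pp : ℕ → ℕ} (he : IsSearchOrder D.T e pp) {U : Fin p → Set (Fin n)}
    (hU : ∀ j, (U j).Nonempty) (hconn : ∀ j, G.ConnectedOn (U j)) {M A : ℕ → ℕ → ℕ}
    (hM : ∀ (i : Fin m) (j : Fin p), M i j ≠ 0 ↔ (U j ∩ D.bag (e i)).Nonempty)
    (hMp : ∀ i, M i p = 0) (hMm : ∀ j, M m j = 0) (hpA : ∀ j, A p j = 0) (hAp : ∀ j, A j p = 0)
    (hA : ∀ a b : Fin p, A a b ≠ 0 ↔ ∃ u ∈ U a, ∃ v ∈ U b, u = v ∨ G.Adj u v) :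
    IsRootedDecomposition m p k pp M A where
  parent i hi := by
    rcases Nat.eq_zero_or_pos i with rfl | h0
    · exact .inr he.root
    · obtain ⟨j, hj, hj', -⟩ := he.parent ⟨i, hi⟩ h0.ne'
      simp only at hj'
      exact .inl (hj' ▸ hj)
  not_mem := hMp
  root := hMm
  left_none := hpA
  right_none := hAp
  self j hj := by
    obtain ⟨u, hu⟩ := hU ⟨j, hj⟩
    exact (hA ⟨j, hj⟩ ⟨j, hj⟩).mpr ⟨u, hu, u, hu, .inl rfl⟩
  symm a ha b hb hab := by
    by_contra hba
    obtain ⟨u, hu, v, hv, huv⟩ := (hA ⟨b, hb⟩ ⟨a, ha⟩).mp hba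
    exact (hA ⟨a, ha⟩ ⟨b, hb⟩).mpr ⟨v, hv, u, hu, huv.imp Eq.symm fun h => h.symm⟩ hab
  top j hj := by
    have hne : ∃ i, ∃ h : i < m, (U ⟨j, hj⟩ ∩ D.bag (e ⟨i, h⟩)).Nonempty := by
      obtain ⟨u, hu⟩ := hU ⟨j, hj⟩
      obtain ⟨t, ht⟩ := D.exists_mem_bag u
      exact ⟨e.symm t, (e.symm t).2, u, hu, by simpa using ht⟩
    classical
    obtain ⟨him, hi⟩ := Nat.find_spec hne
    -- The topmost node is the first one in the search order whose bag meets the member: its parent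
    -- comes earlier and so misses the member.
    set i := Nat.find hne with hidef
    have hparent : ∀ i < m, M i j ≠ 0 → M (pp i) j = 0 → ∀ u : Fin m, pp i = u →
        ¬ (U ⟨j, hj⟩ ∩ D.bag (e u)).Nonempty := fun i _ _ h u hu hn => by
      rw [hu] at h
      exact (hM u ⟨j, hj⟩).mpr hn h
    have hMi : M i j ≠ 0 := (hM ⟨i, him⟩ ⟨j, hj⟩).mpr hi
    have hMpi : M (pp i) j = 0 := by
      by_contra hne'
      rcases Nat.eq_zero_or_pos i with h0 | h0
      · rw [h0, he.root] at hne'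
        exact hne' (hMm j)
      · obtain ⟨x, hx, hx', -⟩ := he.parent ⟨i, him⟩ h0.ne'
        simp only at hx'
        rw [hx'] at hne'
        exact Nat.find_min hne (hidef ▸ hx) ⟨x.2, (hM x ⟨j, hj⟩).mp hne'⟩
    refine ⟨i, him, ⟨hMi, hMpi⟩, fun i' hi' h1 h2 => ?_⟩
    have := he.eq_of_parent_not_mem D.isTree (D.connectedOn (hconn ⟨j, hj⟩))
      (i := ⟨i', hi'⟩) (i' := ⟨i, him⟩) ((hM ⟨i', hi'⟩ ⟨j, hj⟩).mp h1)
      (hparent i' hi' h1 h2) hi (hparent i him hMi hMpi)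
    exact congrArg Fin.val this
  edge a ha b hb hab := by
    obtain ⟨u, hu, v, hv, huv⟩ := (hA ⟨a, ha⟩ ⟨b, hb⟩).mp hab
    obtain ⟨t, hut, hvt⟩ : ∃ t, u ∈ D.bag t ∧ v ∈ D.bag t := by
      rcases huv with rfl | huv
      · obtain ⟨t, ht⟩ := D.exists_mem_bag u
        exact ⟨t, ht, ht⟩
      · exact D.exists_edge_bag u v huv
    refine ⟨e.symm t, (e.symm t).2, (hM (e.symm t) ⟨a, ha⟩).mpr ⟨u, hu, ?_⟩,
      (hM (e.symm t) ⟨b, hb⟩).mpr ⟨v, hv, ?_⟩⟩ <;> rwa [Equiv.apply_symm_apply]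
  card_le i hi I hI hIM := by
    -- One vertex of each member within the old bag; absence of conflicts makes these vertices
    -- distinct and nonadjacent.
    choose f hf using fun a : I => (hM ⟨i, hi⟩ ⟨a, hI.1 a a.2⟩).mp (hIM a a.2)
    refine (D.card_le_independenceNumber (e ⟨i, hi⟩) (fun a => (hf a).2) fun a b hab => ?_).trans hk
    have h0 := hI.2 a a.2 b b.2 fun h => hab (Subtype.ext h)
    have h1 := mt (hA ⟨a, hI.1 a a.2⟩ ⟨b, hI.1 b b.2⟩).mpr (not_not.mpr h0)
    exact ⟨fun h => h1 ⟨_, (hf a).1, _, (hf b).1, .inl h⟩,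
      fun h => h1 ⟨_, (hf a).1, _, (hf b).1, .inr h⟩⟩

end TreeDecomposition

/-! ### Searching the tree -/

/-- The first `c` nodes `o 0, …, o (c - 1)` of a search of `T`, as stored in the arrays `ord` of
nodes, `pp` of the positions of their parents and `vis` of marks. -/
structure IsPartialSearch {m : ℕ} (T : SimpleGraph (Fin m)) (o : ℕ → Fin m) (c : ℕ)
    (ord pp vis : ℕ → ℕ) : Prop where
  pos : 0 < c
  ord : ∀ x < c, ord x = o x
  injOn : Set.InjOn o (Set.Iio c)
  vis : ∀ v : Fin m, vis v ≠ 0 ↔ ∃ x < c, o x = v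
  root : pp 0 = m
  parent : ∀ x, 0 < x → x < c → pp x < x ∧ T.Adj (o x) (o (pp x))

namespace IsPartialSearch

variable {m c : ℕ} {T : SimpleGraph (Fin m)} {o : ℕ → Fin m} {ord pp vis : ℕ → ℕ}

theorem le (h : IsPartialSearch T o c ord pp vis) : c ≤ m := by
  have := Fintype.card_le_of_injective (fun x : Fin c => o x)
    fun x y hxy => Fin.ext (h.injOn x.2 y.2 hxy)
  simpa using this

/-- A nonempty set of nodes closed under taking neighbors is everything, so the queue cannot run
empty too early. -/
theorem eq_of_closed (h : IsPartialSearch T o c ord pp vis) (hT : T.Connected)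
    (hcl : ∀ y < c, ∀ v : Fin m, T.Adj (o y) v → vis v ≠ 0) : c = m := by
  refine le_antisymm h.le ?_
  have hall : ∀ v, ∃ x < c, o x = v := by
    by_contra! hne
    obtain ⟨v, hv⟩ := hne
    obtain ⟨a, ⟨-, x, hx, rfl⟩, b, ⟨-, hb⟩, hab⟩ :=
      SimpleGraph.connectedOn_of_preconnected (G := T) hT.preconnected id (fun _ _ h => h)
        {v | ∃ x < c, o x = v} ⟨o 0, ⟨o 0, rfl⟩, 0, h.pos, rfl⟩
        ⟨v, ⟨v, rfl⟩, fun ⟨x, hx, hxv⟩ => hv x hx hxv⟩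
    exact hb ((h.vis b).mp (hcl x hx b hab))
  have := Fintype.card_le_of_surjective (fun x : Fin c => o x) fun v => by
    obtain ⟨x, hx, hxv⟩ := hall v
    exact ⟨⟨x, hx⟩, hxv⟩
  simpa using this

theorem visit (h : IsPartialSearch T o c ord pp vis) {v : Fin m} {y : ℕ} (hv : vis v = 0)
    (hy : y < c) (hyv : T.Adj (o y) v) {ord' pp' vis' : ℕ → ℕ}
    (hord : ∀ x, ord' x = if x = c then (v : ℕ) else ord x)
    (hpp : ∀ x, pp' x = if x = c then y else pp x)
    (hvis : ∀ x, vis' x = if x = v then 1 else vis x) :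
    IsPartialSearch T (Function.update o c v) (c + 1) ord' pp' vis' := by
  have hc := h.pos
  have ho : ∀ x < c, Function.update o c v x = o x := fun x hx => Function.update_of_ne hx.ne _ _
  have hnew : ∀ x < c, o x ≠ v := fun x hx he => (h.vis v).mpr ⟨x, hx, he⟩ hv
  refine ⟨Nat.succ_pos c, fun x hx => ?_, fun x hx z hz he => ?_, fun u => ?_, ?_, fun x h0 hx => ?_⟩
  · rcases Nat.lt_succ_iff_lt_or_eq.mp hx with hx | rfl
    · rw [hord, if_neg hx.ne, ho x hx, h.ord x hx]
    · rw [hord, if_pos rfl, Function.update_self]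
  · rcases Nat.lt_succ_iff_lt_or_eq.mp hx with hx | rfl <;>
      rcases Nat.lt_succ_iff_lt_or_eq.mp hz with hz | rfl
    · rw [ho x hx, ho z hz] at he; exact h.injOn hx hz he
    · rw [ho x hx, Function.update_self] at he; exact absurd he (hnew x hx)
    · rw [ho z hz, Function.update_self] at he; exact absurd he.symm (hnew z hz)
    · rfl
  · rw [hvis]
    by_cases hu : (u : ℕ) = v
    · simp only [hu, if_pos, ne_eq, one_ne_zero, not_false_eq_true, true_iff]
      exact ⟨c, Nat.lt_succ_self c, by rw [Function.update_self]; exact (Fin.ext hu).symm⟩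
    · rw [if_neg hu, h.vis]
      constructor
      · rintro ⟨x, hx, rfl⟩
        exact ⟨x, by omega, ho x hx⟩
      · rintro ⟨x, hx, rfl⟩
        rcases Nat.lt_succ_iff_lt_or_eq.mp hx with hx | rfl
        · exact ⟨x, hx, (ho x hx).symm⟩
        · rw [Function.update_self] at hu; exact absurd rfl hu
  · rw [hpp, if_neg (by omega), h.root]
  · rw [hpp]
    rcases Nat.lt_succ_iff_lt_or_eq.mp hx with hx | rfl
    · obtain ⟨h1, h2⟩ := h.parent x h0 hx
      rw [if_neg hx.ne, ho x hx, ho _ (h1.trans hx)]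
      exact ⟨h1, h2⟩
    · rw [if_pos rfl, Function.update_self, ho y hy]
      exact ⟨hy, hyv.symm⟩

theorem exists_isSearchOrder (h : IsPartialSearch T o m ord pp vis) :
    ∃ e : Fin m ≃ Fin m, IsSearchOrder T e pp ∧ ∀ i : Fin m, ord i = e i := by
  have hinj : Function.Injective fun i : Fin m => o i :=
    fun i j hij => Fin.ext (h.injOn i.2 j.2 hij)
  refine ⟨Equiv.ofBijective _ (Finite.injective_iff_bijective.mp hinj), ⟨h.root, fun i hi => ?_⟩,
    fun i => h.ord i i.2⟩
  obtain ⟨h1, h2⟩ := h.parent i (Nat.pos_of_ne_zero hi) i.2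
  exact ⟨⟨pp i, h1.trans i.2⟩, h1, rfl, h2⟩

end IsPartialSearch

namespace RamProgram

/-- Visit the next neighbor of a node. -/
def searchNeighbor : RamProgram :=
  .seq (.set 24 (.const 0) (.const 0) (.read 3 (.reg 26) (.reg 23)))
    (.cond (.read 19 (.reg 24) (.const 0)) .skip
      (.seq (.set 19 (.reg 24) (.const 0) (.const 1))
        (.seq (.set 17 (.reg 20) (.const 0) (.reg 24))
          (.seq (.set 18 (.reg 20) (.const 0) (.reg 22))
            (.set 20 (.const 0) (.const 0) (.add (.reg 20) (.const 1)))))))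

/-- Breadth-first search of the tree from node `0`. -/
def searchTree : RamProgram :=
  .seq (.set 18 (.const 0) (.const 0) .nodeCount)
    (.seq (.set 19 (.const 0) (.const 0) (.const 1))
      (.seq (.set 20 (.const 0) (.const 0) (.const 1))
        (forLoop 22 .nodeCount
          (.seq (.set 26 (.const 0) (.const 0) (.read 17 (.reg 22) (.const 0)))
            (forLoop 23 (.read 2 (.reg 26) (.const 0)) searchNeighbor)))))

@[simp] theorem writesNat_searchNeighbor {b : ℕ} :
    searchNeighbor.WritesNat b ↔ b = 24 ∨ b = 19 ∨ b = 17 ∨ b = 18 ∨ b = 20 := by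
  simp [searchNeighbor]

@[simp] theorem writesWt_searchNeighbor {b : ℕ} : ¬ searchNeighbor.WritesWt b := by
  simp [searchNeighbor]

variable {W m : ℕ} {T : SimpleGraph (Fin m)} {s : RamState}

theorem exec_searchNeighbor_loop {c i : ℕ} {t : Fin m} {o : ℕ → Fin m} (hmW : m ≤ W)
    (h22 : s.nat 22 0 0 = i)
    (h26 : s.nat 26 0 0 = t) (hot : o i = t)
    (hT : ListsSet (s.nat 2 t 0) (s.nat 3 t) (T.neighborSet t))
    (h : IsPartialSearch T o c (fun x => s.nat 17 x 0) (fun x => s.nat 18 x 0)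
      (fun v => s.nat 19 v 0)) (hc : s.nat 20 0 0 = c) (hic : i < c) :
    Exec W (forLoop 23 (.read 2 (.reg 26) (.const 0)) searchNeighbor) s
      fun τ s' => τ ≤ s.nat 2 t 0 * 8 + 2 ∧ ∃ c' o', s'.nat 20 0 0 = c' ∧ c ≤ c' ∧
        IsPartialSearch T o' c' (fun x => s'.nat 17 x 0) (fun x => s'.nat 18 x 0)
          (fun v => s'.nat 19 v 0) ∧ (∀ x < c, o' x = o x) ∧
        (∀ v : Fin m, s.nat 19 v 0 ≠ 0 → s'.nat 19 v 0 ≠ 0) ∧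
        ∀ v, T.Adj t v → s'.nat 19 v 0 ≠ 0 := by
  obtain ⟨e, he, her, hes⟩ := hT
  have hlen : s.nat 2 t 0 ≤ W := by
    have := Fintype.card_le_of_injective e he
    simp only [Fintype.card_fin] at this
    omega
  refine (Exec.forLoop (n := s.nat 2 t 0) 6 (fun n s' => ∃ c' o', s'.nat 20 0 0 = c' ∧ c ≤ c' ∧
      IsPartialSearch T o' c' (fun x => s'.nat 17 x 0) (fun x => s'.nat 18 x 0)
        (fun v => s'.nat 19 v 0) ∧ (∀ x < c, o' x = o x) ∧
      (∀ v : Fin m, s.nat 19 v 0 ≠ 0 → s'.nat 19 v 0 ≠ 0) ∧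
      ∀ x : Fin (s.nat 2 t 0), x < n → s'.nat 19 (e x) 0 ≠ 0)
    (by simp) hlen ?_ ⟨c, o, hc, le_rfl, h, fun _ _ => rfl, fun _ h => h, by simp⟩
    (fun n s' x h => by simpa using h) ?_).mono ?_
  · intro s' hf
    simp [hf.nat 26 (by simp), hf.nat 2 (by simp), h26]
  · intro n s' hn hf h23 ⟨c', o', k1, k2, k3, k4, k6, k7⟩
    have e22 : s'.nat 22 0 0 = i := by rw [hf.nat 22 (by simp), h22]
    have e3 : s'.nat 3 = s.nat 3 := hf.nat 3 (by simp)
    have hv := hes ⟨n, hn⟩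
    simp only at hv
    set v := e ⟨n, hn⟩ with hvdef
    have hvt : T.Adj t v := by
      have : v ∈ T.neighborSet t := her ▸ Set.mem_range_self _
      exact this
    have e26 : s'.nat 26 0 0 = t := by rw [hf.nat 26 (by simp), h26]
    refine .seq (.set (by simp [e26, h23, e3, hv]; omega) (.cond (fun h19 => .skip ?_)
      fun h19 => .seq (.set (by simp; omega) (.seq (.set ?_ (.seq (.set ?_ (.set ?_ ?_))))))))
    · simp [e26, h23, e3, hv] at h19
      refine ⟨by omega, c', o', by simpa using k1, k2, by simpa using k3, k4,
        by simpa using k6, fun x hx => ?_⟩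
      rcases Nat.lt_succ_iff_lt_or_eq.mp hx with hx | hx
      · simpa using k7 x hx
      · have : x = ⟨n, hn⟩ := Fin.ext hx
        rw [this, ← hvdef]
        simpa using h19
    · simp [e26, h23, e3, hv]; omega
    · simp [e22]; have := k3.le; omega
    all_goals simp [e26, h23, e3, hv] at h19
    · have := (k3.visit h19 (hic.trans_le k2) (by rw [k4 i hic, hot]; exact hvt) (fun _ => rfl)
        (fun _ => rfl) fun _ => rfl).le
      simp [k1]; omega
    · refine ⟨by omega, c' + 1, Function.update o' c' v, by simp [k1], by omega,
        k3.visit h19 (y := i) (hic.trans_le k2) (by rw [k4 i hic, hot]; exact hvt) ?_ ?_ ?_,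
        fun x hx => ?_, fun x hx => ?_, fun x hx => ?_⟩
      · intro x; simp [k1, e26, h23, e3, hv]
      · intro x; simp [k1, e22]
      · intro x; simp [e26, h23, e3, hv]
      · rw [Function.update_of_ne (by omega), k4 x hx]
      · simp only [e26, h23, e3, hv, NatExpr.eval, NatExpr.eval_reg, ne_eq, Nat.reduceEqDiff,
          not_false_eq_true, RamState.setNat_nat_of_ne, RamState.setNat_nat_same, and_self, if_true,
          and_true]
        split_ifs
        · simp
        · exact k6 x hx
      · simp only [e26, h23, e3, hv, NatExpr.eval, NatExpr.eval_reg, ne_eq, Nat.reduceEqDiff,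
          not_false_eq_true, RamState.setNat_nat_of_ne, RamState.setNat_nat_same, and_self, if_true,
          and_true]
        split_ifs with hne
        · simp
        · rcases Nat.lt_succ_iff_lt_or_eq.mp hx with hx | hx
          · exact k7 x hx
          · have : x = ⟨n, hn⟩ := Fin.ext hx
            rw [this, ← hvdef] at hne
            exact absurd rfl hne
  · intro t' s' _ ⟨ht, c', o', k1, k2, k3, k4, k6, k7⟩
    refine ⟨ht, c', o', k1, k2, k3, k4, k6, fun v hv => ?_⟩
    obtain ⟨x, rfl⟩ : v ∈ Set.range e := by rw [her]; exact hv
    exact k7 x x.2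

/-- The time is charged to the degrees of the scanned nodes, whose sum is `2 * (m - 1)`. A uniform
bound on the rounds would only give quadratic time. -/
theorem exec_searchTree (hT : T.IsTree) (hm : 0 < m) (hmW : m ≤ W) (hms : s.nat 0 0 1 = m)
    (hadj : ∀ t : Fin m, ListsSet (s.nat 2 t 0) (s.nat 3 t) (T.neighborSet t))
    (h17 : s.nat 17 = 0) (h19 : s.nat 19 = 0) :
    Exec W searchTree s fun τ s' => τ ≤ 24 * m ∧ ∃ e : Fin m ≃ Fin m,
      IsSearchOrder T e (fun i => s'.nat 18 i 0) ∧ ∀ i : Fin m, s'.nat 17 i 0 = e i := by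
  classical
  have hdeg : ∀ t : Fin m, s.nat 2 t 0 = T.degree t := fun t => by
    obtain ⟨e, he, her, -⟩ := hadj t
    rw [← SimpleGraph.card_neighborSet_eq_degree, ← Nat.card_eq_fintype_card, ← her,
      Nat.card_range_of_injective he, Nat.card_eq_fintype_card, Fintype.card_fin]
  refine .seq (.set (by simp [hms, hmW]) (.seq (.set (by simp; omega) (.seq (.set (by simp; omega)
    ?_)))))
  refine (Exec.forLoop_timed (n := m) (fun i τ s' => ∃ c o, s'.nat 20 0 0 = c ∧ i ≤ c ∧
      IsPartialSearch T o c (fun x => s'.nat 17 x 0) (fun x => s'.nat 18 x 0)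
        (fun v => s'.nat 19 v 0) ∧ (∀ y < i, ∀ v, T.Adj (o y) v → s'.nat 19 v 0 ≠ 0) ∧
      τ ≤ ∑ y ∈ Finset.range i, (T.degree (o y) * 8 + 5)) (by simp) hmW ?_ ?_
      (fun n τ s' x h => by simpa using h) ?_).mono ?_
  · intro s' hf
    simp [hf.nat 0 (by simp), hms]
  · refine ⟨1, fun _ => ⟨0, hm⟩, by simp, by simp, ⟨one_pos, ?_, ?_, ?_, by simp [hms], ?_⟩,
      by simp, by simp⟩
    -- The list of nodes is initially zero, so node `0` is already its first entry.
    · intro x hx; simp [h17]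
    · intro x hx y hy _
      simp only [Set.mem_Iio] at hx hy
      omega
    · intro v
      simp [h19, Fin.ext_iff, eq_comm]
    · intro x h0 h1; omega
  · intro i τ s' hi hf hc ⟨c, o, k1, k2, k3, k4, k5⟩
    -- If every listed node had been scanned, the listed nodes would be closed under neighbors and
    -- hence be all `m` nodes.
    have hic : i < c := by
      refine lt_of_le_of_ne k2 fun he => ?_
      have := k3.eq_of_closed hT.connected (he ▸ k4)
      omega
    have e17 : s'.nat 17 i 0 = o i := k3.ord i hic
    have e2 : s'.nat 2 = s.nat 2 := by rw [hf.nat 2 (by simp)]; simp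
    have e3 : s'.nat 3 = s.nat 3 := by rw [hf.nat 3 (by simp)]; simp
    refine .seq (.set (by simp [hc, e17]; omega) ?_)
    refine (exec_searchNeighbor_loop (T := T) (c := c) (i := i) (t := o i) (o := o) hmW
      (by simp [hc]) (by simp [hc, e17]) rfl (by simpa [e2, e3] using hadj (o i))
      (by simpa using k3) (by simpa using k1) hic).mono ?_
    intro t₁ s₁ hf₁ ⟨ht₁, c', o', l1, l2, l3, l4, l5, l6⟩
    refine ⟨c', o', l1, by omega, l3, fun y hy v hv => ?_, ?_⟩
    · rcases Nat.lt_succ_iff_lt_or_eq.mp hy with hy | rfl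
      · exact l5 v (by simpa using k4 y hy v (by rwa [← l4 y (by omega)]))
      · exact l6 v (by rwa [← l4 y hic])
    · rw [Finset.sum_range_succ, l4 i hic, Finset.sum_congr rfl fun y hy => by
        rw [l4 y ((Finset.mem_range.mp hy).trans hic)]]
      have h1 : s'.nat 2 (o i) 0 = T.degree (o i) := by rw [e2, hdeg]
      simp only [ne_eq, not_false_eq_true, Nat.reduceEqDiff,
        RamState.setNat_nat_of_ne] at ht₁
      rw [h1] at ht₁
      omega
  · intro t s' _ ⟨τ, ht, c, o, _, k2, k3, _, k5⟩
    obtain rfl : c = m := le_antisymm k3.le k2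
    refine ⟨?_, k3.exists_isSearchOrder⟩
    have hbij : Function.Bijective fun x : Fin c => o x := Finite.injective_iff_bijective.mp
      fun i j hij => Fin.ext (k3.injOn i.2 j.2 hij)
    have h1 : ∑ y ∈ Finset.range c, (T.degree (o y) * 8 + 5) =
        ∑ v : Fin c, (T.degree v * 8 + 5) := by
      rw [← Fin.sum_univ_eq_sum_range (fun y => T.degree (o y) * 8 + 5)]
      exact hbij.sum_comp fun v => T.degree v * 8 + 5
    have h2 := T.sum_degrees_eq_twice_card_edges
    have h3 := hT.card_edgeFinset
    rw [h1, Finset.sum_add_distrib, ← Finset.sum_mul, h2] at k5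
    simp only [Finset.sum_const, Finset.card_univ, Fintype.card_fin, smul_eq_mul] at k5 h3
    omega

end RamProgram

/-! ### The conflict graph and its bags -/

namespace RamProgram

/-- Compute the bags of the members of the family, ordered like the nodes in word array `17`. -/
def buildBags (r : ℕ) : RamProgram :=
  forLoop 22 .nodeCount
    (.seq (.set 26 (.const 0) (.const 0) (.read 17 (.reg 22) (.const 0)))
      (.seq
        (forLoop 23 (.read 4 (.reg 26) (.const 0))
          (.set 21 (.reg 22) (.read 5 (.reg 26) (.reg 23)) (.const 1)))
        (forLoop 23 (.reg 13)
          (.set 16 (.reg 22) (.reg 23) (.lt (.const 0)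
            (.sum (fun x => .read 21 (.reg 22) (.read 14 (.reg 23) (.const x))) r))))))

/-- Compute the conflicts between the members of the family. -/
def buildConflicts (r : ℕ) : RamProgram :=
  forLoop 22 (.reg 13) (forLoop 23 (.reg 13)
    (.set 15 (.reg 22) (.reg 23) (.lt (.const 0) (.sum (fun x => .sum (fun y =>
      .add (.eq (.read 14 (.reg 22) (.const x)) (.read 14 (.reg 23) (.const y)))
        (.read 1 (.read 14 (.reg 22) (.const x)) (.read 14 (.reg 23) (.const y)))) r) r))))

variable {W n m p r : ℕ} {s : RamState}

open Classical in
-- Row `i` of word array `21` first becomes the characteristic vector of the old bag, so that a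
-- member is tested by `r` lookups rather than by a scan of the bag. Each node has its own row,
-- which needs no clearing.
theorem exec_buildBags (hW : 1 ≤ W) (hm : m ≤ W) (hn : n ≤ W) (hpW : p ≤ W)
    (hms : s.nat 0 0 1 = m) (hp : s.nat 13 0 0 = p)
    (h17 : ∀ i < m, s.nat 17 i 0 < m) (h4 : ∀ t < m, s.nat 4 t 0 ≤ n)
    (h16 : s.nat 16 = 0) (h21 : s.nat 21 = 0) :
    Exec W (buildBags r) s fun t s' => t ≤ m * (n * 3 + p * 3 + 7) + 2 ∧
      ∀ i j, s'.nat 16 i j = if i < m ∧ j < p ∧ ∃ x < r, ∃ y < s.nat 4 (s.nat 17 i 0) 0,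
        s.nat 5 (s.nat 17 i 0) y = s.nat 14 j x then 1 else 0 := by
  refine (Exec.forLoop (n := m) (n * 3 + p * 3 + 5) (fun i₀ s' =>
    (∀ i v, s'.nat 21 i v = if i < i₀ ∧ ∃ y < s.nat 4 (s.nat 17 i 0) 0,
      s.nat 5 (s.nat 17 i 0) y = v then 1 else 0) ∧
    ∀ i j, s'.nat 16 i j = if i < i₀ ∧ j < p ∧ ∃ x < r, ∃ y < s.nat 4 (s.nat 17 i 0) 0,
        s.nat 5 (s.nat 17 i 0) y = s.nat 14 j x then 1 else 0)
    (by simp) hm ?_ ⟨by simp [h21], by simp [h16]⟩ (fun i s' x h => by simpa using h) ?_).mono ?_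
  · intro s' hf
    simp [hf.nat 0 (by simp), hms]
  · intro i s' hi hf hc ⟨k1, k2⟩
    have e17 : s'.nat 17 = s.nat 17 := hf.nat 17 (by simp)
    have e4 : s'.nat 4 = s.nat 4 := hf.nat 4 (by simp)
    have e5 : s'.nat 5 = s.nat 5 := hf.nat 5 (by simp)
    have e14 : s'.nat 14 = s.nat 14 := hf.nat 14 (by simp)
    have e13 : s'.nat 13 0 0 = p := by rw [hf.nat 13 (by simp), hp]
    have hti := h17 i hi
    set t := s.nat 17 i 0 with ht
    have ht4 := h4 t hti
    refine .seq (.set (by simp [hc, e17, ← ht]; omega) (.seq ?_))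
    refine (Exec.forLoop (n := s.nat 4 t 0) 1 (fun y₀ s₁ => ∀ i' v, s₁.nat 21 i' v =
        if (i' < i ∧ ∃ y < s.nat 4 (s.nat 17 i' 0) 0, s.nat 5 (s.nat 17 i' 0) y = v) ∨
          i' = i ∧ ∃ y < y₀, s.nat 5 t y = v then 1 else 0)
      (by simp) (by omega) ?_ ?_ (fun i s' x h => by simpa using h) ?_).mono ?_
    · intro s₁ hf₁
      simp [hf₁.nat 26 (by simp), hf₁.nat 4 (by simp), hc, e17, e4, ← ht]
    · intro i' v
      simp [k1]
    · intro y s₁ hy hf₁ hc₁ l1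
      have f22 : s₁.nat 22 0 0 = i := by rw [hf₁.nat 22 (by simp)]; simp [hc]
      have f26 : s₁.nat 26 0 0 = t := by rw [hf₁.nat 26 (by simp)]; simp [hc, e17, ← ht]
      have f5 : s₁.nat 5 = s.nat 5 := by rw [hf₁.nat 5 (by simp)]; simp [e5]
      refine .set (by simpa using hW) ⟨le_rfl, fun i' v => ?_⟩
      simp only [NatExpr.eval, NatExpr.eval_reg, f22, f26, f5, hc₁, RamState.setNat_nat_same, l1,
        Nat.lt_succ_iff_lt_or_eq]
      by_cases hi' : i' = i
      · subst hi'
        by_cases hv : v = s.nat 5 t y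
        · rw [if_pos ⟨rfl, hv⟩, if_pos (.inr ⟨rfl, y, .inr rfl, hv.symm⟩)]
        · rw [if_neg fun h => hv h.2]
          congr 1
          rw [eq_iff_iff]
          refine or_congr_right (and_congr_right fun _ => exists_congr fun z => ?_)
          constructor
          · exact fun h => ⟨.inl h.1, h.2⟩
          · rintro ⟨h | rfl, h'⟩
            · exact ⟨h, h'⟩
            · exact absurd h'.symm hv
      · simp [hi']
    intro t₁ s₁ hf₁ ⟨ht₁, l1⟩
    have f22 : s₁.nat 22 0 0 = i := by rw [hf₁.nat 22 (by simp)]; simp [hc]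
    have f13 : s₁.nat 13 0 0 = p := by rw [hf₁.nat 13 (by simp)]; simp [e13]
    have f14 : s₁.nat 14 = s.nat 14 := by rw [hf₁.nat 14 (by simp)]; simp [e14]
    have f16 : s₁.nat 16 = s'.nat 16 := by rw [hf₁.nat 16 (by simp)]; simp
    have hrow : ∀ v, s₁.nat 21 i v = if ∃ y < s.nat 4 t 0, s.nat 5 t y = v then 1 else 0 := by
      intro v
      simp [l1]
    refine (Exec.forLoop (n := p) 1 (fun j₀ s₂ => ∀ i' j, s₂.nat 16 i' j =
        if (i' < i ∧ j < p ∧ ∃ x < r, ∃ y < s.nat 4 (s.nat 17 i' 0) 0,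
          s.nat 5 (s.nat 17 i' 0) y = s.nat 14 j x) ∨
          i' = i ∧ j < j₀ ∧ ∃ x < r, ∃ y < s.nat 4 t 0, s.nat 5 t y = s.nat 14 j x then 1 else 0)
      (by simp) hpW ?_ ?_ (fun i s' x h => by simpa using h) ?_).mono ?_
    · intro s₂ hf₂
      simp [hf₂.nat 13 (by simp), f13]
    · intro i' v
      simp [f16, k2]
    · intro j s₂ hj hf₂ hc₂ q1
      have g22 : s₂.nat 22 0 0 = i := by rw [hf₂.nat 22 (by simp), f22]
      have g21 : s₂.nat 21 = s₁.nat 21 := hf₂.nat 21 (by simp)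
      have g14 : s₂.nat 14 = s.nat 14 := by rw [hf₂.nat 14 (by simp), f14]
      have hval : (NatExpr.lt (.const 0) (.sum (fun x =>
          .read 21 (.reg 22) (.read 14 (.reg 23) (.const x))) r)).eval s₂ =
          if ∃ x < r, ∃ y < s.nat 4 t 0, s.nat 5 t y = s.nat 14 j x then 1 else 0 := by
        simp only [NatExpr.eval, NatExpr.eval_sum, NatExpr.eval_reg, g22, g21, g14, hc₂, hrow]
        congr 1
        rw [eq_iff_iff, Nat.pos_iff_ne_zero, ne_eq, Finset.sum_eq_zero_iff]
        simp
      refine .set ?_ ⟨le_rfl, fun i' j' => ?_⟩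
      · rw [hval]; split_ifs <;> omega
      · rw [hval]
        simp only [NatExpr.eval_reg, g22, hc₂, RamState.setNat_nat_same, q1, Nat.lt_succ_iff_lt_or_eq]
        by_cases hi' : i' = i
        · subst hi'
          by_cases hj' : j' = j
          · subst hj'; simp
          · simp [hj']
        · simp [hi']
    intro t₂ s₂ hf₂ ⟨ht₂, q1⟩
    refine ⟨by omega, fun i' v => ?_, fun i' j => ?_⟩
    · rw [hf₂.nat 21 (by simp), l1]
      congr 1
      rw [eq_iff_iff, Nat.lt_succ_iff_lt_or_eq, or_and_right]
      refine or_congr_right (and_congr_right ?_)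
      rintro rfl
      rfl
    · rw [q1]
      congr 1
      rw [eq_iff_iff, Nat.lt_succ_iff_lt_or_eq, or_and_right]
      refine or_congr_right (and_congr_right ?_)
      rintro rfl
      rfl
  · exact fun t s' _ h => ⟨h.1, h.2.2⟩

open Classical in
-- The entries with an index at least `p` stay zero, as required of the empty entry.
theorem exec_buildConflicts (hW : 1 ≤ W) (hpW : p ≤ W) (hp : s.nat 13 0 0 = p)
    (h15 : s.nat 15 = 0) :
    Exec W (buildConflicts r) s fun t s' => t ≤ p * (p * 3 + 4) + 2 ∧
      ∀ i j, s'.nat 15 i j = if i < p ∧ j < p ∧ ∃ x < r, ∃ y < r,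
        s.nat 14 i x = s.nat 14 j y ∨ s.nat 1 (s.nat 14 i x) (s.nat 14 j y) ≠ 0 then 1 else 0 := by
  refine (Exec.forLoop (n := p) (p * 3 + 2) (fun i₀ s' => ∀ i j, s'.nat 15 i j =
      if i < i₀ ∧ j < p ∧ ∃ x < r, ∃ y < r,
        s.nat 14 i x = s.nat 14 j y ∨ s.nat 1 (s.nat 14 i x) (s.nat 14 j y) ≠ 0 then 1 else 0)
    (by simp) hpW ?_ (by simp [h15]) (fun i s' x h => by simpa using h) ?_).mono fun t s' _ h => h
  · intro s' hf
    simp [hf.nat 13 (by simp), hp]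
  · intro i s' hi hf hc k1
    have e13 : s'.nat 13 0 0 = p := by rw [hf.nat 13 (by simp), hp]
    refine (Exec.forLoop (n := p) 1 (fun j₀ s₁ => ∀ i' j, s₁.nat 15 i' j =
        if (i' < i ∧ j < p ∨ i' = i ∧ j < j₀) ∧ ∃ x < r, ∃ y < r,
        s.nat 14 i' x = s.nat 14 j y ∨ s.nat 1 (s.nat 14 i' x) (s.nat 14 j y) ≠ 0 then 1 else 0)
      (by simp) hpW ?_ ?_ (fun i s' x h => by simpa using h) ?_).mono ?_
    · intro s₁ hf₁
      simp [hf₁.nat 13 (by simp), e13]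
    · intro i' j
      simp [k1, and_assoc]
    · intro j s₁ hj hf₁ hc₁ l1
      have f22 : s₁.nat 22 0 0 = i := by rw [hf₁.nat 22 (by simp), hc]
      have f14 : s₁.nat 14 = s.nat 14 := by rw [hf₁.nat 14 (by simp), hf.nat 14 (by simp)]
      have f1 : s₁.nat 1 = s.nat 1 := by rw [hf₁.nat 1 (by simp), hf.nat 1 (by simp)]
      have hval : (NatExpr.lt (.const 0) (.sum (fun x => .sum (fun y =>
          .add (.eq (.read 14 (.reg 22) (.const x)) (.read 14 (.reg 23) (.const y)))
          (.read 1 (.read 14 (.reg 22) (.const x)) (.read 14 (.reg 23) (.const y)))) r) r)).eval s₁ =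
          if ∃ x < r, ∃ y < r, s.nat 14 i x = s.nat 14 j y ∨
            s.nat 1 (s.nat 14 i x) (s.nat 14 j y) ≠ 0 then 1 else 0 := by
        simp only [NatExpr.eval, NatExpr.eval_sum, NatExpr.eval_reg, f22, f14, f1, hc₁]
        congr 1
        rw [eq_iff_iff, Nat.pos_iff_ne_zero, ne_eq, Finset.sum_eq_zero_iff]
        simp [Finset.sum_eq_zero_iff, imp_iff_not_or]
      refine .set ?_ ⟨le_rfl, fun i' j' => ?_⟩
      · rw [hval]; split_ifs <;> omega
      · rw [hval]
        simp only [NatExpr.eval_reg, f22, hc₁, RamState.setNat_nat_same, l1, Nat.lt_succ_iff_lt_or_eq]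
        by_cases hi' : i' = i
        · subst hi'
          by_cases hj' : j' = j
          · subst hj'; simp
          · simp [hj']
        · simp [hi']
    intro t₁ s₁ hf₁ ⟨ht₁, l1⟩
    refine ⟨ht₁, fun i' j => ?_⟩
    rw [l1]
    congr 1
    rw [eq_iff_iff, Nat.lt_succ_iff_lt_or_eq, ← or_and_right, and_assoc]

end RamProgram

/-! ### Scattered sets of maximum weight: the common core of both algorithms. -/

/-- A set of members of a family of vertex sets, given by lists of vertices, any two of which are
disjoint and not joined by an edge. -/
def IsScattered {n p r : ℕ} (G : SimpleGraph (Fin n)) (v : Fin p → Fin r → Fin n)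
    (I : Finset (Fin p)) : Prop :=
  ∀ a ∈ I, ∀ b ∈ I, a ≠ b → ∀ x y, v a x ≠ v b y ∧ ¬ G.Adj (v a x) (v b y)

namespace RamProgram

/-- List a scattered set of maximum weight. -/
def solve (β k r : ℕ) : RamProgram :=
  .seq searchTree (.seq (buildBags r) (.seq (buildConflicts r) (listOptimum β k)))

@[simp] theorem writesNat_searchTree {b : ℕ} : searchTree.WritesNat b ↔
    b = 18 ∨ b = 19 ∨ b = 20 ∨ b = 22 ∨ b = 26 ∨ b = 23 ∨ b = 24 ∨ b = 17 := by
  simp [searchTree]; tauto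

@[simp] theorem writesWt_searchTree {b : ℕ} : ¬ searchTree.WritesWt b := by
  simp [searchTree]

@[simp] theorem writesNat_buildBags {b r : ℕ} : (buildBags r).WritesNat b ↔
    b = 22 ∨ b = 26 ∨ b = 23 ∨ b = 21 ∨ b = 16 := by
  simp [buildBags]; tauto

@[simp] theorem writesWt_buildBags {b r : ℕ} : ¬ (buildBags r).WritesWt b := by
  simp [buildBags]

@[simp] theorem writesNat_buildConflicts {b r : ℕ} : (buildConflicts r).WritesNat b ↔
    b = 22 ∨ b = 23 ∨ b = 15 := by
  simp [buildConflicts]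

@[simp] theorem writesWt_buildConflicts {b r : ℕ} : ¬ (buildConflicts r).WritesWt b := by
  simp [buildConflicts]

/-- The self-reduction dominates; `k ≥ 1` lets it absorb the quadratic time for the conflicts. Only
the reading of the old bags, `3 * (n * m)`, depends on `n`. -/
theorem solve_time_le {n m p k : ℕ} (hk : 1 ≤ k) (hm : 1 ≤ m) :
    24 * m + (m * (n * 3 + p * 3 + 7) + 2) + (p * (p * 3 + 4) + 2) +
      (p + 1) * (m * ((p + 1) ^ k * 8 + 8) + 12) ≤ 80 * (m * (p + 1) ^ (k + 1)) + 3 * (n * m) := by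
  have h1 : (p + 1) ^ 2 ≤ (p + 1) ^ (k + 1) := Nat.pow_le_pow_right (Nat.succ_pos p) (by omega)
  have h2 : (p + 1) ^ (k + 1) ≤ m * (p + 1) ^ (k + 1) := Nat.le_mul_of_pos_left _ hm
  have h3 : m * (p + 1) ^ 2 ≤ m * (p + 1) ^ (k + 1) := Nat.mul_le_mul_left _ h1
  have h4 : (p + 1) * (m * ((p + 1) ^ k * 8 + 8) + 12) =
    8 * (m * (p + 1) ^ (k + 1)) + 8 * (m * (p + 1)) + 12 * (p + 1) := by ring
  have h5 : p + 1 ≤ (p + 1) ^ 2 := Nat.le_self_pow two_ne_zero _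
  have h6 : m * (p + 1) ≤ m * (p + 1) ^ 2 := Nat.mul_le_mul_left _ h5
  have h7 : m * p ≤ m * (p + 1) := Nat.mul_le_mul_left _ (Nat.le_succ p)
  have h8 : m ≤ m * (p + 1) := Nat.le_mul_of_pos_right _ (Nat.succ_pos p)
  have h9 : m * (n * 3 + p * 3 + 7) = 3 * (n * m) + 3 * (m * p) + 7 * m := by ring
  have h10 : p * (p * 3 + 4) ≤ 4 * (p + 1) ^ 2 := by nlinarith
  omega

variable {W n m p r k β : ℕ} {s : RamState} {G : SimpleGraph (Fin n)}
  {D : TreeDecomposition G (Fin m)} {v : Fin p → Fin r → Fin n} {w : ℕ → ℚ}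

theorem exec_solve (hs : RepresentsDecomposedGraph s G D) (hk : 1 ≤ k) (hr : 1 ≤ r)
    (hD : D.independenceNumber ≤ k) (hnW : n ≤ W) (hK : (p + 1) ^ k ≤ W)
    (hW : (p + 1) * (m + 1) ≤ W) (hp : s.nat 13 0 0 = p)
    (hv : ∀ (j : Fin p) (x : Fin r), s.nat 14 j x = v j x)
    (hconn : ∀ j, G.ConnectedOn (Set.range (v j))) (hw : ∀ j, s.wt β j 0 = w j)
    (hw0 : ∀ j, 0 ≤ w j) (hwp : w p = 0)
    (hnat : ∀ a, 15 ≤ a → a ≤ 30 → a ≠ 22 → a ≠ 23 → a ≠ 24 → a ≠ 26 → a ≠ 27 → s.nat a = 0)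
    (hF : s.wt (β + 2) = 0) (hg : s.wt (β + 3) = 0) :
    Exec W (solve β k r) s fun t s' => t ≤ 80 * (m * (p + 1) ^ (k + 1)) + 3 * (n * m) ∧
      s'.nat 30 0 0 ≤ p ∧ ∃ I : Finset (Fin p),
        ListsSet (s'.nat 30 0 0) (s'.nat 31 0) (I : Set (Fin p)) ∧
        IsScattered G v I ∧
        ∀ I' : Finset (Fin p), IsScattered G v I' → ∑ j ∈ I', w j ≤ ∑ j ∈ I, w j := by
  classical
  obtain ⟨-, h0m, hG, hT, hbag⟩ := hs
  have hm : 0 < m := by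
    obtain ⟨t⟩ := D.isTree.connected.nonempty
    exact t.pos
  have hmW : m + 1 ≤ W := le_trans (Nat.le_mul_of_pos_left _ (Nat.succ_pos p)) hW
  have hpW : p ≤ W :=
    le_trans (le_trans (Nat.le_succ p) (Nat.le_mul_of_pos_right _ (Nat.succ_pos m))) hW
  refine .seq ((exec_searchTree D.isTree hm (by omega) h0m hT (hnat 17 (by omega) (by omega)
    (by omega) (by omega) (by omega) (by omega) (by omega)) (hnat 19 (by omega) (by omega)
    (by omega) (by omega) (by omega) (by omega) (by omega))).mono ?_)
  intro t₁ s₁ hf₁ ⟨ht₁, e, he, hord⟩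
  have hord' : ∀ i (hi : i < m), s₁.nat 17 i 0 = e ⟨i, hi⟩ := fun i hi => hord ⟨i, hi⟩
  have hlen : ∀ t < m, s.nat 4 t 0 ≤ n := fun t ht => by
    obtain ⟨f, hf, -⟩ := hbag ⟨t, ht⟩
    simpa using Fintype.card_le_of_injective f hf
  refine .seq ((exec_buildBags (n := n) (m := m) (p := p) (by omega) (by omega) hnW hpW ?_ ?_ ?_ ?_
    ?_ ?_).mono ?_)
  · rw [hf₁.nat 0 (by simp), h0m]
  · rw [hf₁.nat 13 (by simp), hp]
  · intro i hi; rw [hord' i hi]; exact (e _).2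
  · rw [hf₁.nat 4 (by simp)]; exact hlen
  · rw [hf₁.nat 16 (by simp)]
    exact hnat 16 (by omega) (by omega) (by omega) (by omega) (by omega) (by omega) (by omega)
  · rw [hf₁.nat 21 (by simp)]
    exact hnat 21 (by omega) (by omega) (by omega) (by omega) (by omega) (by omega) (by omega)
  intro t₂ s₂ hf₂ ⟨ht₂, hM⟩
  rw [hf₁.nat 4 (by simp), hf₁.nat 5 (by simp), hf₁.nat 14 (by simp)] at hM
  refine .seq ((exec_buildConflicts (p := p) (by omega) hpW ?_ ?_).mono ?_)
  · rw [hf₂.nat 13 (by simp), hf₁.nat 13 (by simp), hp]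
  · rw [hf₂.nat 15 (by simp), hf₁.nat 15 (by simp)]
    exact hnat 15 (by omega) (by omega) (by omega) (by omega) (by omega) (by omega) (by omega)
  intro t₃ s₃ hf₃ ⟨ht₃, hA⟩
  rw [hf₂.nat 14 (by simp), hf₁.nat 14 (by simp), hf₂.nat 1 (by simp), hf₁.nat 1 (by simp)] at hA
  have hconf : ∀ a b : Fin p, s₃.nat 15 a b ≠ 0 ↔
      ∃ x y, v a x = v b y ∨ G.Adj (v a x) (v b y) := by
    intro a b
    have hadj : ∀ u z : Fin n, s.nat 1 u z ≠ 0 ↔ G.Adj u z := fun u z => by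
      by_cases h : G.Adj u z
      · simp [(hG u z).1 h, h]
      · simp [(hG u z).2 h, h]
    rw [hA]
    simp only [a.2, b.2, true_and, ne_eq, ite_eq_right_iff, one_ne_zero, imp_false, not_not]
    constructor
    · rintro ⟨x, hx, y, hy, h⟩
      have h1 := hv a ⟨x, hx⟩
      have h2 := hv b ⟨y, hy⟩
      simp only at h1 h2
      rw [h1, h2] at h
      exact ⟨⟨x, hx⟩, ⟨y, hy⟩, h.imp Fin.ext (hadj _ _).mp⟩
    · rintro ⟨x, y, h⟩
      refine ⟨x, x.2, y, y.2, ?_⟩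
      rw [hv, hv]
      exact h.imp (congrArg Fin.val) (hadj _ _).mpr
  have hdec : IsRootedDecomposition m p k (fun i => s₁.nat 18 i 0) (s₂.nat 16) (s₃.nat 15) := by
    refine D.isRootedDecomposition hD he (U := fun j => Set.range (v j))
      (fun j => ⟨v j ⟨0, hr⟩, Set.mem_range_self _⟩) hconn (fun i j => ?_) (fun i => ?_) (fun j => ?_)
      (fun j => ?_) (fun j => ?_) fun a b => ?_
    · obtain ⟨f, hf, hfr, hfs⟩ := hbag (e i)
      rw [hM, hord]
      simp only [i.2, j.2, true_and, ne_eq, ite_eq_right_iff, one_ne_zero, imp_false, not_not]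
      constructor
      · rintro ⟨x, hx, y, hy, h⟩
        refine ⟨v j ⟨x, hx⟩, Set.mem_range_self _, ?_⟩
        rw [← hfr]
        refine ⟨⟨y, hy⟩, Fin.ext ?_⟩
        rw [← hfs, ← hv]
        exact h
      · rintro ⟨_, ⟨x, rfl⟩, hx⟩
        rw [← hfr] at hx
        obtain ⟨y, hy⟩ := hx
        exact ⟨x, x.2, y, y.2, by rw [hv, hfs, hy]⟩
    · simp [hM]
    · simp [hM]
    · simp [hA]
    · simp [hA]
    · rw [hconf]
      simp
  refine (exec_listOptimum (w := w) hdec hK hW ?_ ?_ ?_ ?_ ?_ rfl ?_ ?_ hw0 hwp ?_ ?_).mono ?_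
  · rw [hf₃.nat 13 (by simp), hf₂.nat 13 (by simp), hf₁.nat 13 (by simp), hp]
  · rw [hf₃.nat 0 (by simp), hf₂.nat 0 (by simp), hf₁.nat 0 (by simp), h0m]
  · rw [hf₃.nat 25 (by simp), hf₂.nat 25 (by simp), hf₁.nat 25 (by simp),
      hnat 25 (by omega) (by omega) (by omega) (by omega) (by omega) (by omega) (by omega)]
    rfl
  · rw [hf₃.nat 30 (by simp), hf₂.nat 30 (by simp), hf₁.nat 30 (by simp),
      hnat 30 (by omega) (by omega) (by omega) (by omega) (by omega) (by omega) (by omega)]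
    rfl
  · rw [hf₃.nat 16 (by simp)]
  · intro i _; rw [hf₃.nat 18 (by simp), hf₂.nat 18 (by simp)]
  · rw [hf₃.wt β (by simp), hf₂.wt β (by simp), hf₁.wt β (by simp)]; exact hw
  · rw [hf₃.wt _ (by simp), hf₂.wt _ (by simp), hf₁.wt _ (by simp)]; exact hF
  · rw [hf₃.wt _ (by simp), hf₂.wt _ (by simp), hf₁.wt _ (by simp)]; exact hg
  intro t₄ s₄ hf₄ ⟨ht₄, I, hI, hcnt, hfree, hmax⟩
  refine ⟨?_, hcnt, Finset.univ.filter fun j : Fin p => (j : ℕ) ∈ I, ?_, ?_, fun I' hI' => ?_⟩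
  · have := solve_time_le (n := n) (p := p) hk hm
    omega
  · refine ⟨fun x => ⟨s₄.nat 31 0 x, hfree.1 _ (hI.1 x.2)⟩, fun x y hxy => ?_, ?_, fun x => rfl⟩
    · exact Fin.ext (hI.2.1 x.2 y.2 (congrArg Fin.val hxy))
    · ext j
      simp only [Set.mem_range, Finset.coe_filter, Finset.mem_univ, true_and, Set.mem_ofPred_eq]
      constructor
      · rintro ⟨x, rfl⟩
        exact hI.1 x.2
      · intro hj
        obtain ⟨x, hx, hxj⟩ := hI.2.2 hj
        exact ⟨⟨x, hx⟩, Fin.ext hxj⟩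
  · intro a ha b hb hab x y
    simp only [Finset.mem_filter, Finset.mem_univ, true_and] at ha hb
    have h1 := mt (hconf a b).mpr (not_not.mpr (hfree.2 a ha b hb fun h => hab (Fin.ext h)))
    exact ⟨fun h => h1 ⟨x, y, .inl h⟩, fun h => h1 ⟨x, y, .inr h⟩⟩
  · have hsum : ∑ j ∈ I, w j = ∑ j ∈ Finset.univ.filter (fun j : Fin p => (j : ℕ) ∈ I), w j := by
      refine (Finset.sum_bij (fun (j : Fin p) _ => (j : ℕ)) (fun j hj => ?_) (fun i _ j _ h => Fin.ext h)
        (fun j hj => ?_) fun _ _ => rfl).symm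
      · simpa using hj
      · exact ⟨⟨j, hfree.1 j hj⟩, by simpa using hj, rfl⟩
    have hsum' : ∑ j ∈ I'.map Fin.valEmbedding, w j = ∑ j ∈ I', w j := Finset.sum_map _ _ _
    rw [← hsum, ← hsum']
    refine hmax _ ⟨fun a ha => ?_, fun a ha b hb hab => ?_⟩
    · obtain ⟨a, -, rfl⟩ := Finset.mem_map.mp ha
      exact a.2
    · obtain ⟨a, ha', rfl⟩ := Finset.mem_map.mp ha
      obtain ⟨b, hb', rfl⟩ := Finset.mem_map.mp hb
      by_contra hne
      obtain ⟨x, y, h⟩ := (hconf a b).mp hne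
      have := hI' a ha' b hb' (fun h => hab (congrArg _ h)) x y
      exact h.elim this.1 this.2

end RamProgram

/-! ### Max Weight Independent Packing -/

/-- A subgraph is determined by a list of its vertices, for which there are `n ^ r` choices, and by
the adjacency relation on the positions, for which there are `2 ^ (r * r)`. -/
theorem card_le_of_injective_subgraphs {n p r : ℕ} {G : SimpleGraph (Fin n)} {H : Fin p → G.Subgraph}
    (hH : Function.Injective H) {v : Fin p → Fin r → Fin n} (hv : ∀ j, Set.range (v j) = (H j).verts) :
    p ≤ n ^ r * 2 ^ (r * r) := by
  classical
  let q : Fin p → (Fin r → Fin n) × Set (Fin r × Fin r) :=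
    fun j => (v j, {x | (H j).Adj (v j x.1) (v j x.2)})
  have hq : Function.Injective q := by
    intro a b hab
    simp only [q, Prod.mk.injEq] at hab
    obtain ⟨h1, h2⟩ := hab
    have hverts : (H a).verts = (H b).verts := by rw [← hv, ← hv, h1]
    have himp : ∀ x y, (H a).Adj (v a x) (v a y) ↔ (H b).Adj (v b x) (v b y) := fun x y => by
      have := Set.ext_iff.mp h2 (x, y)
      simpa using this
    refine hH (SimpleGraph.Subgraph.ext hverts (funext fun x => funext fun y => ?_))
    rw [eq_iff_iff]
    constructor
    · intro h
      obtain ⟨x, rfl⟩ : x ∈ Set.range (v a) := by rw [hv]; exact h.fst_mem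
      obtain ⟨y, rfl⟩ : y ∈ Set.range (v a) := by rw [hv]; exact h.snd_mem
      have := (himp x y).mp h
      rwa [← h1] at this
    · intro h
      obtain ⟨x, rfl⟩ : x ∈ Set.range (v b) := by rw [hv]; exact h.fst_mem
      obtain ⟨y, rfl⟩ : y ∈ Set.range (v b) := by rw [hv]; exact h.snd_mem
      have := (himp x y).mpr h
      rwa [h1] at this
  simpa using Fintype.card_le_of_injective q hq

theorem forall_ne_and_not_adj_iff {V X Y : Type*} {G : SimpleGraph V} {f : X → V} {g : Y → V} :
    (∀ x y, f x ≠ g y ∧ ¬ G.Adj (f x) (g y)) ↔ Disjoint (Set.range f) (Set.range g) ∧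
      ∀ u ∈ Set.range f, ∀ v ∈ Set.range g, ¬ G.Adj u v := by
  rw [Set.disjoint_left]
  constructor
  · intro h
    refine ⟨?_, ?_⟩
    · rintro _ ⟨x, rfl⟩ ⟨y, hxy⟩
      exact (h x y).1 hxy.symm
    · rintro _ ⟨x, rfl⟩ _ ⟨y, rfl⟩
      exact (h x y).2
  · intro h x y
    exact ⟨fun hxy => h.1 (Set.mem_range_self x) ⟨y, hxy.symm⟩,
      h.2 _ (Set.mem_range_self x) _ (Set.mem_range_self y)⟩

/-- The bounds on words and on the running time for a family of at most `c * n ^ r` members. -/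
theorem packing_bounds {n m p r k c a C : ℕ} (hn : 1 ≤ n) (hm : 1 ≤ m) (hr : 1 ≤ r) (hk : 1 ≤ k)
    (hc : 1 ≤ c) (hp : p + 1 ≤ c * n ^ r) (hC : (90 + a) * c ^ (k + 1) + r * (k + 1) ≤ C) :
    n ≤ C * (n * m) ^ C ∧ n ^ r ≤ C * (n * m) ^ C ∧ a ≤ C * (n * m) ^ C ∧
      (p + 1) ^ k ≤ C * (n * m) ^ C ∧ (p + 1) * (m + 1) ≤ C * (n * m) ^ C ∧
      80 * (m * (p + 1) ^ (k + 1)) + 3 * (n * m) + a * n ^ r ≤ C * (n ^ (r * (k + 1)) * m) := by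
  set X := n ^ (r * (k + 1)) * m with hX
  set B := c ^ (k + 1) with hB
  have hB1 : 1 ≤ B := Nat.one_le_pow _ _ hc
  have hX1 : 1 ≤ X := Nat.mul_pos (Nat.pow_pos hn) hm
  have hrC : r * (k + 1) ≤ C := le_trans (Nat.le_add_left _ _) hC
  have h90 : (90 + a) * B ≤ C := le_trans (Nat.le_add_right _ _) hC
  have hC90 : 90 + a ≤ C := le_trans (Nat.le_mul_of_pos_right _ hB1) h90
  have hXW : X ≤ (n * m) ^ C := by
    rw [mul_pow]
    exact Nat.mul_le_mul (Nat.pow_le_pow_right hn hrC) (Nat.le_self_pow (by omega) m)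
  have hnr : n ^ r ≤ n ^ (r * (k + 1)) :=
    Nat.pow_le_pow_right hn (Nat.le_mul_of_pos_right _ (Nat.succ_pos k))
  have hnX : n * m ≤ X := Nat.mul_le_mul_right _ ((Nat.le_self_pow (by omega) n).trans hnr)
  have hrX : n ^ r ≤ X := hnr.trans (Nat.le_mul_of_pos_right _ hm)
  -- Substituting `p + 1 ≤ c * n ^ r` produces the exponent `r * (k + 1)` and the constant `B = c ^
  -- (k + 1)`.
  have hQ : m * (p + 1) ^ (k + 1) ≤ B * X := by
    calc m * (p + 1) ^ (k + 1) ≤ m * (c * n ^ r) ^ (k + 1) :=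
          Nat.mul_le_mul_left _ (Nat.pow_le_pow_left hp _)
      _ = B * X := by rw [hB, hX, mul_pow, ← pow_mul]; ring
  have hBX : ∀ d, d ≤ 90 + a → d * (B * X) ≤ C * (n * m) ^ C := fun d hd => by
    rw [← mul_assoc]
    exact Nat.mul_le_mul ((Nat.mul_le_mul_right _ hd).trans h90) hXW
  have hXBX : X ≤ B * X := Nat.le_mul_of_pos_left _ hB1
  have hXC : ∀ y, y ≤ B * X → y ≤ C * (n * m) ^ C := fun y hy =>
    hy.trans (by simpa using hBX 1 (by omega))
  have hQk : (p + 1) ^ k ≤ m * (p + 1) ^ (k + 1) :=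
    (Nat.pow_le_pow_right (Nat.succ_pos p) (Nat.le_succ k)).trans (Nat.le_mul_of_pos_left _ hm)
  have hQ1 : (p + 1) * m ≤ m * (p + 1) ^ (k + 1) := by
    rw [mul_comm]
    exact Nat.mul_le_mul_left _ (Nat.le_self_pow (by omega) _)
  refine ⟨hXC _ ((Nat.le_mul_of_pos_right _ hm).trans (hnX.trans hXBX)), hXC _ (hrX.trans hXBX),
    ?_, hXC _ (hQk.trans hQ), ?_, ?_⟩
  · exact le_trans (by omega) (Nat.le_mul_of_pos_right C (Nat.pow_pos (Nat.mul_pos hn hm)))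
  · refine le_trans ?_ (hBX 2 (by omega))
    have : (p + 1) * (m + 1) ≤ 2 * ((p + 1) * m) := by nlinarith
    omega
  · have h1 : a * n ^ r ≤ a * (B * X) := Nat.mul_le_mul_left _ (hrX.trans hXBX)
    have h2 : (90 + a) * B * X ≤ C * X := Nat.mul_le_mul_right _ h90
    have h3 : (90 + a) * B * X = 90 * (B * X) + a * (B * X) := by ring
    omega

namespace RamProgram

/-- Copy the weights and the vertex lists of the family; the lists are padded to length `r`. -/
def loadFamily (r : ℕ) : RamProgram :=
  .seq (.set 13 (.const 0) (.const 0) (.read 0 (.const 0) (.const 2)))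
    (forLoop 22 (.reg 13)
      (.seq (.setW 1 (.reg 22) (.const 0) (.read 0 (.reg 22) (.const 0)))
        (forLoop 23 (.const r) (.set 14 (.reg 22) (.reg 23)
          (.read 7 (.reg 22) (.mod (.reg 23) (.read 6 (.reg 22) (.const 0))))))))

/-- Write the output. -/
def writeIndexSet : RamProgram :=
  .seq (forLoop 22 (.reg 30) (.set 12 (.const 0) (.reg 22) (.read 31 (.const 0) (.reg 22))))
    (.set 11 (.const 0) (.const 0) (.reg 30))

/-- The program for Max Weight Independent Packing. -/
def packing (k r : ℕ) : RamProgram := .seq (loadFamily r) (.seq (solve 1 k r) writeIndexSet)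

@[simp] theorem writesNat_loadFamily {r b : ℕ} : (loadFamily r).WritesNat b ↔
    b = 13 ∨ b = 22 ∨ b = 23 ∨ b = 14 := by
  simp [loadFamily]

@[simp] theorem writesWt_loadFamily {r b : ℕ} : (loadFamily r).WritesWt b ↔ b = 1 := by
  simp [loadFamily]

variable {W n p r : ℕ} {s : RamState}

/-- Lists are padded cyclically, which leaves the set of vertices unchanged. The weights are copied
because the input array is arbitrary from row `p` on, whereas the empty entry `p` must have weight
zero. -/
theorem exec_loadFamily (hpW : p ≤ W) (hrW : r ≤ W) (hnW : n ≤ W) (hp : s.nat 0 0 2 = p)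
    {v : Fin p → Fin r → Fin n}
    (hv : ∀ (j : Fin p) (x : Fin r), s.nat 7 j (x % s.nat 6 j 0) = v j x) (hw : s.wt 1 = 0) :
    Exec W (loadFamily r) s fun t s' => t ≤ p * (r * 3 + 5) + 3 ∧ s'.nat 13 0 0 = p ∧
      (∀ (j : Fin p) (x : Fin r), s'.nat 14 j x = v j x) ∧
      ∀ j, s'.wt 1 j 0 = if j < p then s.wt 0 j 0 else 0 := by
  refine .seq (.set (by simpa [hp] using hpW) ?_)
  refine (Exec.forLoop (n := p) (r * 3 + 3) (fun i s' =>
    (∀ (j : Fin p) (x : Fin r), j < i → s'.nat 14 j x = v j x) ∧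
    ∀ j, s'.wt 1 j 0 = if j < i then s.wt 0 j 0 else 0)
    (by simp) hpW ?_ ⟨by simp, by simp [hw]⟩ (fun i s' x h => by simpa using h) ?_).mono ?_
  · intro s' hf
    simp [hf.nat 13 (by simp), hp]
  · intro i s' hi hf hc ⟨k1, k2⟩
    have e7 : s'.nat 7 = s.nat 7 := by rw [hf.nat 7 (by simp)]; simp
    have e6 : s'.nat 6 = s.nat 6 := by rw [hf.nat 6 (by simp)]; simp
    have e0 : s'.wt 0 = s.wt 0 := by rw [hf.wt 0 (by simp)]; simp
    refine .seq (.setW ?_)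
    refine (Exec.forLoop (n := r) 1 (fun x₀ s₁ =>
      ∀ (j : Fin p) (x : Fin r), j < i ∨ (j : ℕ) = i ∧ x < x₀ → s₁.nat 14 j x = v j x)
      (by simp) hrW (by simp) ?_ (fun i s' x h => by simpa using h) ?_).mono ?_
    · intro j x hj
      simpa using k1 j x (by simpa using hj)
    · intro x s₁ hx hf₁ hc₁ l1
      have f22 : s₁.nat 22 0 0 = i := by rw [hf₁.nat 22 (by simp)]; simp [hc]
      have f7 : s₁.nat 7 = s.nat 7 := by rw [hf₁.nat 7 (by simp)]; simp [e7]
      have f6 : s₁.nat 6 = s.nat 6 := by rw [hf₁.nat 6 (by simp)]; simp [e6]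
      have hvx := hv ⟨i, hi⟩ ⟨x, hx⟩
      simp only at hvx
      refine .set (by simp [f22, f7, f6, hc₁, hvx]; omega) ⟨le_rfl, fun j y hj => ?_⟩
      simp only [NatExpr.eval, NatExpr.eval_reg, f22, f7, f6, hc₁, hvx, RamState.setNat_nat_same]
      split_ifs with h
      · have h1 : j = ⟨i, hi⟩ := Fin.ext h.1
        have h2 : y = ⟨x, hx⟩ := Fin.ext h.2
        rw [h1, h2]
      · exact l1 j y (by omega)
    intro t₁ s₁ hf₁ ⟨ht₁, l1⟩
    refine ⟨by omega, fun j x hj => l1 j x ?_, fun j => ?_⟩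
    · have := x.2
      omega
    · rw [hf₁.wt 1 (by simp)]
      simp only [NatExpr.eval, WtExpr.eval, NatExpr.eval_reg, hc, e0, RamState.setWt_wt_same, k2]
      rcases lt_trichotomy j i with h | rfl | h
      · simp [h, h.ne, h.trans (Nat.lt_succ_self i)]
      · simp
      · simp [h.ne', not_lt.mpr h.le, show ¬ j < i + 1 by omega]
  · intro t s' hf ⟨ht, k1, k2⟩
    have ht : t ≤ p * (r * 3 + 5) + 2 := ht
    refine ⟨by omega, ?_, fun j x => k1 j x j.2, k2⟩
    simp [hf.nat 13 (by simp), hp]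

theorem exec_writeIndexSet {c : ℕ} (hpW : p ≤ W) (hc : s.nat 30 0 0 = c) (hcp : c ≤ p)
    (hlist : ∀ x < c, s.nat 31 0 x ≤ p) :
    Exec W writeIndexSet s fun t s' => t ≤ p * 3 + 3 ∧ s'.nat 11 0 0 = c ∧
      ∀ x < c, s'.nat 12 0 x = s.nat 31 0 x := by
  refine .seq ((Exec.forLoop (n := c) 1 (fun i s' => ∀ x < i, s'.nat 12 0 x = s.nat 31 0 x)
    (by simp) (by omega) ?_ (by simp) (fun i s' x h => by simpa using h) ?_).mono ?_)
  · intro s' hf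
    simp [hf.nat 30 (by simp), hc]
  · intro i s' hi hf hci k1
    have e31 : s'.nat 31 = s.nat 31 := hf.nat 31 (by simp)
    refine .set (by simp [e31, hci]; have := hlist i hi; omega) ⟨le_rfl, fun x hx => ?_⟩
    simp only [NatExpr.eval, NatExpr.eval_reg, e31, hci, RamState.setNat_nat_same, true_and]
    split_ifs with h
    · rw [h]
    · exact k1 x (by omega)
  · intro t s' hf ⟨ht, k1⟩
    have e30 : s'.nat 30 0 0 = c := by rw [hf.nat 30 (by simp), hc]
    exact .set (by simp [e30]; omega) ⟨by omega, by simp [e30], fun x hx => by simpa using k1 x hx⟩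

end RamProgram

theorem exists_program_packing (k r : ℕ) (hk : 1 ≤ k) (hr : 1 ≤ r) :
    ∃ (P : RamProgram) (C : ℕ), ∀ (n m p : ℕ) (G : SimpleGraph (Fin n))
      (D : TreeDecomposition G (Fin m)) (H : Fin p → G.Subgraph) (w : Fin p → ℚ≥0),
      0 < n → D.independenceNumber ≤ k →
      Function.Injective H → (∀ j, (H j).Connected) → (∀ j, (H j).verts.ncard ≤ r) →
      ∀ s : RamState, RepresentsPackingInput s G D H w →
        ∃ (t : ℕ) (s' : RamState), Runs (C * (n * m) ^ C) P s t s' ∧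
          t ≤ C * (n ^ (r * (k + 1)) * m) ∧
          ∃ I : Finset (Fin p), OutputsIndexSet s' I ∧ IsMaxWeightIndependentPacking H w I := by
  -- The extra factor 2 turns the bound on `p` into one on `p + 1`. The constant `a` pays for
  -- reading the family and writing the output.
  set c := 2 ^ (r * r + 1) with hcdef
  set a := (r * 3 + 14) * c with ha
  set C := (90 + a) * c ^ (k + 1) + r * (k + 1) with hCdef
  refine ⟨RamProgram.packing k r, C, fun n m p G D H w hn hD hH hconn hcard s hs => ?_⟩
  obtain ⟨hs1, hs2, hs3, -, hs5, hs6, hs7⟩ := hs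
  have hm : 1 ≤ m := by
    obtain ⟨t⟩ := D.isTree.connected.nonempty
    exact t.pos
  have hlist : ∀ j : Fin p, ∃ v : Fin r → Fin n, Set.range v = (H j).verts ∧
      ∀ x : Fin r, s.nat 7 j (x % s.nat 6 j 0) = v x := by
    intro j
    obtain ⟨e, he, her, hes⟩ := hs3 j
    obtain ⟨⟨u, hu⟩⟩ := (hconn j).coe.nonempty
    have hpos : 0 < s.nat 6 j 0 := by
      rw [← her] at hu
      obtain ⟨x, -⟩ := hu
      exact x.pos
    have hle : s.nat 6 j 0 ≤ r := by
      have := hcard j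
      rw [← her, ← Nat.card_coe_set_eq, Nat.card_range_of_injective he] at this
      simpa using this
    refine ⟨fun x => e ⟨x % s.nat 6 j 0, Nat.mod_lt _ hpos⟩, ?_, fun x => hes ⟨_, Nat.mod_lt _ hpos⟩⟩
    rw [← her]
    ext z
    constructor
    · rintro ⟨x, rfl⟩
      exact ⟨_, rfl⟩
    · rintro ⟨x, rfl⟩
      exact ⟨⟨x, x.2.trans_le hle⟩, congrArg e (Fin.ext (Nat.mod_eq_of_lt x.2))⟩
  choose v hvr hvs using hlist
  have hc1 : 1 ≤ c := Nat.one_le_two_pow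
  have hp : p + 1 ≤ c * n ^ r := by
    have h1 := card_le_of_injective_subgraphs hH hvr
    have h2 : c * n ^ r = n ^ r * 2 ^ (r * r) + n ^ r * 2 ^ (r * r) := by rw [hcdef, pow_succ]; ring
    have h3 : 0 < n ^ r * 2 ^ (r * r) := Nat.mul_pos (Nat.pow_pos hn) (Nat.two_pow_pos _)
    omega
  obtain ⟨b1, b2, b3, b4, b5, b6⟩ := packing_bounds (a := a) (C := C) hn hm hr hk hc1 hp
    hCdef.ge
  have hpW : p ≤ C * (n * m) ^ C := by
    refine le_trans ?_ b5
    nlinarith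
  have hrW : r ≤ C * (n * m) ^ C := by
    refine le_trans ?_ b3
    rw [ha]
    nlinarith
  refine RamProgram.Exec.seq ((RamProgram.exec_loadFamily hpW hrW b1 hs2 hvs
    (hs7 1 le_rfl)).mono fun t₁ s₁ hf₁ h₁ => ?_)
  obtain ⟨ht₁, h13, h14, hw₁⟩ := h₁
  have hs1' : RepresentsDecomposedGraph s₁ G D := by
    unfold RepresentsDecomposedGraph at hs1 ⊢
    rwa [hf₁.nat 0 (by simp), hf₁.nat 1 (by simp), hf₁.nat 2 (by simp), hf₁.nat 3 (by simp),
      hf₁.nat 4 (by simp), hf₁.nat 5 (by simp)]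
  have hconn' : ∀ j, G.ConnectedOn (Set.range (v j)) := fun j => by
    rw [hvr]
    have := SimpleGraph.connectedOn_of_preconnected (G := G) (hconn j).coe.preconnected
      Subtype.val fun x y hxy => (H j).adj_sub hxy
    rwa [Subtype.range_coe] at this
  set w' : ℕ → ℚ := fun j => if j < p then s.wt 0 j 0 else 0 with hw'
  have hww : ∀ j : Fin p, w' j = w j := fun j => by simp [hw', hs5]
  refine .seq ((RamProgram.exec_solve (w := w') hs1' hk hr hD b1 b4 b5 h13 h14 hconn' hw₁ (fun j => ?_)
    ?_ ?_ ?_ ?_).mono fun t₂ s₂ hf₂ h₂ => ?_)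
  · by_cases hj : j < p
    · rw [hww ⟨j, hj⟩]; exact (w _).2
    · simp [hw', hj]
  · simp [hw']
  · intro x h15 _ h22 h23 _ _ _
    rw [hf₁.nat x (by simp; omega)]
    exact hs6 x (by omega)
  · rw [hf₁.wt _ (by simp)]; exact hs7 _ (by omega)
  · rw [hf₁.wt _ (by simp)]; exact hs7 _ (by omega)
  obtain ⟨ht₂, hcnt, I, ⟨e, he, her, hes⟩, hI, hmax⟩ := h₂
  refine (RamProgram.exec_writeIndexSet hpW rfl hcnt fun x hx => ?_).mono fun t₃ s₃ _ h₃ => ?_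
  · rw [hes ⟨x, hx⟩]; exact (e _).2.le
  obtain ⟨ht₃, h11, h12⟩ := h₃
  have hiff : ∀ I' : Finset (Fin p), IsScattered G v I' ↔ IsIndependentPacking H I' := by
    intro I'
    refine forall₂_congr fun i _ => forall₂_congr fun j _ => forall_congr' fun _ => ?_
    rw [← hvr, ← hvr, forall_ne_and_not_adj_iff]
  refine ⟨?_, I, ?_, (hiff I).mp hI, fun I' hI' => ?_⟩
  · have h1 : p * (r * 3 + 5) + 3 + (p * 3 + 3) ≤ (r * 3 + 14) * (p + 1) := by nlinarith
    have h2 : (r * 3 + 14) * (p + 1) ≤ a * n ^ r := by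
      rw [ha, mul_assoc]
      exact Nat.mul_le_mul_left _ hp
    omega
  · unfold OutputsIndexSet
    rw [h11]
    exact ⟨e, he, her, fun x => by rw [h12 x x.2, hes]⟩
  · have := hmax I' ((hiff I').mpr hI')
    simp only [hww] at this
    exact_mod_cast this

/-! ### Max Weight Independent `F`-Packing -/

theorem mapCode_lt {a n : ℕ} (f : Fin a → Fin n) : mapCode f < n ^ a := by
  rw [mapCode, ← finFunctionFinEquiv_apply_val]
  exact (finFunctionFinEquiv f).2

theorem mapCode_injective (a n : ℕ) : Function.Injective (mapCode : (Fin a → Fin n) → ℕ) := by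
  intro f g h
  rw [mapCode, mapCode, ← finFunctionFinEquiv_apply_val, ← finFunctionFinEquiv_apply_val] at h
  exact finFunctionFinEquiv.injective (Fin.ext h)

theorem digit_mapCode {a n : ℕ} (f : Fin a → Fin n) (x : Fin a) :
    mapCode f / n ^ (x : ℕ) % n = f x := by
  rw [mapCode, ← finFunctionFinEquiv_apply_val, ← finFunctionFinEquiv_symm_apply_val,
    Equiv.symm_apply_apply]

namespace NatExpr

/-- The number of vertices of the graph. -/
def vertexCount : NatExpr := .read 0 (.const 0) (.const 0)

@[simp] theorem eval_vertexCount (s : RamState) : vertexCount.eval s = s.nat 0 0 0 := rfl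

open Classical in
/-- The test whether `c` is the code of an injective homomorphism from `F` to the input graph. -/
noncomputable def isCopyCode {a : ℕ} (F : SimpleGraph (Fin a)) (c : NatExpr) : NatExpr :=
  .eq (.const 0) (sum (fun x => sum (fun y =>
    if x = y then .const 0
    else .add (.eq (digit vertexCount c x) (digit vertexCount c y))
      (if ∃ u v : Fin a, (u : ℕ) = x ∧ (v : ℕ) = y ∧ F.Adj u v then
        .eq (.read 1 (digit vertexCount c x) (digit vertexCount c y)) (.const 0) else .const 0)) a) a)

/-- Every number below `n ^ a` is the code of the map given by its digits, so it remains to test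
injectivity and the preservation of edges on pairs of different positions. -/
theorem eval_isCopyCode_ne_zero {s : RamState} {n a : ℕ} {G : SimpleGraph (Fin n)}
    (F : SimpleGraph (Fin a)) {c : NatExpr} (hn : s.nat 0 0 0 = n)
    (hG : ∀ u v : Fin n, (G.Adj u v → s.nat 1 u v = 1) ∧ (¬ G.Adj u v → s.nat 1 u v = 0))
    (hc : c.eval s < n ^ a) :
    (isCopyCode F c).eval s ≠ 0 ↔ ∃ f : SimpleGraph.Copy F G, mapCode f = c.eval s := by
  classical
  have h1 : (isCopyCode F c).eval s ≠ 0 ↔ ∀ x < a, ∀ y < a, x ≠ y →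
      c.eval s / n ^ x % n ≠ c.eval s / n ^ y % n ∧
      ((∃ u v : Fin a, (u : ℕ) = x ∧ (v : ℕ) = y ∧ F.Adj u v) →
        s.nat 1 (c.eval s / n ^ x % n) (c.eval s / n ^ y % n) ≠ 0) := by
    simp only [isCopyCode, eval, eval_sum, ne_eq, ite_eq_right_iff, one_ne_zero, imp_false, not_not]
    rw [eq_comm, Finset.sum_eq_zero_iff]
    refine forall_congr' fun x => ?_
    rw [Finset.mem_range]
    refine imp_congr_right fun hx => ?_
    rw [Finset.sum_eq_zero_iff]
    refine forall_congr' fun y => ?_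
    rw [Finset.mem_range]
    refine imp_congr_right fun hy => ?_
    by_cases hxy : x = y
    · simp [hxy]
    · by_cases hF : ∃ u v : Fin a, (u : ℕ) = x ∧ (v : ℕ) = y ∧ F.Adj u v
      · rw [if_neg hxy, if_pos hF, eq_true hF]
        simp [hxy, hn]
      · rw [if_neg hxy, if_neg hF, eq_false hF]
        simp [hxy, hn]
  rw [h1]
  constructor
  · intro h
    have hn0 : ∀ x : Fin a, 0 < n := fun x => by
      rcases Nat.eq_zero_or_pos n with h0 | h0
      · rw [h0, zero_pow x.pos.ne'] at hc; omega
      · exact h0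
    let f : Fin a → Fin n := fun x => ⟨c.eval s / n ^ (x : ℕ) % n, Nat.mod_lt _ (hn0 x)⟩
    refine ⟨⟨⟨f, fun {u v} huv => ?_⟩, fun u v huv => ?_⟩, ?_⟩
    · by_contra hadj
      exact (h u u.2 v v.2 fun he => huv.ne (Fin.ext he)).2 ⟨u, v, rfl, rfl, huv⟩
        ((hG (f u) (f v)).2 hadj)
    · by_contra hne
      exact (h u u.2 v v.2 fun he => hne (Fin.ext he)).1 (congrArg Fin.val huv)
    · change mapCode f = _
      rw [mapCode, Fin.sum_univ_eq_sum_range (fun x => c.eval s / n ^ x % n * n ^ x)]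
      exact eq_sum_digits hc
  · rintro ⟨f, hf⟩ x hx y hy hxy
    have hdx := digit_mapCode f ⟨x, hx⟩
    have hdy := digit_mapCode f ⟨y, hy⟩
    simp only [hf] at hdx hdy
    rw [hdx, hdy]
    refine ⟨fun he => hxy ?_, ?_⟩
    · exact congrArg Fin.val (f.injective (Fin.ext he))
    · rintro ⟨u, v, rfl, rfl, huv⟩
      have hadj : G.Adj (f u) (f v) := f.toHom.map_adj huv
      simp [(hG _ _).1 hadj]

end NatExpr

/-! ### Listing the copies of the graphs in `F`. -/

namespace RamProgram

/-- Run the programs `P 0, …, P (n - 1)`. -/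
def seqRange (P : ℕ → RamProgram) : ℕ → RamProgram
  | 0 => skip
  | n + 1 => seq (seqRange P n) (P n)

@[simp] theorem writesNat_seqRange {P : ℕ → RamProgram} {n b : ℕ} :
    (seqRange P n).WritesNat b ↔ ∃ i < n, (P i).WritesNat b := by
  induction n with
  | zero => simp [seqRange]
  | succ n ih => simp only [seqRange, WritesNat, ih, Nat.lt_succ_iff_lt_or_eq, or_and_right,
      exists_or, exists_eq_left]

@[simp] theorem writesWt_seqRange {P : ℕ → RamProgram} {n b : ℕ} :
    (seqRange P n).WritesWt b ↔ ∃ i < n, (P i).WritesWt b := by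
  induction n with
  | zero => simp [seqRange]
  | succ n ih => simp only [seqRange, WritesWt, ih, Nat.lt_succ_iff_lt_or_eq, or_and_right,
      exists_or, exists_eq_left]

theorem Exec.seqRange {W n : ℕ} {P : ℕ → RamProgram} {s : RamState} (T : ℕ)
    (Inv : ℕ → RamState → Prop) (h0 : Inv 0 s)
    (hstep : ∀ i s', i < n → (seqRange P n).Frame s s' → Inv i s' →
      Exec W (P i) s' fun t s'' => t ≤ T ∧ Inv (i + 1) s'') :
    Exec W (seqRange P n) s fun t s' => t ≤ n * T + 1 ∧ Inv n s' := by
  induction n with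
  | zero => exact .skip ⟨by omega, h0⟩
  | succ n ih =>
    have hmono : ∀ s', (RamProgram.seqRange P n).Frame s s' →
        (RamProgram.seqRange P (n + 1)).Frame s s' :=
      fun s' hf => hf.mono (fun b hb => .inl hb) fun b hb => .inl hb
    refine .seq ((ih fun i s' hi hf h => hstep i s' (by omega) (hmono s' hf) h).mono
      fun t s' hf h => ?_)
    refine (hstep n s' (Nat.lt_succ_self n) (hmono s' hf) h.2).mono fun t' s'' _ h' => ⟨?_, h'.2⟩
    have := h.1
    have := h'.1
    rw [add_mul]; omega

/-- Append the copy of the `i`-th member of the family with the code in word array `22` to the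
list of all copies; it has `a` vertices, and the list of its vertices is padded to length `r`. -/
def appendCopy (q r i a : ℕ) : RamProgram :=
  .seq (seqRange (fun x => .set 14 (.reg 13) (.const x)
      (.digit .vertexCount (.reg 22) (x % a))) r)
    (.seq (.setW q (.reg 13) (.const 0) (.read i (.reg 22) (.const 0)))
      (.seq (.set 32 (.reg 13) (.const 0) (.const i))
        (.seq (.set 33 (.reg 13) (.const 0) (.reg 22))
          (.set 13 (.const 0) (.const 0) (.add (.reg 13) (.const 1))))))

/-- List the copies of the `i`-th member of the family. -/
noncomputable def listCopies (q r i : ℕ) {a : ℕ} (F : SimpleGraph (Fin a)) : RamProgram :=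
  forLoop 22 (.pow .vertexCount a)
    (.cond (.isCopyCode F (.reg 22)) (appendCopy q r i a) .skip)

/-- List the copies of all members of the family. -/
noncomputable def listAllCopies (r : ℕ) {q : ℕ} {size : Fin q → ℕ}
    (F : ∀ i, SimpleGraph (Fin (size i))) : RamProgram :=
  seqRange (fun i => if h : i < q then listCopies q r i (F ⟨i, h⟩) else .skip) q

/-- Write the output. -/
def writeSubgraphs : RamProgram :=
  .seq (forLoop 22 (.reg 30)
      (.seq (.set 12 (.reg 22) (.const 0) (.read 32 (.read 31 (.const 0) (.reg 22)) (.const 0)))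
        (.set 12 (.reg 22) (.const 1) (.read 33 (.read 31 (.const 0) (.reg 22)) (.const 0)))))
    (.set 11 (.const 0) (.const 0) (.reg 30))

theorem writesNat_appendCopy {q r i a b : ℕ} (h : (appendCopy q r i a).WritesNat b) :
    b = 14 ∨ b = 32 ∨ b = 33 ∨ b = 13 := by
  simp only [appendCopy, WritesNat, writesNat_seqRange] at h
  rcases h with ⟨_, _, h⟩ | h | h | h | h <;> simp_all

theorem writesWt_appendCopy {q r i a b : ℕ} (h : (appendCopy q r i a).WritesWt b) : b = q := by
  simpa [appendCopy] using h

theorem writesNat_listCopies {q r i a b : ℕ} {F : SimpleGraph (Fin a)}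
    (h : (listCopies q r i F).WritesNat b) : b = 22 ∨ b = 14 ∨ b = 32 ∨ b = 33 ∨ b = 13 := by
  simp only [listCopies, writesNat_forLoop, WritesNat, or_false] at h
  exact h.imp_right writesNat_appendCopy

theorem writesWt_listCopies {q r i a b : ℕ} {F : SimpleGraph (Fin a)}
    (h : (listCopies q r i F).WritesWt b) : b = q := by
  simp only [listCopies, writesWt_forLoop, WritesWt, or_false] at h
  exact writesWt_appendCopy h

theorem writesNat_listAllCopies {r q b : ℕ} {size : Fin q → ℕ}
    {F : ∀ i, SimpleGraph (Fin (size i))} (h : (listAllCopies r F).WritesNat b) :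
    b = 22 ∨ b = 14 ∨ b = 32 ∨ b = 33 ∨ b = 13 := by
  simp only [listAllCopies, writesNat_seqRange] at h
  obtain ⟨i, hi, h⟩ := h
  rw [dif_pos hi] at h
  exact writesNat_listCopies h

theorem writesWt_listAllCopies {r q b : ℕ} {size : Fin q → ℕ}
    {F : ∀ i, SimpleGraph (Fin (size i))} (h : (listAllCopies r F).WritesWt b) : b = q := by
  simp only [listAllCopies, writesWt_seqRange] at h
  obtain ⟨i, hi, h⟩ := h
  rw [dif_pos hi] at h
  exact writesWt_listCopies h

end RamProgram

/-- Row `j` of the list of copies holds the copy with code `c` of the `i`-th member of the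
family. -/
structure IsCopyEntry (n q r a : ℕ) (s : RamState) (j i c : ℕ) : Prop where
  index : s.nat 32 j 0 = i
  code : s.nat 33 j 0 = c
  vertex : ∀ x < r, s.nat 14 j x = c / n ^ (x % a) % n
  weight : s.wt q j 0 = s.wt i c 0

theorem IsCopyEntry.congr {n q r a j i c : ℕ} {s s' : RamState} (h : IsCopyEntry n q r a s j i c)
    (h14 : ∀ x, s'.nat 14 j x = s.nat 14 j x) (h32 : s'.nat 32 j 0 = s.nat 32 j 0)
    (h33 : s'.nat 33 j 0 = s.nat 33 j 0) (hq : s'.wt q j 0 = s.wt q j 0) (hi : s'.wt i = s.wt i) :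
    IsCopyEntry n q r a s' j i c :=
  ⟨h32.trans h.index, h33.trans h.code, fun x hx => (h14 x).trans (h.vertex x hx), by
    rw [hq, hi, h.weight]⟩

/-- The list of copies consists of the copies whose indices and codes satisfy `Q`. -/
structure IsCopyList {n q : ℕ} (G : SimpleGraph (Fin n)) {size : Fin q → ℕ}
    (F : ∀ i, SimpleGraph (Fin (size i))) (r : ℕ) (Q : Fin q → ℕ → Prop) (s : RamState) : Prop where
  sound : ∀ j < s.nat 13 0 0, ∃ (i : Fin q) (f : SimpleGraph.Copy (F i) G), Q i (mapCode f) ∧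
    IsCopyEntry n q r (size i) s j i (mapCode f)
  complete : ∀ (i : Fin q) (f : SimpleGraph.Copy (F i) G), Q i (mapCode f) →
    ∃ j < s.nat 13 0 0, IsCopyEntry n q r (size i) s j i (mapCode f)
  weight : ∀ j, s.nat 13 0 0 ≤ j → s.wt q j 0 = 0

namespace IsCopyList

variable {n q r : ℕ} {G : SimpleGraph (Fin n)} {size : Fin q → ℕ}
  {F : ∀ i, SimpleGraph (Fin (size i))} {Q Q' : Fin q → ℕ → Prop} {s s' : RamState}

theorem congr (h : IsCopyList G F r Q s)
    (hQ : ∀ (i : Fin q) (f : SimpleGraph.Copy (F i) G), Q' i (mapCode f) ↔ Q i (mapCode f)) :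
    IsCopyList G F r Q' s := by
  refine ⟨fun j hj => ?_, fun i f hf => h.complete i f ((hQ i f).mp hf), h.weight⟩
  obtain ⟨i, f, h1, h2⟩ := h.sound j hj
  exact ⟨i, f, (hQ i f).mpr h1, h2⟩

theorem append (h : IsCopyList G F r Q s) {i₀ : Fin q} {f₀ : SimpleGraph.Copy (F i₀) G}
    (h13 : s'.nat 13 0 0 = s.nat 13 0 0 + 1)
    (hnew : IsCopyEntry n q r (size i₀) s' (s.nat 13 0 0) i₀ (mapCode f₀))
    (h14 : ∀ j ≠ s.nat 13 0 0, ∀ x, s'.nat 14 j x = s.nat 14 j x)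
    (h32 : ∀ j ≠ s.nat 13 0 0, s'.nat 32 j 0 = s.nat 32 j 0)
    (h33 : ∀ j ≠ s.nat 13 0 0, s'.nat 33 j 0 = s.nat 33 j 0)
    (hq : ∀ j ≠ s.nat 13 0 0, s'.wt q j 0 = s.wt q j 0) (hw : ∀ i < q, s'.wt i = s.wt i)
    (hQ : ∀ (i : Fin q) (f : SimpleGraph.Copy (F i) G),
      Q' i (mapCode f) ↔ Q i (mapCode f) ∨ i = i₀ ∧ mapCode f = mapCode f₀) :
    IsCopyList G F r Q' s' := by
  have hold : ∀ j < s.nat 13 0 0, ∀ (i : Fin q) c, IsCopyEntry n q r (size i) s j i c →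
      IsCopyEntry n q r (size i) s' j i c := fun j hj i c he =>
    he.congr (h14 j hj.ne) (h32 j hj.ne) (h33 j hj.ne) (hq j hj.ne) (hw i i.2)
  refine ⟨fun j hj => ?_, fun i f hf => ?_, fun j hj => ?_⟩
  · rw [h13] at hj
    rcases Nat.lt_succ_iff_lt_or_eq.mp hj with hj | rfl
    · obtain ⟨i, f, h1, h2⟩ := h.sound j hj
      exact ⟨i, f, (hQ i f).mpr (.inl h1), hold j hj i _ h2⟩
    · exact ⟨i₀, f₀, (hQ i₀ f₀).mpr (.inr ⟨rfl, rfl⟩), hnew⟩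
  · rw [h13]
    rcases (hQ i f).mp hf with hf | ⟨rfl, hf⟩
    · obtain ⟨j, hj, he⟩ := h.complete i f hf
      exact ⟨j, by omega, hold j hj i _ he⟩
    · exact ⟨_, Nat.lt_succ_self _, hf ▸ hnew⟩
  · rw [h13] at hj
    rw [hq j (by omega), h.weight j (by omega)]

end IsCopyList

namespace RamProgram

variable {W n q r : ℕ} {G : SimpleGraph (Fin n)} {size : Fin q → ℕ}
  {F : ∀ i, SimpleGraph (Fin (size i))} {s : RamState}

theorem exec_appendCopy {Q Q' : Fin q → ℕ → Prop} {i : Fin q} {f : SimpleGraph.Copy (F i) G}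
    (hn : s.nat 0 0 0 = n) (hn0 : 0 < n) (hnW : n ≤ W) (hqW : q ≤ W) (hp : s.nat 13 0 0 + 1 ≤ W)
    (hfW : mapCode f ≤ W) (h22 : s.nat 22 0 0 = mapCode f) (h : IsCopyList G F r Q s)
    (hQ : ∀ (j : Fin q) (g : SimpleGraph.Copy (F j) G),
      Q' j (mapCode g) ↔ Q j (mapCode g) ∨ j = i ∧ mapCode g = mapCode f) :
    Exec W (appendCopy q r i (size i)) s fun t s' => t ≤ r + 5 ∧
      s'.nat 13 0 0 = s.nat 13 0 0 + 1 ∧ IsCopyList G F r Q' s' := by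
  have hiq := i.2
  refine .seq ((Exec.seqRange 1 (fun x₀ s' => ∀ j x, s'.nat 14 j x =
      if j = s.nat 13 0 0 ∧ x < x₀ then mapCode f / n ^ (x % size i) % n else s.nat 14 j x)
    (by simp) fun x s' hx hf hs' => ?_).mono fun t₁ s₁ hf₁ ⟨ht₁, h₁⟩ => ?_)
  · have e13 : s'.nat 13 = s.nat 13 := hf.nat 13 (by simp)
    have e22 : s'.nat 22 = s.nat 22 := hf.nat 22 (by simp)
    have e0 : s'.nat 0 = s.nat 0 := hf.nat 0 (by simp)
    have hval : (NatExpr.digit .vertexCount (.reg 22) (x % size i)).eval s' =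
        mapCode f / n ^ (x % size i) % n := by
      simp [e22, e0, hn, h22]
    refine .set ?_ ⟨le_rfl, fun j y => ?_⟩
    · rw [hval]
      exact (Nat.mod_lt _ hn0).le.trans hnW
    · rw [hval]
      simp only [NatExpr.eval, NatExpr.eval_reg, e13, RamState.setNat_nat_same, hs',
        Nat.lt_succ_iff_lt_or_eq]
      by_cases hj : j = s.nat 13 0 0
      · by_cases hy : y = x
        · simp [hj, hy]
        · simp [hj, hy]
      · simp [hj]
  · have e13 : s₁.nat 13 = s.nat 13 := hf₁.nat 13 (by simp)
    have e22 : s₁.nat 22 = s.nat 22 := hf₁.nat 22 (by simp)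
    have e32 : s₁.nat 32 = s.nat 32 := hf₁.nat 32 (by simp)
    have e33 : s₁.nat 33 = s.nat 33 := hf₁.nat 33 (by simp)
    have ew : s₁.wt = s.wt := funext fun b => hf₁.wt b (by simp)
    refine .seq (.setW (.seq (.set (by simp; omega) (.seq (.set (by simp [e22, h22, hfW]) (.set
      (by simp [e13, hp]) ⟨by omega, by simp [e13], ?_⟩))))))
    refine h.append (i₀ := i) (f₀ := f) (by simp [e13]) ⟨?_, ?_, fun x hx => ?_, ?_⟩ (fun j hj x => ?_)
      (fun j hj => ?_) (fun j hj => ?_) (fun j hj => ?_) (fun j hj => ?_) hQ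
    · simp [e13]
    · simp [e13, e22, h22]
    · simp [h₁, hx]
    · simp [e13, e22, h22, ew, hiq.ne]
    · simp [h₁, hj]
    · simp [e13, e32, hj]
    · simp [e13, e33, hj]
    · simp [e13, ew, hj]
    · simp [ew, hj.ne]

/-- Codes are tried in increasing order, so after `c` rounds the list holds the copies of earlier
members of the family and those of the `i`-th one with code below `c`. -/
theorem exec_listCopies (i : Fin q) (hn : s.nat 0 0 0 = n) (hn0 : 0 < n)
    (hG : ∀ u v : Fin n, (G.Adj u v → s.nat 1 u v = 1) ∧ (¬ G.Adj u v → s.nat 1 u v = 0))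
    (hnW : n ≤ W) (hqW : q ≤ W) (hr : size i ≤ r) (hp : s.nat 13 0 0 + n ^ r ≤ W)
    (h : IsCopyList G F r (fun j _ => (j : ℕ) < i) s) :
    Exec W (listCopies q r i (F i)) s fun t s' => t ≤ n ^ r * (r + 8) + 2 ∧
      s'.nat 13 0 0 ≤ s.nat 13 0 0 + n ^ r ∧ IsCopyList G F r (fun j _ => (j : ℕ) < i + 1) s' := by
  have hnr : n ^ size i ≤ n ^ r := Nat.pow_le_pow_right hn0 hr
  refine (Exec.forLoop (n := n ^ size i) (r + 6) (fun c s' =>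
      s'.nat 13 0 0 ≤ s.nat 13 0 0 + c ∧
      IsCopyList G F r (fun j d => (j : ℕ) < i ∨ j = i ∧ d < c) s') ?_ (by omega) ?_
    ⟨by simp, h.congr (by simp)⟩ ?_ ?_).mono ?_
  · intro hw
    simp only [WritesNat, or_false] at hw
    have := writesNat_appendCopy hw
    omega
  · intro s' hf
    have := hf.nat 0 fun hw => by have := writesNat_listCopies hw; omega
    simp [this, hn]
  · rintro c s' x ⟨h1, h2, h3, h4⟩
    refine ⟨by simpa using h1, ?_, ?_, ?_⟩
    · intro j hj
      obtain ⟨i, f, k1, k2⟩ := h2 j (by simpa using hj)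
      exact ⟨i, f, k1, k2.congr (by simp) (by simp) (by simp) (by simp) (by simp)⟩
    · intro i f hf
      obtain ⟨j, hj, k⟩ := h3 i f hf
      exact ⟨j, by simpa using hj, k.congr (by simp) (by simp) (by simp) (by simp) (by simp)⟩
    · intro j hj
      exact h4 j (by simpa using hj)
  · intro c s' hc hf h22 ⟨h1, h2⟩
    have e0 := hf.nat 0 fun hw => by have := writesNat_listCopies hw; omega
    have e1 := hf.nat 1 fun hw => by have := writesNat_listCopies hw; omega
    have htest := NatExpr.eval_isCopyCode_ne_zero (s := s') (G := G) (F i) (c := .reg 22)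
      (by rw [e0, hn]) (by rw [e1]; exact hG) (by simpa [h22] using hc)
    simp only [NatExpr.eval_reg, h22] at htest
    refine .cond (fun he => ?_) fun he => .skip ⟨by omega, by omega, h2.congr fun j g => ?_⟩
    · obtain ⟨f, hfc⟩ := htest.mp he
      refine (exec_appendCopy (i := i) (f := f) (Q' := fun j d => (j : ℕ) < i ∨ j = i ∧ d < c + 1)
        (by rw [e0, hn]) hn0 hnW hqW (by omega) (by omega) (by rw [h22, hfc]) h2 fun j g => ?_).mono
        fun t s'' _ h'' => ⟨by omega, by omega, h''.2.2⟩
      rw [hfc, Nat.lt_succ_iff_lt_or_eq]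
      tauto
    · rw [Nat.lt_succ_iff_lt_or_eq]
      refine or_congr_right (and_congr_right ?_)
      rintro rfl
      refine or_iff_left ?_
      rintro rfl
      exact htest.mpr ⟨g, rfl⟩ he
  · intro t s' _ ⟨ht, h1, h2⟩
    refine ⟨?_, by omega, h2.congr fun j g => ?_⟩
    · have := Nat.mul_le_mul_right (r + 6 + 2) hnr
      have h3 : r + 6 + 2 = r + 8 := rfl
      rw [h3] at ht this
      omega
    · rw [Nat.lt_succ_iff_lt_or_eq]
      refine or_congr_right ⟨fun hj => ?_, fun hj => congrArg Fin.val hj.1⟩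
      obtain rfl : j = i := Fin.ext hj
      exact ⟨rfl, mapCode_lt _⟩

theorem exec_listAllCopies (hn : s.nat 0 0 0 = n) (hn0 : 0 < n)
    (hG : ∀ u v : Fin n, (G.Adj u v → s.nat 1 u v = 1) ∧ (¬ G.Adj u v → s.nat 1 u v = 0))
    (hnW : n ≤ W) (hqW : q ≤ W) (hr : ∀ i, size i ≤ r) (hqnW : q * n ^ r ≤ W)
    (hp : s.nat 13 0 0 = 0) (hw : s.wt q = 0) :
    Exec W (listAllCopies r F) s fun t s' => t ≤ q * (n ^ r * (r + 8) + 2) + 1 ∧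
      s'.nat 13 0 0 ≤ q * n ^ r ∧ IsCopyList G F r (fun _ _ => True) s' := by
  refine (Exec.seqRange (n ^ r * (r + 8) + 2) (fun i s' => s'.nat 13 0 0 ≤ i * n ^ r ∧
    IsCopyList G F r (fun j _ => (j : ℕ) < i) s') ⟨by omega, by simp [hp], by simp, by simp [hw]⟩
    fun i s' hi hf ⟨h1, h2⟩ => ?_).mono fun t s' _ ⟨ht, h1, h2⟩ => ⟨ht, h1, h2.congr (by simp)⟩
  have e0 := hf.nat 0 fun hw => by have := writesNat_listAllCopies hw; omega
  have e1 := hf.nat 1 fun hw => by have := writesNat_listAllCopies hw; omega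
  have hiq : (i + 1) * n ^ r ≤ q * n ^ r := Nat.mul_le_mul_right _ hi
  rw [add_mul, one_mul] at hiq
  rw [dif_pos hi]
  refine (exec_listCopies (i := ⟨i, hi⟩) (by rw [e0, hn]) hn0 (by rw [e1]; exact hG) hnW hqW (hr _)
    (by omega) h2).mono fun t s'' _ h'' => ⟨h''.1, ?_, h''.2.2⟩
  have := h''.2.1
  rw [add_mul, one_mul]
  omega

theorem exec_writeSubgraphs {c p : ℕ} (hpW : p ≤ W) (hc : s.nat 30 0 0 = c) (hcp : c ≤ p)
    (h32 : ∀ x < c, s.nat 32 (s.nat 31 0 x) 0 ≤ W) (h33 : ∀ x < c, s.nat 33 (s.nat 31 0 x) 0 ≤ W) :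
    Exec W writeSubgraphs s fun t s' => t ≤ p * 4 + 3 ∧ s'.nat 11 0 0 = c ∧
      ∀ x < c, s'.nat 12 x 0 = s.nat 32 (s.nat 31 0 x) 0 ∧
        s'.nat 12 x 1 = s.nat 33 (s.nat 31 0 x) 0 := by
  refine .seq ((Exec.forLoop (n := c) 2 (fun i s' => ∀ x < i,
      s'.nat 12 x 0 = s.nat 32 (s.nat 31 0 x) 0 ∧ s'.nat 12 x 1 = s.nat 33 (s.nat 31 0 x) 0)
    (by simp) (by omega) ?_ (by simp) (fun i s' x h => by simpa using h) ?_).mono ?_)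
  · intro s' hf
    simp [hf.nat 30 (by simp), hc]
  · intro i s' hi hf hci k1
    have e31 : s'.nat 31 = s.nat 31 := hf.nat 31 (by simp)
    have e32 : s'.nat 32 = s.nat 32 := hf.nat 32 (by simp)
    have e33 : s'.nat 33 = s.nat 33 := hf.nat 33 (by simp)
    refine .seq (.set (by simpa [e31, e32, hci] using h32 i hi)
      (.set (by simpa [e31, e33, hci] using h33 i hi) ⟨by omega, fun x hx => ?_⟩))
    by_cases h : x = i
    · simp [e31, e32, e33, hci, h]
    · simpa [e31, e32, e33, hci, h] using k1 x (by omega)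
  · intro t s' hf ⟨ht, k1⟩
    have e30 : s'.nat 30 0 0 = c := by rw [hf.nat 30 (by simp), hc]
    exact .set (by simp [e30]; omega) ⟨by omega, by simp [e30], fun x hx => by simpa using k1 x hx⟩

end RamProgram

/-- The indexed family consists of copies rather than subgraphs, and the map `S` from indices to
subgraphs need not be injective. Optimal solutions still correspond: `S` is injective on scattered
sets, and a right inverse of `S` turns packings into scattered sets of the same weight. -/
theorem exists_program_subgraph_packing (q : ℕ) (size : Fin q → ℕ)
    (F : ∀ i, SimpleGraph (Fin (size i))) (k : ℕ) (hq : 0 < q) (hF : ∀ i, (F i).Connected)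
    (hk : 1 ≤ k) :
    ∃ (P : RamProgram) (C : ℕ), ∀ (n m : ℕ) (G : SimpleGraph (Fin n))
      (D : TreeDecomposition G (Fin m)) (w : subgraphsIsoTo G F → ℚ≥0),
      0 < n → D.independenceNumber ≤ k →
      ∀ s : RamState, RepresentsFPackingInput s G D F w →
        ∃ (t : ℕ) (s' : RamState), Runs (C * (n * m) ^ C) P s t s' ∧
          t ≤ C * (n ^ (Finset.univ.sup size * (k + 1)) * m) ∧
          ∃ I : Finset (subgraphsIsoTo G F), OutputsSubgraphs s' F I ∧
            IsMaxWeightIndependentPacking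
              (fun H : subgraphsIsoTo G F => (H : G.Subgraph)) w I := by
  classical
  set r := Finset.univ.sup size with hrdef
  have hsize : ∀ i, size i ≤ r := fun i => Finset.le_sup (Finset.mem_univ i)
  have hsize1 : ∀ i, 1 ≤ size i := fun i => by
    obtain ⟨x⟩ := (hF i).nonempty
    exact x.pos
  have hr : 1 ≤ r := (hsize1 ⟨0, hq⟩).trans (hsize _)
  set a := q * (r + 14) + 4 with ha
  set c := q + 1 with hcdef
  set C := (90 + a) * c ^ (k + 1) + r * (k + 1) with hCdef
  refine ⟨.seq (RamProgram.listAllCopies r F) (.seq (RamProgram.solve q k r)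
    RamProgram.writeSubgraphs), C, fun n m G D w hn hD s hs => ?_⟩
  obtain ⟨hs1, hs2, hs3, hs4⟩ := hs
  have hm : 1 ≤ m := by
    obtain ⟨t⟩ := D.isTree.connected.nonempty
    exact t.pos
  have hnr : 1 ≤ n ^ r := Nat.pow_pos hn
  -- The number of copies is not known before they are listed, so the word bounds for the listing
  -- come from its upper bound `q * n ^ r`; the bounds for the actual `p` follow afterwards.
  have hp₀ : q * n ^ r + 1 ≤ c * n ^ r := by rw [hcdef, add_mul]; omega
  obtain ⟨b1, b2, b3, -, b5, -⟩ := packing_bounds (a := a) (C := C) hn hm hr hk (by omega) hp₀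
    hCdef.ge
  have hqnW : q * n ^ r ≤ C * (n * m) ^ C := by
    exact ((Nat.le_succ _).trans (Nat.le_mul_of_pos_right _ (Nat.succ_pos m))).trans b5
  have hqW : q ≤ C * (n * m) ^ C := (Nat.le_mul_of_pos_right _ hnr).trans hqnW
  refine RamProgram.Exec.seq ((RamProgram.exec_listAllCopies (G := G) (r := r) hs1.1 hn hs1.2.2.1 b1 hqW
    hsize hqnW (by rw [hs3 13 (by omega)]; rfl) (hs4 q le_rfl)).mono fun t₁ s₁ hf₁ h₁ => ?_)
  obtain ⟨ht₁, hple, hlist⟩ := h₁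
  set p := s₁.nat 13 0 0 with hpdef
  obtain ⟨-, -, -, b4, b5', b6⟩ := packing_bounds (p := p) (a := a) (C := C) hn hm hr hk
    (by omega : 1 ≤ c) (by omega) hCdef.ge
  have hnat : ∀ b, b ≠ 22 → b ≠ 14 → b ≠ 32 → b ≠ 33 → b ≠ 13 → s₁.nat b = s.nat b :=
    fun b h1 h2 h3 h4 h5 => hf₁.nat b fun hw => by
      have := RamProgram.writesNat_listAllCopies hw
      omega
  have hwt : ∀ b, b ≠ q → s₁.wt b = s.wt b := fun b hb => hf₁.wt b fun hw =>
    hb (RamProgram.writesWt_listAllCopies hw)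
  have hs1' : RepresentsDecomposedGraph s₁ G D := by
    unfold RepresentsDecomposedGraph at hs1 ⊢
    rwa [hnat 0, hnat 1, hnat 2, hnat 3, hnat 4, hnat 5] <;> omega
  choose idx copy _ hentry using fun j : Fin p => hlist.sound j j.2
  let v : Fin p → Fin r → Fin n := fun j x => copy j ⟨x % size (idx j), Nat.mod_lt _ (hsize1 _)⟩
  have hv : ∀ (j : Fin p) (x : Fin r), s₁.nat 14 j x = v j x := fun j x => by
    rw [(hentry j).vertex x x.2]
    exact digit_mapCode (copy j) ⟨x % size (idx j), Nat.mod_lt _ (hsize1 _)⟩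
  have hrange : ∀ j, Set.range (v j) = Set.range (copy j) := fun j => by
    ext z
    constructor
    · rintro ⟨x, rfl⟩
      exact ⟨_, rfl⟩
    · rintro ⟨x, rfl⟩
      exact ⟨⟨x, x.2.trans_le (hsize _)⟩, congrArg (copy j) (Fin.ext (Nat.mod_eq_of_lt x.2))⟩
  let S : Fin p → subgraphsIsoTo G F := fun j =>
    ⟨(copy j).toSubgraph, idx j, ⟨(copy j).isoToSubgraph⟩⟩
  have hSv : ∀ j, (S j).1.verts = Set.range (v j) := fun j => by
    rw [hrange]
    simp [S]
  have hSsurj : Function.Surjective S := by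
    rintro ⟨H, i, hi⟩
    obtain ⟨f, -, rfl⟩ := SimpleGraph.Copy.toSubgraph_surjOn (show H ∈ {B' | Nonempty (F i ≃g B'.coe)}
      from hi)
    obtain ⟨j, hj, he⟩ := hlist.complete i f trivial
    have h1 := (hentry ⟨j, hj⟩).index
    have h2 := (hentry ⟨j, hj⟩).code
    rw [he.index] at h1
    rw [he.code] at h2
    refine ⟨⟨j, hj⟩, Subtype.ext ?_⟩
    obtain rfl : i = idx ⟨j, hj⟩ := Fin.ext h1
    exact congrArg SimpleGraph.Copy.toSubgraph
      (DFunLike.coe_injective (mapCode_injective _ _ h2) : f = copy ⟨j, hj⟩).symm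
  have hcw : ∀ j : Fin p, s₁.wt q j 0 = w (S j) := fun j => by
    rw [(hentry j).weight, hwt _ (idx j).2.ne]
    exact hs2 (idx j) (copy j) (S j) rfl
  have hconn : ∀ j, G.ConnectedOn (Set.range (v j)) := fun j => by
    rw [hrange]
    exact SimpleGraph.connectedOn_of_preconnected (hF (idx j)).preconnected (copy j)
      fun x y hxy => (copy j).toHom.map_adj hxy
  refine .seq ((RamProgram.exec_solve (w := fun j => s₁.wt q j 0) hs1' hk hr hD b1 b4 b5' rfl hv hconn
    (fun _ => rfl) (fun j => ?_) (hlist.weight p le_rfl) ?_ ?_ ?_).mono fun t₂ s₂ hf₂ h₂ => ?_)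
  · by_cases hj : j < p
    · rw [hcw ⟨j, hj⟩]; exact (w _).2
    · exact (hlist.weight j (not_lt.mp hj)).ge
  · intro x h15 _ h22 _ _ _ _
    rw [hnat x] <;> first | omega | exact hs3 x (by omega)
  · rw [hwt _ (by omega)]; exact hs4 _ (by omega)
  · rw [hwt _ (by omega)]; exact hs4 _ (by omega)
  obtain ⟨ht₂, hcnt, I, ⟨e, he, her, hes⟩, hI, hmax⟩ := h₂
  have hfix : ∀ b, 31 < b → s₂.nat b = s₁.nat b := fun b hb => hf₂.nat b (by
    simp [RamProgram.solve, RamProgram.listOptimum, RamProgram.testMember, RamProgram.appendMember]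
    omega)
  have h32 : ∀ x : Fin (s₂.nat 30 0 0), s₂.nat 32 (s₂.nat 31 0 x) 0 = idx (e x) := fun x => by
    rw [hes, hfix 32 (by omega), (hentry _).index]
  have h33 : ∀ x : Fin (s₂.nat 30 0 0), s₂.nat 33 (s₂.nat 31 0 x) 0 = mapCode (copy (e x)) :=
    fun x => by rw [hes, hfix 33 (by omega), (hentry _).code]
  refine (RamProgram.exec_writeSubgraphs (hple.trans hqnW) rfl hcnt (fun x hx => ?_)
    fun x hx => ?_).mono fun t₃ s₃ _ h₃ => ?_
  · rw [h32 ⟨x, hx⟩]; exact (idx _).2.le.trans hqW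
  · rw [h33 ⟨x, hx⟩]
    exact ((mapCode_lt _).le.trans (Nat.pow_le_pow_right hn (hsize _))).trans b2
  obtain ⟨ht₃, h11, h12⟩ := h₃
  have hpair : ∀ a b : Fin p, (∀ x y, v a x ≠ v b y ∧ ¬ G.Adj (v a x) (v b y)) ↔
      Disjoint (S a).1.verts (S b).1.verts ∧
        ∀ x ∈ (S a).1.verts, ∀ y ∈ (S b).1.verts, ¬ G.Adj x y := fun a b => by
    rw [hSv, hSv, forall_ne_and_not_adj_iff]
  -- Two listings of one subgraph share its vertices, and there is at least one since `r ≥ 1`; so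
  -- they are not both in a scattered set.
  have hinj : Set.InjOn S I := by
    intro a ha b hb hab
    by_contra hne
    have h1 := ((hpair a b).mp (hI a ha b hb hne)).1
    rw [hab, hSv] at h1
    exact Set.disjoint_left.mp h1 (Set.mem_range_self (⟨0, hr⟩ : Fin r))
      (Set.mem_range_self (⟨0, hr⟩ : Fin r))
  refine ⟨?_, I.image S, ⟨?_, ?_⟩⟩
  · have h1 : q * (n ^ r * (r + 8) + 2) + 1 + (p * 4 + 3) ≤ a * n ^ r := by
      have h2 : q ≤ q * n ^ r := Nat.le_mul_of_pos_right _ hnr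
      have h3 : a * n ^ r = q * (n ^ r * (r + 8)) + 6 * (q * n ^ r) + 4 * n ^ r := by rw [ha]; ring
      rw [mul_add q]
      omega
    omega
  · rw [OutputsSubgraphs, h11]
    refine ⟨fun x => S (e x), fun x y hxy => he (hinj ?_ ?_ hxy), ?_, fun x => ?_⟩
    · rw [← her]; exact Set.mem_range_self _
    · rw [← her]; exact Set.mem_range_self _
    · rw [Finset.coe_image, ← her, ← Set.range_comp]
      rfl
    · obtain ⟨h1, h2⟩ := h12 x x.2
      exact ⟨idx (e x), copy (e x), h1.trans (h32 x), h2.trans (h33 x), rfl⟩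
  · refine ⟨?_, fun I' hI' => ?_⟩
    · intro x hx y hy hxy
      obtain ⟨a, ha, rfl⟩ := Finset.mem_image.mp hx
      obtain ⟨b, hb, rfl⟩ := Finset.mem_image.mp hy
      exact (hpair a b).mp (hI a ha b hb fun h => hxy (congrArg S h))
    -- Choosing one listing per subgraph lets every packing `I'` compete with `I`.
    · obtain ⟨J, hJ⟩ := hSsurj.hasRightInverse
      have h1 : IsScattered G v (I'.image J) := by
        intro a ha b hb hab
        obtain ⟨x, hx, rfl⟩ := Finset.mem_image.mp ha
        obtain ⟨y, hy, rfl⟩ := Finset.mem_image.mp hb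
        rw [hpair, hJ, hJ]
        exact hI' x hx y hy fun h => hab (congrArg J h)
      have h2 := hmax _ h1
      rw [Finset.sum_image hJ.injective.injOn] at h2
      simp only [hcw, hJ _] at h2
      rw [Finset.sum_image hinj]
      exact_mod_cast h2

theorem mainTheorem11 :
    (∀ k r : ℕ, 1 ≤ k → 1 ≤ r →
      ∃ (P : RamProgram) (C : ℕ), ∀ (n m p : ℕ) (G : SimpleGraph (Fin n))
        (D : TreeDecomposition G (Fin m)) (H : Fin p → G.Subgraph) (w : Fin p → ℚ≥0),
        0 < n → D.independenceNumber ≤ k →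
        Function.Injective H → (∀ j, (H j).Connected) → (∀ j, (H j).verts.ncard ≤ r) →
        ∀ s : RamState, RepresentsPackingInput s G D H w →
          ∃ (t : ℕ) (s' : RamState), Runs (C * (n * m) ^ C) P s t s' ∧
            t ≤ C * (n ^ (r * (k + 1)) * m) ∧
            ∃ I : Finset (Fin p), OutputsIndexSet s' I ∧ IsMaxWeightIndependentPacking H w I) ∧
    (∀ (q : ℕ) (size : Fin q → ℕ) (F : ∀ i, SimpleGraph (Fin (size i))) (k : ℕ),
      0 < q → (∀ i, (F i).Connected) → 1 ≤ k →
      ∃ (P : RamProgram) (C : ℕ), ∀ (n m : ℕ) (G : SimpleGraph (Fin n))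
        (D : TreeDecomposition G (Fin m)) (w : subgraphsIsoTo G F → ℚ≥0),
        0 < n → D.independenceNumber ≤ k →
        ∀ s : RamState, RepresentsFPackingInput s G D F w →
          ∃ (t : ℕ) (s' : RamState), Runs (C * (n * m) ^ C) P s t s' ∧
            t ≤ C * (n ^ (Finset.univ.sup size * (k + 1)) * m) ∧
            ∃ I : Finset (subgraphsIsoTo G F), OutputsSubgraphs s' F I ∧
              IsMaxWeightIndependentPacking
                (fun H : subgraphsIsoTo G F => (H : G.Subgraph)) w I) :=
  ⟨exists_program_packing, exists_program_subgraph_packing⟩
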